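/- Let $C$ be a Riemann surface with a spin structure $T^*_{C,-}$, i.e. a holomorphic line bundle with an isomorphism $T^*_{C,-}\otimes T^*_{C,-}\cong\omega_C$; locally, choose holomorphic coordinates $x$ and frames $\theta$ of $T^*_{C,-}$ with $\theta\otimes\theta\mapsto dx$, so that on overlaps $y=f(x)$, $\eta=\zeta(x)\theta$ and $\zeta^2=f'$. Let $S(C,T^*_{C,-})^\infty$ be the smooth supermanifold with local coordinates $(x,\tilde x|\theta)$ and $\tilde\partial=d\tilde x\,\partial/\partial\tilde x$ its complex structure; this is a super Riemann surface, with superconformal structure generated by $D=\partial/\partial\theta+\theta\,\partial/\partial x$. Let $n\ge 0$ and let $\xi_1,\dots,\xi_n$ be the odd coordinates of $\mathbb A^{0|n}_{\mathbb C}$. A vector field $W=a\,\partial/\partial x+b\,\partial/\partial\theta$ on $S(C,T^*_{C,-})^\infty\times\mathbb A^{0|n}_{\mathbb C}$ (along the fibres over $\mathbb A^{0|n}_{\mathbb C}$, with smooth coefficients $a,b$ depending on $(x,\tilde x|\theta,\xi)$) is called superconformal if $[W,D]=fD$ for some function $f$; similarly for vector $(0,1)$-forms $d\tilde x\,W$.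 An analytic deformation $\mathcal X^\infty$ of this super Riemann surface over $\mathbb A^{0|n}_{\mathbb C}$ is a complex structure $\tilde\partial_\xi=\tilde\partial-\varphi(\xi)$ on $S(C,T^*_{C,-})^\infty\times\mathbb A^{0|n}_{\mathbb C}$, where $\varphi(\xi)$ is a global smooth even superconformal vector $(0,1)$-form which vanishes modulo $(\xi_1,\dots,\xi_n)$ and, writing locally $\varphi(\xi)\equiv\sum_i\xi_i\,\chi^i\left(\frac{\partial}{\partial\theta}-\theta\frac{\partial}{\partial x}\right)$ modulo $(\xi)^2$, satisfies $\partial\chi^i\otimes\chi^j-\chi^i\otimes\partial\chi^j=0$ for all $i,j$. It is trivial to second order if there is a global smooth even superconformal vector field $\nu$, vanishing modulo $(\xi)$, with $e^{-\nu}\tilde\partial_\xi e^{\nu}\equiv\tilde\partial$ modulo $(\xi)^3$. The odd cotangent bundle $T^*_{\mathcal X^{\mathrm{an.}},-}$ is the holomorphic vector bundle of rank $n+1$ on $C$ whose underlying smooth bundle is $T^*_{C,-}\oplus\underline{\mathbb C}^n$ (with local frame $\theta,\xi_1,\dots,\xi_n$) and whose holomorphic sections are those annihilated by the operator induced by $\tilde\partial_\xi$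 modulo the square of the ideal $(\theta,\xi)$; i.e. $u\,\theta+\sum_i v_i\,\xi_i$ is holomorphic if and only if $\bar\partial u=0$ and $\bar\partial v_i=\chi^i u$ for all $i$. A complex supermanifold modelled on $(C,E)$, for a holomorphic vector bundle $E$ on $C$, is a sheaf $\mathcal O$ of $\mathbb C$-superalgebras on $C$, together with identifications $\mathcal O/J\cong\mathcal O_C$ and $J/J^2\cong E$ (where $J$ is the ideal generated by the odd elements), such that $\mathcal O$ is locally isomorphic to $\wedge^\bullet E$ compatibly with these identifications. It is split if it is isomorphic, as a superspace, to the split model $S(C,E)=(C,\wedge^\bullet E)$, and non-split otherwise. Theorem. If the analytic deformation $\mathcal X^\infty$ is not trivial to second order, then there exists a non-split complex supermanifold modelled on $(C,T^*_{\mathcal X^{\mathrm{an.}},-})$. -/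

import Mathlib

open scoped Manifold ContDiff
open CategoryTheory TopologicalSpace Opposite

universe u

noncomputable section
namespace SuperRiemann

/-- The algebra `ℂ[θ, ξ₁, …, ξₙ]` of odd coordinates: the exterior algebra on `n + 1` generators,
generator `0` being `θ` and generator `i + 1` being the parameter `ξ_{i+1}` of `𝔸^{0|n}`. -/
abbrev Grass (n : ℕ) : Type := ExteriorAlgebra ℂ (Fin (n + 1) → ℂ)

section Grass
variable {n : ℕ}

/-- The monomial basis of `ℂ[θ, ξ]`. -/
def Grass.basis (n : ℕ) : Module.Basis (Finset (Fin (n + 1))) ℂ (Grass n) :=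
  (Pi.basisFun ℂ (Fin (n + 1))).ExteriorAlgebra

/-- `ℂ[θ, ξ]` is finite-dimensional; we give it some (submultiplicative) norm in order to
differentiate functions with values in it. Nothing depends on the choice of this norm. -/
instance : NormedRing (Grass n) :=
  letI := Matrix.linftyOpNormedRing (n := Finset (Fin (n + 1))) (α := ℂ)
  NormedRing.induced (Grass n) (Matrix (Finset (Fin (n + 1))) (Finset (Fin (n + 1))) ℂ)
    (Algebra.leftMulMatrix (Grass.basis n)) (Algebra.leftMulMatrix_injective _)

instance : NormedAlgebra ℂ (Grass n) :=
  letI := Matrix.linftyOpNormedRing (n := Finset (Fin (n + 1))) (α := ℂ)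
  letI := Matrix.linftyOpNormedAlgebra (n := Finset (Fin (n + 1))) (α := ℂ) (R := ℂ)
  NormedAlgebra.induced ℂ (Grass n) (Matrix (Finset (Fin (n + 1))) (Finset (Fin (n + 1))) ℂ)
    (Algebra.leftMulMatrix (Grass.basis n))

instance : FiniteDimensional ℂ (Grass n) := (Grass.basis n).finiteDimensional_of_finite

/-- The odd coordinate `θ`. -/
def theta : Grass n := ExteriorAlgebra.ι ℂ (Pi.single 0 1)

/-- The odd parameter `ξ_i`. -/
def xi (i : Fin n) : Grass n := ExteriorAlgebra.ι ℂ (Pi.single i.succ 1)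

/-- The parity involution: `+1` on even elements and `-1` on odd elements. -/
def parity : Grass n →ₐ[ℂ] Grass n :=
  CliffordAlgebra.involute (Q := (0 : QuadraticForm ℂ (Fin (n + 1) → ℂ)))

/-- The odd (left) derivative with respect to the `j`-th generator: `∂/∂θ` for `j = 0` and
`∂/∂ξ_i` for `j = i.succ`. -/
def dOdd (j : Fin (n + 1)) : Grass n →ₗ[ℂ] Grass n :=
  CliffordAlgebra.contractLeft (Q := (0 : QuadraticForm ℂ (Fin (n + 1) → ℂ))) (LinearMap.proj j)

/-- The value at `θ = 0`, `ξ = 0`. -/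
def body : Grass n →ₐ[ℂ] ℂ := ExteriorAlgebra.algebraMapInv

/-- The homogeneous component of degree `k` in the generators `θ, ξ`. -/
def degPart (k : ℕ) : Grass n →ₗ[ℂ] Grass n :=
  GradedAlgebra.proj (fun i : ℕ => ⋀[ℂ]^i (Fin (n + 1) → ℂ)) k

/-- The substitution `θ ↦ c θ`, `ξ_i ↦ ξ_i`. -/
def rescale (c : ℂ) : Grass n →ₐ[ℂ] Grass n :=
  ExteriorAlgebra.map (LinearMap.pi fun j => (if j = 0 then c else 1) • LinearMap.proj j)

/-- The ideal `(ξ₁, …, ξₙ)`. -/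
def xiIdeal (n : ℕ) : Ideal (Grass n) := Ideal.span (Set.range xi)

/-- The ideal `(ξ₁, …, ξₙ)³`. -/
def xiIdealCubed (n : ℕ) : Ideal (Grass n) :=
  Ideal.span {x | ∃ i j k : Fin n, x = xi i * xi j * xi k}

theorem parity_parity (x : Grass n) : parity (parity x) = x :=
  CliffordAlgebra.involute_involute (Q := (0 : QuadraticForm ℂ (Fin (n + 1) → ℂ))) x


theorem dOdd_algebraMap (j : Fin (n + 1)) (r : ℂ) : dOdd j (algebraMap ℂ (Grass n) r) = 0 :=
  CliffordAlgebra.contractLeft_algebraMap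
    (Q := (0 : QuadraticForm ℂ (Fin (n + 1) → ℂ))) (LinearMap.proj j) r

theorem dOdd_mul (j : Fin (n + 1)) (x y : Grass n) :
    dOdd j (x * y) = dOdd j x * y + parity x * dOdd j y := by
  induction x using ExteriorAlgebra.induction generalizing y with
  | algebraMap r =>
    have h1 := CliffordAlgebra.contractLeft_algebraMap_mul
      (Q := (0 : QuadraticForm ℂ (Fin (n + 1) → ℂ))) (LinearMap.proj j) r y
    have h2 := CliffordAlgebra.contractLeft_algebraMap
      (Q := (0 : QuadraticForm ℂ (Fin (n + 1) → ℂ))) (LinearMap.proj j) r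
    have h3 : parity (algebraMap ℂ (Grass n) r) = algebraMap ℂ (Grass n) r := parity.commutes r
    change dOdd j (algebraMap ℂ (Grass n) r * y) = algebraMap ℂ (Grass n) r * dOdd j y at h1
    change dOdd j (algebraMap ℂ (Grass n) r) = 0 at h2
    change dOdd j (algebraMap ℂ (Grass n) r * y) = dOdd j (algebraMap ℂ (Grass n) r) * y +
      parity (algebraMap ℂ (Grass n) r) * dOdd j y
    rw [h1, h2, h3, zero_mul, zero_add]
  | ι v =>
    have h1 := CliffordAlgebra.contractLeft_ι_mul
      (Q := (0 : QuadraticForm ℂ (Fin (n + 1) → ℂ))) (LinearMap.proj j) v y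
    have h2 := CliffordAlgebra.contractLeft_ι
      (Q := (0 : QuadraticForm ℂ (Fin (n + 1) → ℂ))) (LinearMap.proj j) v
    have h3 := CliffordAlgebra.involute_ι (Q := (0 : QuadraticForm ℂ (Fin (n + 1) → ℂ))) v
    let w : Grass n := ExteriorAlgebra.ι ℂ v
    change dOdd j (w * y) = (LinearMap.proj (R := ℂ) (φ := fun _ => ℂ) j v) • y - w * dOdd j y at h1
    change dOdd j w = algebraMap ℂ (Grass n) _ at h2
    change parity w = -w at h3
    change dOdd j (w * y) = dOdd j w * y + parity w * dOdd j y
    rw [h1, h2, h3, Algebra.smul_def, neg_mul, sub_eq_add_neg]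
  | mul a b ha hb =>
    change dOdd j ((a : Grass n) * b * y) = dOdd j ((a : Grass n) * b) * y +
      parity ((a : Grass n) * b) * dOdd j y
    rw [mul_assoc, ha, hb, ha, map_mul]
    noncomm_ring
  | add a b ha hb =>
    change dOdd j (((a : Grass n) + b) * y) = dOdd j ((a : Grass n) + b) * y +
      parity ((a : Grass n) + b) * dOdd j y
    rw [add_mul, map_add, ha, hb, map_add, map_add]
    noncomm_ring

theorem parity_ι (v : Fin (n + 1) → ℂ) :
    parity (ExteriorAlgebra.ι ℂ v : Grass n) = -(ExteriorAlgebra.ι ℂ v : Grass n) :=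
  CliffordAlgebra.involute_ι (Q := (0 : QuadraticForm ℂ (Fin (n + 1) → ℂ))) v

theorem dOdd_parity (j : Fin (n + 1)) (x : Grass n) :
    dOdd j (parity x) = -parity (dOdd j x) := by
  induction x using ExteriorAlgebra.induction with
  | algebraMap r =>
    have h2 := CliffordAlgebra.contractLeft_algebraMap
      (Q := (0 : QuadraticForm ℂ (Fin (n + 1) → ℂ))) (LinearMap.proj j) r
    have h3 : parity (algebraMap ℂ (Grass n) r) = algebraMap ℂ (Grass n) r := parity.commutes r
    change dOdd j (algebraMap ℂ (Grass n) r) = 0 at h2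
    change dOdd j (parity (algebraMap ℂ (Grass n) r)) = -parity (dOdd j (algebraMap ℂ (Grass n) r))
    rw [h3, h2, map_zero, neg_zero]
  | ι v =>
    have h2 : dOdd j (ExteriorAlgebra.ι ℂ v : Grass n) = algebraMap ℂ (Grass n) (v j) :=
      CliffordAlgebra.contractLeft_ι
      (Q := (0 : QuadraticForm ℂ (Fin (n + 1) → ℂ))) (LinearMap.proj j) v
    rw [parity_ι, map_neg, h2, AlgHom.commutes]
  | mul a b ha hb =>
    rw [map_mul, dOdd_mul, ha, hb, dOdd_mul, map_add, map_mul, map_mul]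
    noncomm_ring
  | add a b ha hb =>
    rw [map_add, map_add, map_add, map_add, ha, hb, neg_add]

theorem ι_mul_parity (v : Fin (n + 1) → ℂ) (x : Grass n) :
    (ExteriorAlgebra.ι ℂ v : Grass n) * parity x = x * (ExteriorAlgebra.ι ℂ v : Grass n) := by
  induction x using ExteriorAlgebra.induction with
  | algebraMap r =>
    have h3 : parity (algebraMap ℂ (Grass n) r) = algebraMap ℂ (Grass n) r := parity.commutes r
    change (ExteriorAlgebra.ι ℂ v : Grass n) * parity (algebraMap ℂ (Grass n) r) =
      algebraMap ℂ (Grass n) r * _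
    rw [h3, Algebra.commutes]
  | ι w =>
    have h := ExteriorAlgebra.ι_add_mul_swap (R := ℂ) v w
    change (ExteriorAlgebra.ι ℂ v : Grass n) * (ExteriorAlgebra.ι ℂ w : Grass n) +
      (ExteriorAlgebra.ι ℂ w : Grass n) * (ExteriorAlgebra.ι ℂ v : Grass n) = 0 at h
    rw [parity_ι, mul_neg, neg_eq_iff_add_eq_zero, h]
  | mul a b ha hb =>
    change (ExteriorAlgebra.ι ℂ v : Grass n) * parity ((a : Grass n) * b) = (a : Grass n) * b * _
    rw [map_mul, ← mul_assoc, ha, mul_assoc, hb, mul_assoc]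
  | add a b ha hb =>
    change (ExteriorAlgebra.ι ℂ v : Grass n) * parity ((a : Grass n) + b) = ((a : Grass n) + b) * _
    rw [map_add, mul_add, ha, hb, add_mul]

theorem exists_degPart_one (x : Grass n) :
    ∃ v : Fin (n + 1) → ℂ, degPart 1 x = (ExteriorAlgebra.ι ℂ v : Grass n) := by
  have h : (degPart 1 x : ExteriorAlgebra ℂ (Fin (n + 1) → ℂ)) ∈ ⋀[ℂ]^1 (Fin (n + 1) → ℂ) :=
    SetLike.coe_mem (DirectSum.decompose
      (fun i : ℕ => ⋀[ℂ]^i (Fin (n + 1) → ℂ)) (x : ExteriorAlgebra ℂ (Fin (n + 1) → ℂ)) 1)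
  rw [ExteriorAlgebra.exteriorPower, pow_one] at h
  obtain ⟨v, hv⟩ := h
  exact ⟨v, hv.symm⟩

theorem rescale_parity (c : ℂ) (x : Grass n) : rescale c (parity x) = parity (rescale c x) := by
  induction x using ExteriorAlgebra.induction with
  | algebraMap r =>
    change rescale c (parity (algebraMap ℂ (Grass n) r)) = parity (rescale c (algebraMap ℂ (Grass n) r))
    simp only [AlgHom.commutes]
  | ι w =>
    have h : ∀ u : Fin (n + 1) → ℂ, rescale c (ExteriorAlgebra.ι ℂ u : Grass n) =
      (ExteriorAlgebra.ι ℂ (LinearMap.pi (fun j => (if j = 0 then c else (1:ℂ)) •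
        LinearMap.proj (R := ℂ) (φ := fun _ => ℂ) j) u) : Grass n) :=
      fun u => ExteriorAlgebra.map_apply_ι _ u
    rw [parity_ι, map_neg, h, parity_ι]
  | mul a b ha hb =>
    simp only [map_mul, ha, hb]
  | add a b ha hb =>
    simp only [map_add, ha, hb]
end Grass

section LocalCalculus

variable {n : ℕ}

/-- The Wirtinger derivative `∂/∂x`. -/
def dx {E : Type*} [NormedAddCommGroup E] [NormedSpace ℂ E] (G : ℂ → E) (z : ℂ) : E :=
  (1 / 2 : ℂ) • (fderiv ℝ G z 1 - Complex.I • fderiv ℝ G z Complex.I)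

/-- The Wirtinger derivative `∂/∂x̃`. -/
def dxbar {E : Type*} [NormedAddCommGroup E] [NormedSpace ℂ E] (G : ℂ → E) (z : ℂ) : E :=
  (1 / 2 : ℂ) • (fderiv ℝ G z 1 + Complex.I • fderiv ℝ G z Complex.I)

/-- The superconformal generator `D = ∂/∂θ + θ ∂/∂x`, acting on superfunctions
`G(x, x̃ | θ, ξ)`, that is, on functions of `x` with values in `ℂ[θ, ξ]`. -/
def superD (G : ℂ → Grass n) (z : ℂ) : Grass n := dOdd 0 (G z) + theta * dx G z

/-- A vector field `cx ∂/∂x + cθ ∂/∂θ` along the fibres of `ℂ^{1|1} × 𝔸^{0|n} → 𝔸^{0|n}`, with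
coefficients superfunctions of `(x, x̃ | θ, ξ)`. -/
structure VField (n : ℕ) where
  cx : ℂ → Grass n
  cθ : ℂ → Grass n

/-- The action of a vector field on superfunctions. -/
def VField.app (W : VField n) (G : ℂ → Grass n) (z : ℂ) : Grass n :=
  W.cx z * dx G z + W.cθ z * dOdd 0 (G z)

/-- `W` is a smooth even superconformal vector field on the open set `V`:
`[W, D] = f D` for some smooth superfunction `f`. -/
structure VField.IsEvenSuperconformalOn (W : VField n) (V : Set ℂ) : Prop where
  smooth_cx : ContDiffOn ℝ ∞ W.cx V
  smooth_cθ : ContDiffOn ℝ ∞ W.cθ V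
  parity_cx : ∀ z ∈ V, parity (W.cx z) = W.cx z
  parity_cθ : ∀ z ∈ V, parity (W.cθ z) = -W.cθ z
  superconformal : ∃ f : ℂ → Grass n, ContDiffOn ℝ ∞ f V ∧
    ∀ G : ℂ → Grass n, ContDiffOn ℝ ∞ G V →
      ∀ z ∈ V, W.app (superD G) z - superD (W.app G) z = f z * superD G z

/-- `W` vanishes modulo the ideal `(ξ₁, …, ξₙ)`. -/
def VField.VanishesModXi (W : VField n) (V : Set ℂ) : Prop :=
  ∀ z ∈ V, W.cx z ∈ xiIdeal n ∧ W.cθ z ∈ xiIdeal n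

/-- The exponential `e^W` up to second order: if `W` vanishes modulo `(ξ)`, then the omitted terms
lie in `(ξ)³`. -/
def VField.expTwo (W : VField n) (G : ℂ → Grass n) (z : ℂ) : Grass n :=
  G z + W.app G z + (1 / 2 : ℂ) • W.app (W.app G) z

end LocalCalculus

section Deformations

variable {C : Type u} [TopologicalSpace C] [ChartedSpace ℂ C]

/-- A spin structure on a Riemann surface `C`, equivalently the super Riemann surface
`S(C, T^*_{C,-})`, presented by a superconformal atlas: holomorphic coordinate charts `x_α`
covering `C`, and odd coordinates `θ_α` with transition functions
`x_β = f_{αβ}(x_α)`, `θ_β = ζ_{αβ}(x_α) θ_α`, where `ζ_{αβ}` is holomorphic, satisfies the cocycle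
condition and `ζ_{αβ}² = ∂f_{αβ}/∂x`. So `T^*_{C,-}` is the holomorphic line bundle with local
frames `θ_α`, and `θ_α ⊗ θ_α ↦ dx_α` is the isomorphism of its square with the canonical bundle. -/
structure SpinAtlas (C : Type u) [TopologicalSpace C] [ChartedSpace ℂ C] where
  /-- the index set of the atlas -/
  ι : Type u
  /-- the coordinate charts -/
  chart : ι → OpenPartialHomeomorph C ℂ
  chart_mem : ∀ α, chart α ∈ IsManifold.maximalAtlas 𝓘(ℂ) ω C
  cover : ∀ p, ∃ α, p ∈ (chart α).source
  /-- the functions `ζ_{αβ}` of the coordinate `x_α` -/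
  root : ι → ι → ℂ → ℂ
  root_holomorphic : ∀ α β, DifferentiableOn ℂ (root α β) ((chart α).symm.trans (chart β)).source
  root_sq : ∀ α β, ∀ z ∈ ((chart α).symm.trans (chart β)).source,
    root α β z ^ 2 = deriv ((chart α).symm.trans (chart β)) z
  root_cocycle : ∀ α β γ, ∀ z ∈ ((chart α).symm.trans (chart β)).source,
    z ∈ ((chart α).symm.trans (chart γ)).source →
    root α γ z = root β γ ((chart α).symm.trans (chart β) z) * root α β z

namespace SpinAtlas

variable (S : SpinAtlas C) {n : ℕ}

/-- The transition function `f_{αβ}`. -/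
def trans (α β : S.ι) : ℂ → ℂ := (S.chart α).symm.trans (S.chart β)

/-- The domain of `f_{αβ}`. -/
def overlap (α β : S.ι) : Set ℂ := ((S.chart α).symm.trans (S.chart β)).source

/-- Pull-back of superfunctions along the transition map
`(x | θ, ξ) ↦ (f_{αβ}(x) | ζ_{αβ}(x) θ, ξ)`. -/
def pullback (α β : S.ι) (G : ℂ → Grass n) (z : ℂ) : Grass n :=
  rescale (S.root α β z) (G (S.trans α β z))

/-- Local vector fields `W_α` glue, up to the factors `c_{αβ}`: on overlaps `W_α = c_{αβ} W_β` as
operators on superfunctions. For `c = 1` this is a global vector field; for `c_{αβ}` the complex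
conjugate of `∂f_{αβ}/∂x` it is a global vector `(0,1)`-form, locally `dx̃_α W_α`. -/
def Glues (c : S.ι → S.ι → ℂ → ℂ) (W : S.ι → VField n) : Prop :=
  ∀ (α β : S.ι) (G : ℂ → Grass n), ContDiffOn ℝ ∞ G (S.chart β).target →
    ∀ z ∈ S.overlap α β,
      (W α).app (S.pullback α β G) z = c α β z • S.pullback α β ((W β).app G) z

end SpinAtlas

/-- An analytic deformation over `𝔸^{0|n}` of the super Riemann surface given by `S`: a complex
structure `∂̃_ξ = ∂̃ - φ(ξ)` on the smooth supermanifold `S(C, T^*_{C,-})^∞ × 𝔸^{0|n}`, where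
`φ(ξ)`, locally `dx̃_α φ_α`, is a smooth even superconformal vector `(0,1)`-form which vanishes
modulo `(ξ)`, such that the Wronskians of the `∂φ/∂ξ_i` at `ξ = 0` vanish.
(There is only one antiholomorphic direction, so `∂̃_ξ² = 0` holds automatically.) -/
structure AnalyticDeformation (S : SpinAtlas C) (n : ℕ) where
  /-- the local expression `φ_α` of `φ(ξ)` -/
  φ : S.ι → VField n
  superconformal : ∀ α, (φ α).IsEvenSuperconformalOn (S.chart α).target
  vanishes : ∀ α, (φ α).VanishesModXi (S.chart α).target
  glues : S.Glues (fun α β z => starRingEnd ℂ (deriv (S.trans α β) z)) φ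
  wronskian : ∀ (α : S.ι) (i j : Fin n), ∀ z ∈ (S.chart α).target,
    dx (fun w => body (dOdd i.succ ((φ α).cθ w))) z * body (dOdd j.succ ((φ α).cθ z))
      - body (dOdd i.succ ((φ α).cθ z)) * dx (fun w => body (dOdd j.succ ((φ α).cθ w))) z = 0

namespace AnalyticDeformation

variable {S : SpinAtlas C} {n : ℕ} (D : AnalyticDeformation S n)

/-- The complex structure `∂̃_ξ = ∂̃ - φ(ξ)` on superfunctions (coefficient of `dx̃_α`). -/
def dbarXi (α : S.ι) (G : ℂ → Grass n) (z : ℂ) : Grass n := dxbar G z - (D.φ α).app G z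

/-- The deformation is trivial to second order: there is a global smooth even superconformal vector
field `ν` vanishing modulo `(ξ)` such that `e^{-ν} ∂̃_ξ e^{ν} = ∂̃` modulo `(ξ)³`. -/
def IsTrivialToSecondOrder : Prop :=
  ∃ ν : S.ι → VField n,
    (∀ α, (ν α).IsEvenSuperconformalOn (S.chart α).target) ∧
    (∀ α, (ν α).VanishesModXi (S.chart α).target) ∧
    S.Glues (fun _ _ _ => 1) ν ∧
    ∀ (α : S.ι) (G : ℂ → Grass n), ContDiffOn ℝ ∞ G (S.chart α).target →
      ∀ z ∈ (S.chart α).target,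
        D.dbarXi α ((ν α).expTwo G) z - (ν α).expTwo (dxbar G) z ∈ xiIdealCubed n

end AnalyticDeformation

end Deformations

section Model

variable {C : Type u} [TopologicalSpace C] [ChartedSpace ℂ C]

namespace SpinAtlas

variable (S : SpinAtlas C) {n : ℕ}

/-- The image of `U` in the coordinate chart `x_α`. -/
def dom (α : S.ι) (U : Opens C) : Set ℂ :=
  (S.chart α).target ∩ (S.chart α).symm ⁻¹' (U : Set C)

theorem isOpen_dom (α : S.ι) (U : Opens C) : IsOpen (S.dom α U) :=
  (S.chart α).isOpen_inter_preimage_symm U.isOpen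

theorem dom_mono {α : S.ι} {U V : Opens C} (h : U ≤ V) : S.dom α U ⊆ S.dom α V :=
  fun _ hz => ⟨hz.1, h hz.2⟩

/-- Families of local superfunctions over `U`. -/
abbrev Fam (n : ℕ) (U : Opens C) : Type u := ∀ α : S.ι, S.dom α U → Grass n

/-- A local superfunction of a family, extended by zero outside its domain. -/
def ext {U : Opens C} (s : S.Fam n U) (α : S.ι) : ℂ → Grass n :=
  Function.extend Subtype.val (s α) 0

/-- Restriction of families. -/
def famRes {U V : Opens C} (h : U ≤ V) : S.Fam n V →ₐ[ℂ] S.Fam n U where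
  toFun s α z := s α ⟨z.1, S.dom_mono h z.2⟩
  map_one' := rfl
  map_mul' _ _ := rfl
  map_zero' := rfl
  map_add' _ _ := rfl
  commutes' _ := rfl

/-- Parity of families. -/
def famParity (U : Opens C) : S.Fam n U →ₐ[ℂ] S.Fam n U where
  toFun s α z := parity (s α z)
  map_one' := by ext; simp
  map_mul' _ _ := by ext; simp
  map_zero' := by ext; simp
  map_add' _ _ := by ext; simp
  commutes' r := by
    funext α z
    exact parity.commutes r

theorem ext_apply {U : Opens C} (s : S.Fam n U) {α : S.ι} {z : ℂ} (hz : z ∈ S.dom α U) :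
    S.ext s α z = s α ⟨z, hz⟩ :=
  Subtype.val_injective.extend_apply (s α) 0 ⟨z, hz⟩

end SpinAtlas

namespace SpinAtlas

variable (S : SpinAtlas C) {n : ℕ}

theorem trans_mem_dom {U : Opens C} {α β : S.ι} {z : ℂ} (hz : z ∈ S.dom α U)
    (hz' : z ∈ S.overlap α β) : S.trans α β z ∈ S.dom β U := by
  simp only [SpinAtlas.overlap, OpenPartialHomeomorph.trans_source, Set.mem_inter_iff,
    OpenPartialHomeomorph.symm_source, Set.mem_preimage] at hz'
  refine ⟨(S.chart β).map_source hz'.2, ?_⟩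
  have h : (S.chart β).symm (S.trans α β z) = (S.chart α).symm z := (S.chart β).left_inv hz'.2
  simpa only [Set.mem_preimage, h] using hz.2

theorem differentiableAt_of_contDiffOn {U : Opens C} {α : S.ι} {G : ℂ → Grass n}
    (h : ContDiffOn ℝ ∞ G (S.dom α U)) {z : ℂ} (hz : z ∈ S.dom α U) : DifferentiableAt ℝ G z :=
  (h.contDiffAt ((S.isOpen_dom α U).mem_nhds hz)).differentiableAt (by simp)

end SpinAtlas

section Operators

variable {n : ℕ}

theorem dxbar_congr {G H : ℂ → Grass n} {z : ℂ} (h : G =ᶠ[nhds z] H) : dxbar G z = dxbar H z := by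
  simp only [dxbar, h.fderiv_eq]

theorem dxbar_const (c : Grass n) (z : ℂ) : dxbar (fun _ => c) z = 0 := by
  simp [dxbar]

theorem dxbar_add {G H : ℂ → Grass n} {z : ℂ} (hG : DifferentiableAt ℝ G z)
    (hH : DifferentiableAt ℝ H z) : dxbar (fun w => G w + H w) z = dxbar G z + dxbar H z := by
  simp only [dxbar, fderiv_fun_add hG hH, add_apply, smul_add]
  abel

theorem dxbar_mul {G H : ℂ → Grass n} {z : ℂ} (hG : DifferentiableAt ℝ G z)
    (hH : DifferentiableAt ℝ H z) :
    dxbar (fun w => G w * H w) z = dxbar G z * H z + G z * dxbar H z := by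
  simp only [dxbar, fderiv_fun_mul' hG hH, add_apply,
    smul_apply, smul_eq_mul, MulOpposite.smul_eq_mul_unop,
    MulOpposite.unop_op, smul_add, mul_add, add_mul, smul_mul_assoc, mul_smul_comm]
  abel

/-- A complex linear endomorphism of `ℂ[θ, ξ]` as a continuous real linear map. -/
def realCLM (L : Grass n →ₗ[ℂ] Grass n) : Grass n →L[ℝ] Grass n :=
  (LinearMap.toContinuousLinearMap L).restrictScalars ℝ

theorem dxbar_linear (L : Grass n →ₗ[ℂ] Grass n) {G : ℂ → Grass n} {z : ℂ}
    (hG : DifferentiableAt ℝ G z) : dxbar (fun w => L (G w)) z = L (dxbar G z) := by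
  have h : fderiv ℝ (fun w => L (G w)) z = (realCLM L).comp (fderiv ℝ G z) :=
    ((realCLM L).hasFDerivAt.comp z hG.hasFDerivAt).fderiv
  have h' : ∀ v, fderiv ℝ (fun w => L (G w)) z v = L (fderiv ℝ G z v) := fun v => by
    rw [h]; rfl
  simp only [dxbar, h', map_smul, map_add]

end Operators

namespace AnalyticDeformation

variable {S : SpinAtlas C} {n : ℕ} (D : AnalyticDeformation S n)

/-- The component `β_α` of `φ_α` of degree one: modulo higher order in `(θ, ξ)`,
`φ_α = β_α ∂/∂θ`. -/
def lin (α : S.ι) (z : ℂ) : Grass n := degPart 1 ((D.φ α).cθ z)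

/-- The Dolbeault operator of the exterior algebra of the holomorphic vector bundle
`T^*_{𝒳^an,-}` (coefficient of `dx̃_α`). On sections of degree one, that is, on smooth sections of
the bundle `T^*_- C^∞ ⊕ ℂⁿ` of odd cotangents, it is the operator induced by `∂̃_ξ` modulo the
square of the ideal generated by `(θ, ξ)`; it is extended to the exterior algebra as a
derivation. -/
def dbarE (α : S.ι) (G : ℂ → Grass n) (z : ℂ) : Grass n :=
  dxbar G z - D.lin α z * dOdd 0 (G z)

theorem dbarE_mul (α : S.ι) {G H : ℂ → Grass n} {z : ℂ} (hG : DifferentiableAt ℝ G z)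
    (hH : DifferentiableAt ℝ H z) :
    D.dbarE α (fun w => G w * H w) z = D.dbarE α G z * H z + G z * D.dbarE α H z := by
  obtain ⟨v, hv⟩ := exists_degPart_one ((D.φ α).cθ z)
  have h := ι_mul_parity v (G z)
  simp only [dbarE, lin, hv, dxbar_mul hG hH, dOdd_mul, mul_add, sub_mul, mul_sub]
  rw [← mul_assoc _ (parity (G z)), h]
  noncomm_ring

theorem dbarE_congr (α : S.ι) {G H : ℂ → Grass n} {z : ℂ} (h : G =ᶠ[nhds z] H) :
    D.dbarE α G z = D.dbarE α H z := by
  simp only [dbarE, dxbar_congr h, h.eq_of_nhds]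

/-- The sections over `U` of the exterior algebra `⋀^• T^*_{𝒳^an,-}` of the odd cotangent bundle:
smooth sections of the exterior algebra of `T^*_- C^∞ ⊕ ℂⁿ`, given by compatible families of local
superfunctions, which are annihilated by the Dolbeault operator. Those of degree zero are the
holomorphic functions on `U`. -/
def extSections (U : Opens C) : Subalgebra ℂ (S.Fam n U) where
  carrier := {s | (∀ α, ContDiffOn ℝ ∞ (S.ext s α) (S.dom α U)) ∧
    (∀ α β, ∀ z ∈ S.dom α U, z ∈ S.overlap α β →
      S.ext s α z = S.pullback α β (S.ext s β) z) ∧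
    ∀ α, ∀ z ∈ S.dom α U, D.dbarE α (S.ext s α) z = 0}
  mul_mem' := by
    rintro s t ⟨hs, hs', hs''⟩ ⟨ht, ht', ht''⟩
    have key : ∀ α, ∀ z ∈ S.dom α U, S.ext (s * t) α z = S.ext s α z * S.ext t α z := by
      intro α z hz
      rw [S.ext_apply _ hz, S.ext_apply _ hz, S.ext_apply _ hz]
      rfl
    refine ⟨fun α => ((hs α).mul (ht α)).congr (key α), fun α β z hz hz' => ?_,
      fun α z hz => ?_⟩
    · have h := S.trans_mem_dom hz hz'
      rw [key α z hz, hs' α β z hz hz', ht' α β z hz hz']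
      simp only [SpinAtlas.pullback, key β _ h, map_mul]
    · have e : S.ext (s * t) α =ᶠ[nhds z] fun w => S.ext s α w * S.ext t α w := by
        filter_upwards [(S.isOpen_dom α U).mem_nhds hz] with w hw using key α w hw
      have d1 := S.differentiableAt_of_contDiffOn (hs α) hz
      have d2 := S.differentiableAt_of_contDiffOn (ht α) hz
      rw [D.dbarE_congr α e, D.dbarE_mul α d1 d2, hs'' α z hz, ht'' α z hz, zero_mul, mul_zero,
        add_zero]
  add_mem' := by
    rintro s t ⟨hs, hs', hs''⟩ ⟨ht, ht', ht''⟩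
    have key : ∀ α, ∀ z ∈ S.dom α U, S.ext (s + t) α z = S.ext s α z + S.ext t α z := by
      intro α z hz
      rw [S.ext_apply _ hz, S.ext_apply _ hz, S.ext_apply _ hz]
      rfl
    refine ⟨fun α => ((hs α).add (ht α)).congr (key α), fun α β z hz hz' => ?_,
      fun α z hz => ?_⟩
    · have h := S.trans_mem_dom hz hz'
      rw [key α z hz, hs' α β z hz hz', ht' α β z hz hz']
      simp only [SpinAtlas.pullback, key β _ h, map_add]
    · have e : S.ext (s + t) α =ᶠ[nhds z] fun w => S.ext s α w + S.ext t α w := by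
        filter_upwards [(S.isOpen_dom α U).mem_nhds hz] with w hw using key α w hw
      have d1 := S.differentiableAt_of_contDiffOn (hs α) hz
      have d2 := S.differentiableAt_of_contDiffOn (ht α) hz
      have h1 := hs'' α z hz
      have h2 := ht'' α z hz
      rw [D.dbarE_congr α e]
      simp only [dbarE] at h1 h2 ⊢
      rw [dxbar_add d1 d2, map_add, mul_add, add_sub_add_comm, h1, h2, add_zero]
  algebraMap_mem' := by
    intro r
    have key : ∀ α, ∀ z ∈ S.dom α U,
        S.ext (algebraMap ℂ (S.Fam n U) r) α z = algebraMap ℂ (Grass n) r := by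
      intro α z hz
      rw [S.ext_apply _ hz]
      rfl
    refine ⟨fun α => contDiffOn_const.congr (key α), fun α β z hz hz' => ?_,
      fun α z hz => ?_⟩
    · have h := S.trans_mem_dom hz hz'
      rw [key α z hz]
      simp only [SpinAtlas.pullback, key β _ h, AlgHom.commutes]
    · have e : S.ext (algebraMap ℂ (S.Fam n U) r) α =ᶠ[nhds z]
          fun _ => algebraMap ℂ (Grass n) r := by
        filter_upwards [(S.isOpen_dom α U).mem_nhds hz] with w hw using key α w hw
      rw [D.dbarE_congr α e]
      simp only [dbarE, dxbar_const, dOdd_algebraMap, mul_zero, sub_zero]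

theorem res_mem {U V : Opens C} (h : U ≤ V) {s : S.Fam n V} (hs : s ∈ D.extSections V) :
    S.famRes h s ∈ D.extSections U := by
  obtain ⟨h1, h2, h3⟩ := hs
  have key : ∀ α, ∀ z ∈ S.dom α U, S.ext (S.famRes h s) α z = S.ext s α z := by
    intro α z hz
    rw [S.ext_apply _ hz, S.ext_apply _ (S.dom_mono h hz)]
    rfl
  refine ⟨fun α => ((h1 α).mono (S.dom_mono h)).congr (key α), fun α β z hz hz' => ?_,
    fun α z hz => ?_⟩
  · rw [key α z hz, h2 α β z (S.dom_mono h hz) hz']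
    simp only [SpinAtlas.pullback, key β _ (S.trans_mem_dom hz hz')]
  · have e : S.ext (S.famRes h s) α =ᶠ[nhds z] S.ext s α := by
      filter_upwards [(S.isOpen_dom α U).mem_nhds hz] with w hw using key α w hw
    rw [D.dbarE_congr α e, h3 α z (S.dom_mono h hz)]

theorem parity_mem {U : Opens C} {s : S.Fam n U} (hs : s ∈ D.extSections U) :
    S.famParity U s ∈ D.extSections U := by
  obtain ⟨h1, h2, h3⟩ := hs
  have key : ∀ α, ∀ z ∈ S.dom α U, S.ext (S.famParity U s) α z = parity (S.ext s α z) := by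
    intro α z hz
    rw [S.ext_apply _ hz, S.ext_apply _ hz]
    rfl
  refine ⟨fun α => ContDiffOn.congr (f := fun z => parity (S.ext s α z))
    ((realCLM (parity (n := n)).toLinearMap).contDiff.comp_contDiffOn (h1 α)) (key α),
    fun α β z hz hz' => ?_, fun α z hz => ?_⟩
  · rw [key α z hz, h2 α β z hz hz']
    simp only [SpinAtlas.pullback, key β _ (S.trans_mem_dom hz hz'), rescale_parity]
  · have e : S.ext (S.famParity U s) α =ᶠ[nhds z] fun w => parity (S.ext s α w) := by
      filter_upwards [(S.isOpen_dom α U).mem_nhds hz] with w hw using key α w hw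
    have h4 := h3 α z hz
    obtain ⟨v, hv⟩ := exists_degPart_one ((D.φ α).cθ z)
    have hd : dxbar (fun w => parity (S.ext s α w)) z = parity (dxbar (S.ext s α) z) :=
      dxbar_linear (parity (n := n)).toLinearMap (S.differentiableAt_of_contDiffOn (h1 α) hz)
    rw [D.dbarE_congr α e]
    simp only [dbarE, lin, hv] at h4 ⊢
    rw [hd, dOdd_parity, sub_eq_zero.mp h4, map_mul, parity_ι]
    noncomm_ring

end AnalyticDeformation

/-- A presheaf of `ℂ`-superalgebras on `C`: a presheaf of `ℂ`-algebras with an involution, whose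
eigenspaces for `+1` and `-1` are the even and the odd part. -/
structure SuperPresheaf (C : Type u) [TopologicalSpace C] where
  /-- the underlying presheaf of `ℂ`-algebras -/
  presheaf : TopCat.Presheaf (AlgCat.{u} ℂ) (TopCat.of C)
  /-- the parity involution -/
  parity : presheaf ⟶ presheaf
  parity_parity : parity ≫ parity = 𝟙 presheaf

namespace SuperPresheaf

variable {C : Type u} [TopologicalSpace C] (O P : SuperPresheaf C)

/-- The algebra of sections over `U`. -/
abbrev sec (U : Opens C) : Type u := O.presheaf.obj (op U)

/-- Restriction of sections. -/
def res {U V : Opens C} (h : U ≤ V) : O.sec V →ₐ[ℂ] O.sec U :=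
  (O.presheaf.map (homOfLE h : U ⟶ V).op).hom

/-- Parity of sections. -/
def par (U : Opens C) : O.sec U →ₐ[ℂ] O.sec U := (O.parity.app (op U)).hom

/-- An isomorphism of `O` with `P` over the open set `W`. -/
structure IsoOver (W : Opens C) where
  equiv : ∀ V : Opens C, V ≤ W → (O.sec V ≃ₐ[ℂ] P.sec V)
  equiv_res : ∀ (V V' : Opens C) (h : V' ≤ V) (hV : V ≤ W) (x : O.sec V),
    equiv V' (h.trans hV) (O.res h x) = P.res h (equiv V hV x)
  equiv_par : ∀ (V : Opens C) (hV : V ≤ W) (x : O.sec V),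
    equiv V hV (O.par V x) = P.par V (equiv V hV x)

/-- `(C, O)` and `(C, P)` are isomorphic as superspaces: there are a homeomorphism `σ` of `C` and
an isomorphism of `O` with `σ_* P`, compatible with parity. -/
def Isomorphic : Prop :=
  ∃ (σ : C ≃ₜ C) (e : ∀ U : Opens C, O.sec U ≃ₐ[ℂ] P.sec (Opens.comap σ U)),
    (∀ (U V : Opens C) (h : U ≤ V) (x : O.sec V),
      e U (O.res h x) = P.res (OrderHomClass.mono (Opens.comap (σ : C(C, C))) h) (e V x)) ∧
    ∀ (U : Opens C) (x : O.sec U), e U (O.par U x) = P.par _ (e U x)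

end SuperPresheaf

namespace AnalyticDeformation

variable {S : SpinAtlas C} {n : ℕ} (D : AnalyticDeformation S n)

/-- The structure sheaf `⋀^• T^*_{𝒳^an,-}` of the split model `S(C, T^*_{𝒳^an,-})`. -/
def splitModel : SuperPresheaf C where
  presheaf :=
    { obj := fun U => AlgCat.of ℂ (D.extSections (unop U))
      map := fun i => AlgCat.ofHom
        (((S.famRes (leOfHom i.unop)).comp (D.extSections _).val).codRestrict (D.extSections _)
          fun s => D.res_mem (leOfHom i.unop) s.2)
      map_id := fun _ => rfl
      map_comp := fun _ _ => rfl }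
  parity :=
    { app := fun U => AlgCat.ofHom
        (((S.famParity (unop U)).comp (D.extSections _).val).codRestrict (D.extSections _)
          fun s => D.parity_mem s.2)
      naturality := fun _ _ _ => rfl }
  parity_parity := by
    ext U s α z
    exact SuperRiemann.parity_parity _

/-- The component of degree `k` of a section of `⋀^• T^*_{𝒳^an,-}`, as a family of local
superfunctions. For `k = 0` it is a holomorphic function and for `k = 1` a section of
`T^*_{𝒳^an,-}`. -/
def component {U : Opens C} (k : ℕ) (s : D.splitModel.sec U) : S.Fam n U :=
  fun α z => degPart k ((show D.extSections U from s).1 α z)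

/-- A complex supermanifold modelled on `(C, T^*_{𝒳^an,-})`: a sheaf `O` of superalgebras on `C`
which is locally isomorphic to `⋀^• T^*_{𝒳^an,-}`, by isomorphisms which agree with each other on
`O/J` and on `J/J²`, where `J` is the ideal generated by the odd elements (the sections whose
component of degree zero vanishes); thus they identify `O/J` with the sheaf of holomorphic functions
on `C`, and `J/J²` with `T^*_{𝒳^an,-}`. -/
structure Supermanifold where
  /-- the structure sheaf -/
  O : SuperPresheaf C
  isSheaf : O.presheaf.IsSheaf
  /-- neighbourhoods on which the supermanifold is isomorphic to the split model -/
  nhd : C → Opens C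
  mem_nhd : ∀ p, p ∈ nhd p
  /-- the local isomorphisms with the split model -/
  triv : ∀ p, O.IsoOver D.splitModel (nhd p)
  component_zero : ∀ (p q : C) (V : Opens C) (hp : V ≤ nhd p) (hq : V ≤ nhd q) (x : O.sec V),
    D.component 0 ((triv p).equiv V hp x) = D.component 0 ((triv q).equiv V hq x)
  component_one : ∀ (p q : C) (V : Opens C) (hp : V ≤ nhd p) (hq : V ≤ nhd q) (x : O.sec V),
    D.component 0 ((triv p).equiv V hp x) = 0 →
    D.component 1 ((triv p).equiv V hp x) = D.component 1 ((triv q).equiv V hq x)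

/-- The supermanifold is split: it is isomorphic to the split model. -/
def Supermanifold.IsSplit {D : AnalyticDeformation S n} (X : D.Supermanifold) : Prop :=
  X.O.Isomorphic D.splitModel

end AnalyticDeformation

end Model
end SuperRiemann
end

/-! The contrapositive is proved: if every supermanifold modelled on E = T^*_{𝒳^an,-} splits, a
second-order trivialization of the deformation can be assembled from the splittings. Let β = Σ ξ_i
χ^i (`lin`), so that ∂̄_E = ∂̄ - β ∂/∂θ is the Dolbeault operator of ⋀^• E.

Supermanifolds arise by replacing ∂̄_E with ∂̄_E - δ, where δ = ξ_i ρ ∂/∂x + ξ_i κ ∂/∂θ is a global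
vector (0,1)-form with ρ of degree one and κ of degree two (`Perturbation`). The common factor ξ_i
makes all products of such operators vanish. Hence a local solution ν of [∂̄_E, ν] = -δ, which the
Cauchy transform provides (`exists_dxbar_eq`, `exists_gauge`), gives an algebra isomorphism 1 + ν
from ker(∂̄_E - δ) onto ker ∂̄_E. Since ν raises the degree by two, `O/J` and `J/J²` are those of
the split model (`supermanifold`).

A splitting embeds the holomorphic functions into the perturbed sheaf. Let w_α be the degree-two
part of the resulting lift of the coordinate x_α. The degree-two part of the equation for the lift
reads ∂̄_E w_α = ξ_i ρ_α, and a Taylor expansion of the transition functions shows that the w_α glue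
to a section of T_C ⊗ ⋀²E. So splitness makes ξ_i ρ exact (`Perturbation.exists_primitive`).

This is used twice. For ρ = -θ ∂β/∂ξ_i, the θ-derivatives of the primitives sum to a section η with
∂̄η = β (`exists_odd_primitive`): the deformation is trivial to first order. Next let `quad` be the
degree-two part, at θ = 0, of the ∂/∂x-coefficient of φ, and put R = `quad` - ηβ. For ρ = ½ ∂R/∂ξ_i,
Euler's identity yields w with ∂̄_E w = R, and u = w|_{θ=0} - η ∂w/∂θ satisfies ∂̄u = R. The
superconformal field ν built from (u, η) then solves ∂̄ν - φ + ½[ν, φ] ≡ 0 modulo (ξ)³, which is the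
Baker–Campbell–Hausdorff form of e^{-ν} ∂̄_ξ e^ν ≡ ∂̄ (`IsPotentialOn.dxbar_expTwo_mem`). -/

noncomputable section
namespace SuperRiemann

/-! ### The Cauchy transform and the inhomogeneous Cauchy–Riemann equation -/

section CauchyTransform
open MeasureTheory

variable {E : Type*} [NormedAddCommGroup E] [NormedSpace ℂ E]

/-- The unit vector `e^{iφ}`. -/
def unitVec (φ : ℝ) : ℂ := Real.cos φ + Real.sin φ * Complex.I

theorem unitVec_eq_exp (φ : ℝ) : unitVec φ = Complex.exp (φ * Complex.I) := by
  rw [Complex.exp_mul_I, unitVec, Complex.ofReal_cos, Complex.ofReal_sin]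

theorem norm_unitVec (φ : ℝ) : ‖unitVec φ‖ = 1 := by
  rw [unitVec_eq_exp, Complex.norm_exp_ofReal_mul_I]

theorem continuous_unitVec : Continuous unitVec := by
  unfold unitVec; fun_prop

theorem hasDerivAt_unitVec (φ : ℝ) : HasDerivAt unitVec (Complex.I * unitVec φ) φ := by
  have h : unitVec = fun φ : ℝ => Complex.exp (φ * Complex.I) := funext unitVec_eq_exp
  rw [h]
  have := ((Complex.ofRealCLM.hasDerivAt (x := φ)).mul_const Complex.I).cexp
  simpa [mul_comm] using this

theorem integrableOn_fderiv_polar {g : ℂ → E} (hg : ContDiff ℝ 1 g) (hs : HasCompactSupport g)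
    {v : ℝ → ℂ} (hv : Continuous v) :
    IntegrableOn (fun p : ℝ × ℝ => fderiv ℝ g (p.1 * unitVec p.2) (v p.2))
      (Set.Ioi 0 ×ˢ Set.Ioo (-Real.pi) Real.pi) (volume.prod volume) := by
  obtain ⟨R, hR⟩ := hs.isCompact.isBounded.subset_closedBall 0
  have hc : Continuous fun p : ℝ × ℝ => fderiv ℝ g (p.1 * unitVec p.2) (v p.2) := by
    have h1 := hg.continuous_fderiv (by simp)
    have h2 := continuous_unitVec
    fun_prop
  have hK : IsCompact (Set.Icc 0 R ×ˢ Set.Icc (-Real.pi) Real.pi : Set (ℝ × ℝ)) :=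
    isCompact_Icc.prod isCompact_Icc
  refine (hc.continuousOn.integrableOn_compact hK).of_forall_sdiff_eq_zero
    (measurableSet_Ioi.prod measurableSet_Ioo) ?_
  rintro ⟨r, φ⟩ ⟨⟨h1, h2⟩, h3⟩
  simp only [Set.mem_prod, Set.mem_Icc, Set.mem_Ioi, Set.mem_Ioo, not_and] at h1 h2 h3
  have h4 : R < r := by
    by_contra! h
    exact h3 ⟨h1.le, h⟩ h2.1.le h2.2.le
  have h5 : (r : ℂ) * unitVec φ ∉ tsupport g := by
    intro h
    have := hR h
    rw [mem_closedBall_zero_iff, norm_mul, norm_unitVec, mul_one, Complex.norm_real,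
      Real.norm_of_nonneg h1.le] at this
    linarith
  have h6 : fderiv ℝ g (r * unitVec φ) = 0 := by
    by_contra h
    exact h5 (support_fderiv_subset ℝ h)
  simp [h6]

/-- Along a ray the integrand is the derivative of a compactly supported function, so only the value
at the origin survives, whatever the angle. -/
theorem integral_radial [CompleteSpace E] {g : ℂ → E} (hg : ContDiff ℝ 1 g)
    (hs : HasCompactSupport g) (φ : ℝ) :
    ∫ r in Set.Ioi (0 : ℝ), fderiv ℝ g (r * unitVec φ) (unitVec φ) = -g 0 := by
  have hd : ∀ r : ℝ, HasDerivAt (fun r : ℝ => g (r * unitVec φ))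
      (fderiv ℝ g (r * unitVec φ) (unitVec φ)) r := by
    intro r
    have h1 : HasDerivAt (fun r : ℝ => (r : ℂ) * unitVec φ) (unitVec φ) r := by
      simpa using (Complex.ofRealCLM.hasDerivAt (x := r)).mul_const (unitVec φ)
    exact ((hg.differentiable (by simp)) _).hasFDerivAt.comp_hasDerivAt r h1
  have hcs : HasCompactSupport (fun r : ℝ => g (r * unitVec φ)) := by
    obtain ⟨R, hR⟩ := hs.isCompact.isBounded.subset_closedBall 0
    refine HasCompactSupport.intro (isCompact_Icc (a := -R) (b := R)) fun r hr => ?_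
    by_contra h
    have := hR (subset_tsupport g h)
    rw [mem_closedBall_zero_iff, norm_mul, norm_unitVec, mul_one, Complex.norm_real] at this
    exact hr (abs_le.mp this)
  have hcd : ContDiff ℝ 1 (fun r : ℝ => g (r * unitVec φ)) := by
    refine hg.comp ?_
    exact Complex.ofRealCLM.contDiff.mul contDiff_const
  have := hcs.integral_Ioi_deriv_eq hcd 0
  simp only [fun r => (hd r).deriv] at this
  simpa using this

/-- The integrand is r⁻¹ times the derivative of g along the circle of radius r, a closed curve. -/
theorem integral_angular [CompleteSpace E] {g : ℂ → E} (hg : ContDiff ℝ 1 g) {r : ℝ} (hr : 0 < r) :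
    ∫ φ in Set.Ioo (-Real.pi) Real.pi,
      fderiv ℝ g (r * unitVec φ) (Complex.I * unitVec φ) = 0 := by
  have hd : ∀ φ : ℝ, HasDerivAt (fun φ : ℝ => r⁻¹ • g (r * unitVec φ))
      (fderiv ℝ g (r * unitVec φ) (Complex.I * unitVec φ)) φ := by
    intro φ
    have h1 : HasDerivAt (fun φ : ℝ => (r : ℂ) * unitVec φ) (r * (Complex.I * unitVec φ)) φ :=
      (hasDerivAt_unitVec φ).const_mul (r : ℂ)
    have h2 := (((hg.differentiable (by simp)) _).hasFDerivAt.comp_hasDerivAt φ h1).const_smul r⁻¹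
    refine h2.congr_deriv ?_
    rw [← map_smul, Complex.real_smul]
    congr 1
    have : (r : ℂ) ≠ 0 := by exact_mod_cast hr.ne'
    push_cast
    field_simp
  have hcont : Continuous fun φ : ℝ => fderiv ℝ g (r * unitVec φ) (Complex.I * unitVec φ) := by
    have h1 := hg.continuous_fderiv (by simp)
    have h2 := continuous_unitVec
    fun_prop
  have h := intervalIntegral.integral_eq_sub_of_hasDerivAt (a := -Real.pi) (b := Real.pi)
    (fun φ _ => hd φ) (hcont.intervalIntegrable _ _)
  rw [intervalIntegral.integral_of_le (by linarith [Real.pi_pos]),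
    integral_Ioc_eq_integral_Ioo] at h
  rw [h]
  simp [unitVec]

/-- The Cauchy–Pompeiu formula for compactly supported functions. -/
theorem integral_inv_smul_dxbar [CompleteSpace E] {g : ℂ → E} (hg : ContDiff ℝ 1 g)
    (hs : HasCompactSupport g) :
    ∫ w : ℂ, w⁻¹ • dxbar g w = -(Real.pi : ℂ) • g 0 := by
  rw [← Complex.integral_comp_polarCoord_symm]
  -- The Jacobian r cancels the modulus of w⁻¹, and the remaining phase e^{-iφ} turns 2∂̄ into the
  -- radial derivative plus i times the tangential one.
  have h1 : ∀ p ∈ polarCoord.target, p.1 • ((Complex.polarCoord.symm p)⁻¹ •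
      dxbar g (Complex.polarCoord.symm p)) =
      (1 / 2 : ℂ) • fderiv ℝ g (p.1 * unitVec p.2) (unitVec p.2) +
      (Complex.I / 2) • fderiv ℝ g (p.1 * unitVec p.2) (Complex.I * unitVec p.2) := by
    rintro ⟨r, φ⟩ ⟨hr, -⟩
    have hr' : (r : ℂ) ≠ 0 := by
      have : 0 < r := hr
      exact_mod_cast this.ne'
    have hv : ∀ a b : ℝ, fderiv ℝ g (r * unitVec φ) (a + b * Complex.I) =
        (a : ℂ) • fderiv ℝ g (r * unitVec φ) 1 +
          (b : ℂ) • fderiv ℝ g (r * unitVec φ) Complex.I := by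
      intro a b
      have : (a + b * Complex.I : ℂ) = a • (1 : ℂ) + b • Complex.I := by simp
      rw [this, map_add, map_smul, map_smul]
      simp only [Complex.coe_smul]
    have e1 : unitVec φ = (Real.cos φ : ℝ) + (Real.sin φ : ℝ) * Complex.I := rfl
    have e2 : Complex.I * unitVec φ = (-Real.sin φ : ℝ) + (Real.cos φ : ℝ) * Complex.I := by
      rw [e1]; push_cast; linear_combination (Complex.sin φ) * Complex.I_mul_I
    have e3 : (unitVec φ)⁻¹ = Real.cos φ - Real.sin φ * Complex.I := by
      rw [unitVec_eq_exp, ← Complex.exp_neg, ← neg_mul, Complex.exp_mul_I, Complex.cos_neg,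
        Complex.sin_neg]
      push_cast; ring
    rw [Complex.polarCoord_symm_apply]
    change r • (((r : ℂ) * unitVec φ)⁻¹ • dxbar g (r * unitVec φ)) = _
    have e4 : fderiv ℝ g (r * unitVec φ) (unitVec φ) = _ := hv (Real.cos φ) (Real.sin φ)
    have e5 : fderiv ℝ g (r * unitVec φ) (Complex.I * unitVec φ) = _ :=
      e2 ▸ hv (-Real.sin φ) (Real.cos φ)
    simp only [e4, e5, dxbar]
    rw [mul_inv, e3, ← Complex.coe_smul]
    simp only [smul_add, smul_smul]
    have e6 := Complex.I_sq
    rw [add_add_add_comm, ← add_smul, ← add_smul]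
    congr 2
    · push_cast; field_simp; ring
    · push_cast; field_simp; linear_combination (-(Complex.sin φ)) * e6
  rw [setIntegral_congr_fun polarCoord.open_target.measurableSet h1, polarCoord_target]
  have i1 := integrableOn_fderiv_polar hg hs continuous_unitVec
  have i2 := integrableOn_fderiv_polar hg hs (v := fun φ => Complex.I * unitVec φ)
    (continuous_const.mul continuous_unitVec)
  have i1' : Integrable (fun p : ℝ × ℝ => fderiv ℝ g (p.1 * unitVec p.2) (unitVec p.2))
      ((volume.restrict (Set.Ioi 0)).prod (volume.restrict (Set.Ioo (-Real.pi) Real.pi))) := by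
    rw [Measure.prod_restrict]; exact i1
  change ∫ p in _, _ ∂(volume.prod volume) = _
  have k1 : IntegrableOn (fun p : ℝ × ℝ => (1 / 2 : ℂ) •
      fderiv ℝ g (p.1 * unitVec p.2) (unitVec p.2))
      (Set.Ioi 0 ×ˢ Set.Ioo (-Real.pi) Real.pi) (volume.prod volume) := i1.smul (1 / 2 : ℂ)
  have k2 : IntegrableOn (fun p : ℝ × ℝ => (Complex.I / 2) •
      fderiv ℝ g (p.1 * unitVec p.2) (Complex.I * unitVec p.2))
      (Set.Ioi 0 ×ˢ Set.Ioo (-Real.pi) Real.pi) (volume.prod volume) := i2.smul (Complex.I / 2)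
  -- Fubini is used in opposite orders: the radial term is integrated over r first, the tangential
  -- term over the angle first.
  rw [integral_add k1 k2, integral_smul, integral_smul,
    setIntegral_prod _ i2, ← Measure.prod_restrict, integral_prod_symm _ i1']
  have j2 : ∫ r in Set.Ioi (0 : ℝ), ∫ φ in Set.Ioo (-Real.pi) Real.pi,
      fderiv ℝ g (r * unitVec φ) (Complex.I * unitVec φ) = 0 := by
    rw [setIntegral_congr_fun measurableSet_Ioi fun r hr => integral_angular hg hr]
    simp
  rw [j2]
  simp only [integral_radial hg hs]
  rw [setIntegral_const, smul_zero, add_zero]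
  rw [Measure.real, Real.volume_Ioo, ENNReal.toReal_ofReal (by linarith [Real.pi_pos]),
    ← Complex.coe_smul, smul_smul, smul_neg, ← neg_smul]
  congr 1
  push_cast; ring

/-- The singularity has order 1, less than the real dimension 2. -/
theorem locallyIntegrable_inv : LocallyIntegrable (fun w : ℂ => w⁻¹) volume := by
  refine locallyIntegrable_of_norm_le_rpow (C := 1) (α := 1) (by simp) (by simp) ?_
    (measurable_inv.aestronglyMeasurable)
  refine Filter.Eventually.of_forall fun w => ?_
  rw [norm_inv, one_mul, Real.rpow_neg_one]

/-- The inhomogeneous Cauchy–Riemann equation is solvable for compactly supported data. -/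
theorem exists_dxbar_eq [CompleteSpace E] {f : ℂ → E} (hf : ContDiff ℝ ∞ f)
    (hs : HasCompactSupport f) :
    ∃ v : ℂ → E, ContDiff ℝ ∞ v ∧ ∀ z, dxbar v z = f z := by
  let L : ℂ →L[ℝ] E →L[ℝ] E := ContinuousLinearMap.lsmul ℝ ℂ
  -- The solution is the convolution of f with 1/(πw). Derivatives fall on the smooth factor f, so
  -- Cauchy–Pompeiu can be applied to t ↦ f (z - t).
  let v₀ : ℂ → E := convolution (fun w : ℂ => w⁻¹) f L volume
  have hv₀ : ContDiff ℝ ∞ v₀ := hs.contDiff_convolution_right L locallyIntegrable_inv hf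
  have hf1 : ContDiff ℝ 1 f := hf.of_le (by exact_mod_cast le_top)
  have hc : Continuous (fderiv ℝ f) := hf1.continuous_fderiv (by simp)
  have hd : ∀ z c, fderiv ℝ v₀ z c = ∫ t : ℂ, t⁻¹ • fderiv ℝ f (z - t) c := by
    intro z c
    rw [(hs.hasFDerivAt_convolution_right L locallyIntegrable_inv hf1 z).fderiv,
      convolution_precompR_apply L locallyIntegrable_inv (hs.fderiv ℝ) hc]
    rfl
  have hi : ∀ z c, Integrable fun t : ℂ => t⁻¹ • fderiv ℝ f (z - t) c := by
    intro z c
    have h1 : HasCompactSupport fun a => fderiv ℝ f a c := (hs.fderiv_apply ℝ c)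
    exact h1.convolutionExists_right L locallyIntegrable_inv (hc.clm_apply continuous_const) z
  refine ⟨fun z => (Real.pi : ℂ)⁻¹ • v₀ z, contDiff_const.smul hv₀, fun z => ?_⟩
  have hdv : fderiv ℝ (fun z => (Real.pi : ℂ)⁻¹ • v₀ z) z = (Real.pi : ℂ)⁻¹ • fderiv ℝ v₀ z :=
    fderiv_const_smul ((hv₀.differentiable (by simp)) z) _
  have hmain : dxbar v₀ z = ∫ t : ℂ, t⁻¹ • dxbar f (z - t) := by
    have hI : Integrable fun t : ℂ => Complex.I • t⁻¹ • fderiv ℝ f (z - t) Complex.I :=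
      (hi z Complex.I).smul Complex.I
    simp only [dxbar, hd]
    rw [← integral_smul, ← integral_add (hi z 1) hI,
      ← integral_smul]
    refine integral_congr_ae (Filter.Eventually.of_forall fun t => ?_)
    simp only [smul_add, smul_smul]
    congr 2 <;> ring
  have hg : ∀ t, dxbar f (z - t) = -dxbar (fun t => f (z - t)) t := by
    intro t
    have : fderiv ℝ (fun t => f (z - t)) t = -fderiv ℝ f (z - t) := by
      have h1 := ((hf1.differentiable (by simp)) (z - t)).hasFDerivAt.comp t
        ((hasFDerivAt_id t).const_sub z)
      refine h1.fderiv.trans ?_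
      ext c
      simp
    simp only [dxbar, this, neg_apply, smul_neg, ← neg_add, neg_neg]
  have hcs : HasCompactSupport fun t => f (z - t) :=
    hs.comp_homeomorph (Homeomorph.subLeft z)
  have hcp := integral_inv_smul_dxbar (g := fun t => f (z - t))
    (hf1.comp (contDiff_const.sub contDiff_id)) hcs
  have hp : (Real.pi : ℂ) ≠ 0 := by exact_mod_cast Real.pi_ne_zero
  calc dxbar (fun z => (Real.pi : ℂ)⁻¹ • v₀ z) z = (Real.pi : ℂ)⁻¹ • dxbar v₀ z := by
        simp only [dxbar, hdv, smul_apply]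
        simp only [smul_add, smul_smul]
        congr 2 <;> ring
    _ = f z := by
        rw [hmain]
        simp only [hg, smul_neg]
        rw [integral_neg, hcp, neg_smul, neg_neg, smul_smul, inv_mul_cancel₀ hp, one_smul, sub_zero]

end CauchyTransform

/-! ### Supercommutativity and the dependence on θ -/

section GrassAlgebra
variable {n : ℕ}

/-- The homogeneous elements of degree `k` of `ℂ[θ, ξ]`. -/
abbrev deg (n k : ℕ) : Submodule ℂ (Grass n) := ⋀[ℂ]^k (Fin (n + 1) → ℂ)

theorem mul_eq_of_odd {x : Grass n} (hx : parity x = -x) (y : Grass n) :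
    y * x = x * parity y := by
  induction y using ExteriorAlgebra.induction with
  | algebraMap r =>
    change algebraMap ℂ (Grass n) r * x = x * parity (algebraMap ℂ (Grass n) r)
    rw [AlgHom.commutes, Algebra.commutes]
  | ι v =>
    have h := ι_mul_parity v x
    rw [hx, mul_neg] at h
    rw [parity_ι, mul_neg, ← h, neg_neg]
  | mul a b ha hb =>
    change (a : Grass n) * b * x = x * parity ((a : Grass n) * b)
    rw [map_mul, mul_assoc, hb, ← mul_assoc, ha, mul_assoc]
  | add a b ha hb =>
    change ((a : Grass n) + b) * x = x * parity ((a : Grass n) + b)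
    rw [map_add, add_mul, ha, hb, mul_add]

theorem mul_eq_of_even {x : Grass n} (hx : parity x = x) (y : Grass n) : y * x = x * y := by
  induction y using ExteriorAlgebra.induction with
  | algebraMap r => exact Algebra.commutes r x
  | ι v =>
    have h := ι_mul_parity v x
    rw [hx] at h
    exact h
  | mul a b ha hb =>
    change (a : Grass n) * b * x = x * ((a : Grass n) * b)
    rw [mul_assoc, hb, ← mul_assoc, ha, mul_assoc]
  | add a b ha hb =>
    change ((a : Grass n) + b) * x = x * ((a : Grass n) + b)
    rw [add_mul, ha, hb, mul_add]

theorem parity_theta : parity (theta : Grass n) = -theta := parity_ι _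

theorem parity_xi (i : Fin n) : parity (xi i : Grass n) = -xi i := parity_ι _

theorem theta_mul_theta : (theta : Grass n) * theta = 0 := ExteriorAlgebra.ι_sq_zero _

theorem xi_mul_xi (i : Fin n) : (xi i : Grass n) * xi i = 0 := ExteriorAlgebra.ι_sq_zero _

theorem mul_theta (x : Grass n) : x * theta = theta * parity x := mul_eq_of_odd parity_theta x

theorem mul_xi (i : Fin n) (x : Grass n) : x * xi i = xi i * parity x :=
  mul_eq_of_odd (parity_xi i) x

/-- This nilpotency is what truncates the exponential of a field divisible by ξ_i to 1 + ν. -/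
theorem xi_mul_mul_xi_mul (i : Fin n) (x y : Grass n) : xi i * x * (xi i * y) = 0 := by
  rw [mul_assoc, ← mul_assoc x, mul_xi, mul_assoc, ← mul_assoc, xi_mul_xi, zero_mul]

theorem theta_mul_mul_theta_mul (x y : Grass n) : theta * x * (theta * y) = 0 := by
  rw [mul_assoc, ← mul_assoc x, mul_theta, mul_assoc, ← mul_assoc, theta_mul_theta, zero_mul]

theorem dOdd_ι (j : Fin (n + 1)) (v : Fin (n + 1) → ℂ) :
    dOdd j (ExteriorAlgebra.ι ℂ v : Grass n) = algebraMap ℂ (Grass n) (v j) :=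
  CliffordAlgebra.contractLeft_ι (Q := (0 : QuadraticForm ℂ (Fin (n + 1) → ℂ)))
    (LinearMap.proj j) v

theorem dOdd_one (j : Fin (n + 1)) : dOdd j (1 : Grass n) = 0 := by
  have := dOdd_algebraMap (n := n) j 1
  rwa [map_one] at this

theorem dOdd_zero_theta : dOdd 0 (theta : Grass n) = 1 := by
  rw [theta, dOdd_ι]; simp

theorem dOdd_zero_xi (i : Fin n) : dOdd 0 (xi i : Grass n) = 0 := by
  rw [xi, dOdd_ι]; simp

theorem dOdd_dOdd (j : Fin (n + 1)) (x : Grass n) : dOdd j (dOdd j x) = 0 :=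
  CliffordAlgebra.contractLeft_contractLeft (Q := (0 : QuadraticForm ℂ (Fin (n + 1) → ℂ)))
    (LinearMap.proj j) x

theorem dOdd_zero_theta_mul (x : Grass n) : dOdd 0 (theta * x) = x - theta * dOdd 0 x := by
  rw [dOdd_mul, dOdd_zero_theta, parity_theta, one_mul, neg_mul, sub_eq_add_neg]

theorem dOdd_zero_xi_mul (i : Fin n) (x : Grass n) : dOdd 0 (xi i * x) = -(xi i * dOdd 0 x) := by
  rw [dOdd_mul, dOdd_zero_xi, parity_xi, zero_mul, zero_add, neg_mul]

theorem body_ι (v : Fin (n + 1) → ℂ) : body (ExteriorAlgebra.ι ℂ v : Grass n) = 0 := by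
  change ExteriorAlgebra.algebraMapInv _ = 0
  simp [ExteriorAlgebra.algebraMapInv]

theorem body_theta : body (theta : Grass n) = 0 := body_ι _

theorem body_xi (i : Fin n) : body (xi i : Grass n) = 0 := body_ι _

theorem rescale_ι (c : ℂ) (v : Fin (n + 1) → ℂ) : rescale c (ExteriorAlgebra.ι ℂ v : Grass n) =
    ExteriorAlgebra.ι ℂ (fun j => (if j = 0 then c else 1) * v j) := by
  rw [rescale]
  exact ExteriorAlgebra.map_apply_ι _ v

theorem rescale_theta (c : ℂ) : rescale c (theta : Grass n) = c • theta := by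
  rw [theta, rescale_ι, ← map_smul]
  congr 1
  ext j
  refine Fin.cases ?_ (fun i => ?_) j <;> simp

theorem rescale_xi (c : ℂ) (i : Fin n) : rescale c (xi i : Grass n) = xi i := by
  rw [xi, rescale_ι]
  congr 1
  ext j
  refine Fin.cases ?_ (fun i => ?_) j <;> simp

theorem ι_eq_sum (v : Fin (n + 1) → ℂ) :
    (ExteriorAlgebra.ι ℂ v : Grass n) = v 0 • theta + ∑ i : Fin n, v i.succ • xi i := by
  conv_lhs => rw [pi_eq_sum_univ' v, Fin.sum_univ_succ]
  rw [map_add, map_sum]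
  simp only [map_smul]
  congr 1

/-- Write x = a + θb with a, b free of θ; then b = ∂x/∂θ and the substitution gives a + cθb.
Pull-backs are thus affine in the scalar c, which makes their smoothness and their derivatives easy
to compute. The case c = 0 is evaluation at θ = 0. -/
theorem rescale_eq (c : ℂ) (x : Grass n) : rescale c x = x + (c - 1) • (theta * dOdd 0 x) := by
  induction x using ExteriorAlgebra.induction with
  | algebraMap r =>
    change rescale c (algebraMap ℂ (Grass n) r) = algebraMap ℂ (Grass n) r +
      (c - 1) • (theta * dOdd 0 (algebraMap ℂ (Grass n) r))
    rw [AlgHom.commutes, dOdd_algebraMap, mul_zero, smul_zero, add_zero]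
  | ι v =>
    rw [dOdd_ι, ι_eq_sum, map_add, map_smul, rescale_theta, map_sum]
    simp only [map_smul, rescale_xi]
    rw [← Algebra.commutes, ← Algebra.smul_def]
    module
  | mul a b ha hb =>
    change rescale c ((a : Grass n) * b) = (a : Grass n) * b + (c - 1) •
      (theta * dOdd 0 ((a : Grass n) * b))
    rw [map_mul, ha, hb, dOdd_mul, add_mul, mul_add, mul_add, smul_mul_smul_comm,
      theta_mul_mul_theta_mul, mul_add, ← mul_assoc theta (parity (a : Grass n)), ← mul_theta]
    simp only [smul_add, smul_mul_assoc, mul_smul_comm, smul_zero, mul_assoc]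
    abel
  | add a b ha hb =>
    change rescale c ((a : Grass n) + b) = (a : Grass n) + b + (c - 1) •
      (theta * dOdd 0 ((a : Grass n) + b))
    rw [map_add, ha, hb, map_add, mul_add, smul_add]
    abel

theorem rescale_one (x : Grass n) : rescale 1 x = x := by
  rw [rescale_eq, sub_self, zero_smul, add_zero]

theorem rescale_zero (x : Grass n) : rescale 0 x = x - theta * dOdd 0 x := by
  rw [rescale_eq]; module

theorem dOdd_zero_rescale (c : ℂ) (x : Grass n) :
    dOdd 0 (rescale c x) = c • dOdd 0 x := by
  rw [rescale_eq, map_add, map_smul, dOdd_zero_theta_mul, dOdd_dOdd, mul_zero, sub_zero]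
  module

theorem rescale_dOdd_zero (c : ℂ) (x : Grass n) : rescale c (dOdd 0 x) = dOdd 0 x := by
  rw [rescale_eq, dOdd_dOdd, mul_zero, smul_zero, add_zero]

theorem rescale_eq_self {x : Grass n} (hx : dOdd 0 x = 0) (c : ℂ) : rescale c x = x := by
  rw [rescale_eq, hx, mul_zero, smul_zero, add_zero]

theorem dOdd_zero_rescale_zero (x : Grass n) : dOdd 0 (rescale 0 x) = 0 := by
  rw [dOdd_zero_rescale, zero_smul]

theorem rescale_zero_add (x : Grass n) : x = rescale 0 x + theta * dOdd 0 x := by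
  rw [rescale_zero, sub_add_cancel]

theorem rescale_rescale (c d : ℂ) (x : Grass n) : rescale c (rescale d x) = rescale (d * c) x := by
  rw [rescale_eq c, dOdd_zero_rescale, rescale_eq d, rescale_eq (d * c), mul_smul_comm]
  module

theorem dOdd_dOdd_comm (i j : Fin (n + 1)) (x : Grass n) :
    dOdd i (dOdd j x) = -dOdd j (dOdd i x) :=
  CliffordAlgebra.contractLeft_comm (Q := (0 : QuadraticForm ℂ (Fin (n + 1) → ℂ)))
    (LinearMap.proj i) (LinearMap.proj j) (x : ExteriorAlgebra ℂ (Fin (n + 1) → ℂ))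

theorem body_rescale (c : ℂ) (x : Grass n) : body (rescale c x) = body x := by
  rw [rescale_eq, map_add, map_smul, map_mul, body_theta, zero_mul, smul_zero, add_zero]

end GrassAlgebra

/-! ### The grading by degree in the odd generators -/

section Degree
variable {n : ℕ}

theorem degPart_mem (k : ℕ) (x : Grass n) : degPart k x ∈ deg n k :=
  SetLike.coe_mem (DirectSum.decompose
    (fun i : ℕ => ⋀[ℂ]^i (Fin (n + 1) → ℂ)) (x : ExteriorAlgebra ℂ (Fin (n + 1) → ℂ)) k)

theorem degPart_of_mem {k : ℕ} {x : Grass n} (hx : x ∈ deg n k) : degPart k x = x :=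
  DirectSum.decompose_of_mem_same (fun i : ℕ => ⋀[ℂ]^i (Fin (n + 1) → ℂ)) hx

theorem degPart_of_mem_ne {k l : ℕ} {x : Grass n} (hx : x ∈ deg n k) (h : k ≠ l) :
    degPart l x = 0 :=
  DirectSum.decompose_of_mem_ne (fun i : ℕ => ⋀[ℂ]^i (Fin (n + 1) → ℂ)) hx h

theorem deg_induction {p : Grass n → Prop} (h0 : p 0) (hadd : ∀ x y, p x → p y → p (x + y))
    (h : ∀ k, ∀ x ∈ deg n k, p x) (x : Grass n) : p x :=
  DirectSum.Decomposition.inductionOn (fun i : ℕ => ⋀[ℂ]^i (Fin (n + 1) → ℂ)) h0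
    (fun m => h _ m.1 m.2) hadd x

theorem mul_mem_deg {k l : ℕ} {x y : Grass n} (hx : x ∈ deg n k) (hy : y ∈ deg n l) :
    x * y ∈ deg n (k + l) :=
  SetLike.mul_mem_graded (A := fun i : ℕ => ⋀[ℂ]^i (Fin (n + 1) → ℂ)) hx hy

theorem degPart_mul_left {k l : ℕ} {x : Grass n} (hx : x ∈ deg n k) (y : Grass n) :
    degPart (k + l) (x * y) = x * degPart l y :=
  DirectSum.coe_decompose_mul_add_of_left_mem (fun i : ℕ => ⋀[ℂ]^i (Fin (n + 1) → ℂ)) hx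

theorem degPart_mul_left_of_lt {k l : ℕ} {x : Grass n} (hx : x ∈ deg n k) (y : Grass n)
    (h : l < k) : degPart l (x * y) = 0 :=
  DirectSum.coe_decompose_mul_of_left_mem_of_not_le
    (fun i : ℕ => ⋀[ℂ]^i (Fin (n + 1) → ℂ)) hx (not_le.mpr h)

theorem ι_mem_deg (v : Fin (n + 1) → ℂ) : (ExteriorAlgebra.ι ℂ v : Grass n) ∈ deg n 1 := by
  rw [deg, ExteriorAlgebra.exteriorPower, pow_one]
  exact LinearMap.mem_range_self _ v

theorem theta_mem_deg : (theta : Grass n) ∈ deg n 1 := ι_mem_deg _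

theorem xi_mem_deg (i : Fin n) : (xi i : Grass n) ∈ deg n 1 := ι_mem_deg _

theorem algebraMap_mem_deg (r : ℂ) : algebraMap ℂ (Grass n) r ∈ deg n 0 :=
  SetLike.algebraMap_mem_graded (fun i : ℕ => ⋀[ℂ]^i (Fin (n + 1) → ℂ)) r

theorem exists_of_mem_deg_zero {x : Grass n} (hx : x ∈ deg n 0) :
    ∃ r : ℂ, x = algebraMap ℂ (Grass n) r := by
  rw [deg, ExteriorAlgebra.exteriorPower, pow_zero] at hx
  obtain ⟨r, hr⟩ := Submodule.mem_one.mp hx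
  exact ⟨r, hr.symm⟩

theorem deg_succ_induction {k : ℕ} {p : Grass n → Prop}
    (hadd : ∀ x y, p x → p y → p (x + y))
    (h : ∀ v : Fin (n + 1) → ℂ, ∀ x ∈ deg n k, p ((ExteriorAlgebra.ι ℂ v : Grass n) * x))
    {x : Grass n} (hx : x ∈ deg n (k + 1)) : p x := by
  rw [deg, ExteriorAlgebra.exteriorPower, pow_succ'] at hx
  refine Submodule.mul_induction_on hx ?_ hadd
  rintro _ ⟨v, rfl⟩ y hy
  exact h v y hy

theorem parity_of_mem_deg {k : ℕ} {x : Grass n} (hx : x ∈ deg n k) :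
    parity x = (-1 : ℂ) ^ k • x := by
  induction k generalizing x with
  | zero =>
    obtain ⟨r, rfl⟩ := exists_of_mem_deg_zero hx
    simp
  | succ k ih =>
    refine deg_succ_induction (k := k) (p := fun x => parity x = (-1 : ℂ) ^ (k + 1) • x)
      (fun x y hx hy => ?_) (fun v y hy => ?_) hx
    · rw [map_add, hx, hy, smul_add]
    · rw [map_mul, parity_ι, ih hy, pow_succ, mul_smul_comm, neg_mul]
      module

theorem dOdd_mem_deg {k : ℕ} (j : Fin (n + 1)) {x : Grass n} (hx : x ∈ deg n (k + 1)) :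
    dOdd j x ∈ deg n k := by
  induction k generalizing x with
  | zero =>
    refine deg_succ_induction (k := 0) (p := fun x => dOdd j x ∈ deg n 0)
      (fun x y hx hy => ?_) (fun v y hy => ?_) hx
    · rw [map_add]; exact add_mem hx hy
    · obtain ⟨r, rfl⟩ := exists_of_mem_deg_zero hy
      rw [dOdd_mul, dOdd_ι, dOdd_algebraMap, mul_zero, add_zero, ← map_mul]
      exact algebraMap_mem_deg _
  | succ k ih =>
    refine deg_succ_induction (k := k + 1) (p := fun x => dOdd j x ∈ deg n (k + 1))
      (fun x y hx hy => ?_) (fun v y hy => ?_) hx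
    · rw [map_add]; exact add_mem hx hy
    · rw [dOdd_mul, dOdd_ι, parity_ι, neg_mul, ← Algebra.smul_def]
      have h := mul_mem_deg (ι_mem_deg v) (ih hy)
      rw [Nat.add_comm 1 k] at h
      exact add_mem (Submodule.smul_mem _ _ hy) (neg_mem h)

theorem degPart_dOdd (k : ℕ) (j : Fin (n + 1)) (x : Grass n) :
    degPart k (dOdd j x) = dOdd j (degPart (k + 1) x) := by
  refine deg_induction (p := fun x => degPart k (dOdd j x) = dOdd j (degPart (k + 1) x))
    (by simp) (fun x y hx hy => by simp [hx, hy]) (fun m x hx => ?_) x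
  rcases m with _ | m
  · obtain ⟨r, rfl⟩ := exists_of_mem_deg_zero hx
    rw [degPart_of_mem_ne hx (by omega), dOdd_algebraMap, map_zero, map_zero]
  · by_cases h : m = k
    · subst h
      rw [degPart_of_mem hx, degPart_of_mem (dOdd_mem_deg j hx)]
    · rw [degPart_of_mem_ne hx (by omega), degPart_of_mem_ne (dOdd_mem_deg j hx) h, map_zero]

theorem degPart_map (L : Grass n →ₗ[ℂ] Grass n) (hL : ∀ k, ∀ x ∈ deg n k, L x ∈ deg n k)
    (k : ℕ) (x : Grass n) : degPart k (L x) = L (degPart k x) := by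
  refine deg_induction (p := fun x => degPart k (L x) = L (degPart k x))
    (by simp) (fun x y hx hy => by simp [hx, hy]) (fun m x hx => ?_) x
  by_cases h : m = k
  · subst h
    rw [degPart_of_mem hx, degPart_of_mem (hL _ _ hx)]
  · rw [degPart_of_mem_ne hx h, degPart_of_mem_ne (hL _ _ hx) h, map_zero]

theorem rescale_mem_deg {k : ℕ} (c : ℂ) {x : Grass n} (hx : x ∈ deg n k) :
    rescale c x ∈ deg n k := by
  rw [rescale_eq]
  refine add_mem hx (Submodule.smul_mem _ _ ?_)
  rcases k with _ | k
  · obtain ⟨r, rfl⟩ := exists_of_mem_deg_zero hx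
    rw [dOdd_algebraMap, mul_zero]
    exact zero_mem _
  · have h := mul_mem_deg theta_mem_deg (dOdd_mem_deg 0 hx)
    rwa [Nat.add_comm 1 k] at h

theorem degPart_rescale (k : ℕ) (c : ℂ) (x : Grass n) :
    degPart k (rescale c x) = rescale c (degPart k x) :=
  degPart_map (rescale c).toLinearMap (fun _ _ hx => rescale_mem_deg c hx) k x

theorem degPart_parity (k : ℕ) (x : Grass n) : degPart k (parity x) = parity (degPart k x) := by
  refine degPart_map (parity (n := n)).toLinearMap (fun k x hx => ?_) k x
  change parity x ∈ _
  rw [parity_of_mem_deg hx]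
  exact Submodule.smul_mem _ _ hx

theorem eq_zero_of_eq_neg {x : Grass n} (h : x = -x) : x = 0 := by
  have h2 : (2 : ℂ) • x = 0 := by
    rw [two_smul]
    nth_rw 1 [h]
    exact neg_add_cancel x
  exact (smul_eq_zero.mp h2).resolve_left two_ne_zero

theorem degPart_eq_zero_of_even {k : ℕ} (hk : Odd k) {x : Grass n} (hx : parity x = x) :
    degPart k x = 0 := by
  have h := degPart_parity k x
  rw [hx, parity_of_mem_deg (degPart_mem k x), hk.neg_one_pow, neg_one_smul] at h
  exact eq_zero_of_eq_neg h

theorem degPart_eq_zero_of_odd {k : ℕ} (hk : Even k) {x : Grass n} (hx : parity x = -x) :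
    degPart k x = 0 := by
  have h := degPart_parity k x
  rw [hx, parity_of_mem_deg (degPart_mem k x), hk.neg_one_pow, one_smul, map_neg] at h
  exact eq_zero_of_eq_neg h.symm

theorem parity_of_mem_deg_one {x : Grass n} (hx : x ∈ deg n 1) : parity x = -x := by
  rw [parity_of_mem_deg hx]; simp

theorem parity_of_mem_deg_two {x : Grass n} (hx : x ∈ deg n 2) : parity x = x := by
  rw [parity_of_mem_deg hx]; simp

theorem body_of_mem_deg_succ {k : ℕ} {x : Grass n} (hx : x ∈ deg n (k + 1)) : body x = 0 := by
  refine deg_succ_induction (k := k) (p := fun x => body x = 0) (fun x y hx hy => ?_)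
    (fun v y _ => ?_) hx
  · rw [map_add, hx, hy, add_zero]
  · rw [map_mul, body_ι, zero_mul]

theorem body_algebraMap (r : ℂ) : body (algebraMap ℂ (Grass n) r) = r := body.commutes r

theorem degPart_zero_eq (x : Grass n) : degPart 0 x = algebraMap ℂ (Grass n) (body x) := by
  refine deg_induction (p := fun x => degPart 0 x = algebraMap ℂ (Grass n) (body x))
    (by simp) (fun x y hx hy => by simp [hx, hy]) (fun m x hx => ?_) x
  rcases m with _ | m
  · obtain ⟨r, rfl⟩ := exists_of_mem_deg_zero hx
    rw [degPart_of_mem hx, body_algebraMap]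
  · rw [degPart_of_mem_ne hx (by omega), body_of_mem_deg_succ hx, map_zero]

theorem deg_eq_bot {k : ℕ} (hk : n + 1 < k) {x : Grass n} (hx : x ∈ deg n k) : x = 0 := by
  have h : ⋀[ℂ]^k (Fin (n + 1) → ℂ) = ⊥ := by
    rw [← Submodule.finrank_eq_zero (R := ℂ), exteriorPower.finrank_eq]
    simp [Nat.choose_eq_zero_of_lt hk]
  have : x ∈ (⊥ : Submodule ℂ _) := h ▸ hx
  simpa using this

theorem eq_sum_degPart (x : Grass n) : x = ∑ k ∈ Finset.range (n + 2), degPart k x := by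
  refine deg_induction (p := fun x => x = ∑ k ∈ Finset.range (n + 2), degPart k x)
    (by simp) (fun x y hx hy => ?_) (fun m x hx => ?_) x
  · simp only [map_add, Finset.sum_add_distrib]
    rw [← hx, ← hy]
  · by_cases hm : m < n + 2
    · rw [Finset.sum_eq_single m, degPart_of_mem hx]
      · exact fun k _ hk => degPart_of_mem_ne hx hk.symm
      · exact fun h => absurd (Finset.mem_range.mpr hm) h
    · obtain rfl := deg_eq_bot (by omega) hx
      simp

theorem degPart_mul_of_lt {k l : ℕ} {x y : Grass n} (hx : ∀ m < k, degPart m x = 0)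
    (hy : ∀ m < l, degPart m y = 0) : ∀ m < k + l, degPart m (x * y) = 0 := by
  intro m hm
  rw [eq_sum_degPart x, Finset.sum_mul, map_sum]
  refine Finset.sum_eq_zero fun a _ => ?_
  by_cases ha : a < k
  · rw [hx a ha, zero_mul, map_zero]
  · by_cases hma : m < a
    · exact degPart_mul_left_of_lt (degPart_mem a x) y hma
    · obtain ⟨b, rfl⟩ := Nat.exists_eq_add_of_le (not_lt.mp hma)
      rw [degPart_mul_left (degPart_mem a x), hy b (by omega), mul_zero]

/-- The k-th power has no component below degree k, and degrees stop at n + 1. Since conversely a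
nilpotent element has zero body, nilpotency is how a mere algebra isomorphism of superfunctions
detects bodies. -/
theorem pow_eq_zero_of_body {x : Grass n} (hx : body x = 0) : x ^ (n + 2) = 0 := by
  have h : ∀ k : ℕ, ∀ m < k, degPart m (x ^ k) = 0 := by
    intro k
    induction k with
    | zero => intro m hm; omega
    | succ k ih =>
      rw [pow_succ]
      refine degPart_mul_of_lt ih fun m hm => ?_
      obtain rfl : m = 0 := by omega
      rw [degPart_zero_eq, hx, map_zero]
  rw [eq_sum_degPart (x ^ (n + 2))]
  exact Finset.sum_eq_zero fun k hk => h _ k (Finset.mem_range.mp hk)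

end Degree

/-! ### Wirtinger derivatives -/

section Wirtinger

variable {E F : Type*} [NormedAddCommGroup E] [NormedSpace ℂ E] [NormedAddCommGroup F]
  [NormedSpace ℂ F]

theorem dx_congr {G H : ℂ → E} {z : ℂ} (h : G =ᶠ[nhds z] H) : dx G z = dx H z := by
  simp only [dx, h.fderiv_eq]

theorem dx_const (c : E) (z : ℂ) : dx (fun _ => c) z = 0 := by
  simp [dx]

theorem dx_add {G H : ℂ → E} {z : ℂ} (hG : DifferentiableAt ℝ G z)
    (hH : DifferentiableAt ℝ H z) : dx (fun w => G w + H w) z = dx G z + dx H z := by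
  simp only [dx, fderiv_fun_add hG hH, add_apply, smul_add, smul_sub]
  abel

theorem dx_sub {G H : ℂ → E} {z : ℂ} (hG : DifferentiableAt ℝ G z)
    (hH : DifferentiableAt ℝ H z) : dx (fun w => G w - H w) z = dx G z - dx H z := by
  simp only [dx, fderiv_fun_sub hG hH, sub_apply, smul_sub]
  abel

theorem dxbar_sub {G H : ℂ → E} {z : ℂ} (hG : DifferentiableAt ℝ G z)
    (hH : DifferentiableAt ℝ H z) : dxbar (fun w => G w - H w) z = dxbar G z - dxbar H z := by
  simp only [dxbar, fderiv_fun_sub hG hH, sub_apply, smul_sub, smul_add]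
  abel

theorem fderiv_clm_comp (L : E →L[ℂ] F) {G : ℂ → E} {z : ℂ} (hG : DifferentiableAt ℝ G z)
    (v : ℂ) : fderiv ℝ (fun w => L (G w)) z v = L (fderiv ℝ G z v) := by
  have h : fderiv ℝ (fun w => L (G w)) z = (L.restrictScalars ℝ).comp (fderiv ℝ G z) :=
    ((L.restrictScalars ℝ).hasFDerivAt.comp z hG.hasFDerivAt).fderiv
  rw [h]; rfl

theorem dx_clm (L : E →L[ℂ] F) {G : ℂ → E} {z : ℂ} (hG : DifferentiableAt ℝ G z) :
    dx (fun w => L (G w)) z = L (dx G z) := by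
  simp only [dx, fderiv_clm_comp L hG, map_smul, map_sub]

theorem dxbar_clm (L : E →L[ℂ] F) {G : ℂ → E} {z : ℂ} (hG : DifferentiableAt ℝ G z) :
    dxbar (fun w => L (G w)) z = L (dxbar G z) := by
  simp only [dxbar, fderiv_clm_comp L hG, map_smul, map_add]

theorem fderiv_fun_smul_apply {c : ℂ → ℂ} {G : ℂ → E} {z : ℂ} (hc : DifferentiableAt ℝ c z)
    (hG : DifferentiableAt ℝ G z) (v : ℂ) :
    fderiv ℝ (fun w => c w • G w) z v = c z • fderiv ℝ G z v + fderiv ℝ c z v • G z := by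
  rw [fderiv_fun_smul hc hG]; rfl

theorem dx_smul {c : ℂ → ℂ} {G : ℂ → E} {z : ℂ} (hc : DifferentiableAt ℝ c z)
    (hG : DifferentiableAt ℝ G z) :
    dx (fun w => c w • G w) z = dx c z • G z + c z • dx G z := by
  simp only [dx, fderiv_fun_smul_apply hc hG, smul_eq_mul]
  module

theorem dxbar_smul {c : ℂ → ℂ} {G : ℂ → E} {z : ℂ} (hc : DifferentiableAt ℝ c z)
    (hG : DifferentiableAt ℝ G z) :
    dxbar (fun w => c w • G w) z = dxbar c z • G z + c z • dxbar G z := by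
  simp only [dxbar, fderiv_fun_smul_apply hc hG, smul_eq_mul]
  module

theorem fderiv_real_apply {h : ℂ → ℂ} {z : ℂ} (hh : DifferentiableAt ℂ h z) (v : ℂ) :
    fderiv ℝ h z v = deriv h z * v := by
  rw [hh.fderiv_restrictScalars ℝ]
  change fderiv ℂ h z v = _
  rw [fderiv_eq_smul_deriv, smul_eq_mul, mul_comm]

theorem dx_of_differentiableAt {h : ℂ → ℂ} {z : ℂ} (hh : DifferentiableAt ℂ h z) :
    dx h z = deriv h z := by
  simp only [dx, fderiv_real_apply hh, smul_eq_mul]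
  linear_combination (-1 / 2 * deriv h z) * Complex.I_mul_I

theorem dxbar_of_differentiableAt {h : ℂ → ℂ} {z : ℂ} (hh : DifferentiableAt ℂ h z) :
    dxbar h z = 0 := by
  simp only [dxbar, fderiv_real_apply hh, smul_eq_mul]
  linear_combination (1 / 2 * deriv h z) * Complex.I_mul_I

theorem fderiv_comp_holomorphic {h : ℂ → ℂ} {G : ℂ → E} {z : ℂ} (hh : DifferentiableAt ℂ h z)
    (hG : DifferentiableAt ℝ G (h z)) (v : ℂ) :
    fderiv ℝ (fun w => G (h w)) z v =
      ((deriv h z * v).re : ℂ) • fderiv ℝ G (h z) 1 +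
        ((deriv h z * v).im : ℂ) • fderiv ℝ G (h z) Complex.I := by
  have h1 : fderiv ℝ (fun w => G (h w)) z = (fderiv ℝ G (h z)).comp (fderiv ℝ h z) :=
    fderiv_comp z hG (hh.restrictScalars ℝ)
  rw [h1, ContinuousLinearMap.comp_apply, fderiv_real_apply hh]
  conv_lhs => rw [← Complex.re_add_im (deriv h z * v)]
  have : (((deriv h z * v).re : ℂ) + (deriv h z * v).im * Complex.I) =
    (deriv h z * v).re • (1 : ℂ) + (deriv h z * v).im • Complex.I := by simp
  rw [this, map_add, map_smul, map_smul, Complex.coe_smul, Complex.coe_smul]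

theorem dx_comp_holomorphic {h : ℂ → ℂ} {G : ℂ → E} {z : ℂ} (hh : DifferentiableAt ℂ h z)
    (hG : DifferentiableAt ℝ G (h z)) :
    dx (fun w => G (h w)) z = deriv h z • dx G (h z) := by
  simp only [dx, fderiv_comp_holomorphic hh hG]
  generalize deriv h z = c
  obtain ⟨a, b⟩ := c
  have hc : (⟨a, b⟩ : ℂ) = a + b * Complex.I := by apply Complex.ext <;> simp
  simp only [mul_one, Complex.mul_I_re, Complex.mul_I_im, Complex.ofReal_neg]
  rw [hc]
  simp only [smul_add, smul_sub, smul_smul]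
  match_scalars
  · ring_nf
  · ring_nf; simp only [Complex.I_sq]; ring_nf

theorem dxbar_comp_holomorphic {h : ℂ → ℂ} {G : ℂ → E} {z : ℂ} (hh : DifferentiableAt ℂ h z)
    (hG : DifferentiableAt ℝ G (h z)) :
    dxbar (fun w => G (h w)) z = starRingEnd ℂ (deriv h z) • dxbar G (h z) := by
  simp only [dxbar, fderiv_comp_holomorphic hh hG]
  generalize deriv h z = c
  obtain ⟨a, b⟩ := c
  have hc : starRingEnd ℂ (⟨a, b⟩ : ℂ) = a - b * Complex.I := by apply Complex.ext <;> simp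
  simp only [mul_one, Complex.mul_I_re, Complex.mul_I_im, Complex.ofReal_neg]
  rw [hc]
  simp only [smul_add, smul_smul]
  match_scalars
  · ring_nf
  · ring_nf; simp only [Complex.I_sq]; ring_nf

theorem contDiffOn_fderiv_apply {G : ℂ → E} {V : Set ℂ} (hV : IsOpen V)
    (hG : ContDiffOn ℝ ∞ G V) (v : ℂ) : ContDiffOn ℝ ∞ (fun z => fderiv ℝ G z v) V :=
  (hG.fderiv_of_isOpen hV (m := ∞) (by simp)).clm_apply contDiffOn_const

theorem contDiffOn_dx {G : ℂ → E} {V : Set ℂ} (hV : IsOpen V) (hG : ContDiffOn ℝ ∞ G V) :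
    ContDiffOn ℝ ∞ (dx G) V :=
  contDiffOn_const.smul ((contDiffOn_fderiv_apply hV hG 1).sub
    (contDiffOn_const.smul (contDiffOn_fderiv_apply hV hG Complex.I)))

theorem contDiffOn_dxbar {G : ℂ → E} {V : Set ℂ} (hV : IsOpen V) (hG : ContDiffOn ℝ ∞ G V) :
    ContDiffOn ℝ ∞ (dxbar G) V :=
  contDiffOn_const.smul ((contDiffOn_fderiv_apply hV hG 1).add
    (contDiffOn_const.smul (contDiffOn_fderiv_apply hV hG Complex.I)))

theorem differentiableAt_of_isOpen {G : ℂ → E} {V : Set ℂ} (hV : IsOpen V)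
    (hG : ContDiffOn ℝ ∞ G V) {z : ℂ} (hz : z ∈ V) : DifferentiableAt ℝ G z :=
  (hG.contDiffAt (hV.mem_nhds hz)).differentiableAt (by simp)

theorem dxbar_dx_comm {G : ℂ → E} {V : Set ℂ} (hV : IsOpen V) (hG : ContDiffOn ℝ ∞ G V) {z : ℂ}
    (hz : z ∈ V) : dxbar (dx G) z = dx (dxbar G) z := by
  have hc := hG.contDiffAt (hV.mem_nhds hz)
  have hs : IsSymmSndFDerivAt ℝ G z := hc.isSymmSndFDerivAt (by
    rw [minSmoothness_of_isRCLikeNormedField]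
    exact WithTop.coe_le_coe.mpr (le_top (a := (2 : ℕ∞))))
  have hd : DifferentiableAt ℝ (fderiv ℝ G) z :=
    (hc.fderiv_right (m := ∞) (by simp)).differentiableAt (by simp)
  have h1 : ∀ v w, fderiv ℝ (fun z => fderiv ℝ G z v) z w = fderiv ℝ (fderiv ℝ G) z w v := by
    intro v w
    rw [fderiv_clm_apply hd (differentiableAt_const v)]
    simp
  have hd' : ∀ v, DifferentiableAt ℝ (fun z => fderiv ℝ G z v) z := fun v =>
    hd.clm_apply (differentiableAt_const v)
  have hdI : DifferentiableAt ℝ (fun z => Complex.I • fderiv ℝ G z Complex.I) z :=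
    (hd' Complex.I).const_smul Complex.I
  have hi : ∀ w, fderiv ℝ (fun z => Complex.I • fderiv ℝ G z Complex.I) z w =
      Complex.I • fderiv ℝ (fderiv ℝ G) z w Complex.I := by
    intro w
    rw [fderiv_fun_const_smul (hd' Complex.I), smul_apply, h1]
  have e1 : ∀ w, fderiv ℝ (dx G) z w = (1 / 2 : ℂ) • (fderiv ℝ (fderiv ℝ G) z w 1 -
      Complex.I • fderiv ℝ (fderiv ℝ G) z w Complex.I) := by
    intro w
    change fderiv ℝ (fun z => (1 / 2 : ℂ) • (fderiv ℝ G z 1 -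
      Complex.I • fderiv ℝ G z Complex.I)) z w = _
    have k1 : DifferentiableAt ℝ (fun z => fderiv ℝ G z 1 -
        Complex.I • fderiv ℝ G z Complex.I) z := (hd' 1).sub ((hd' _).const_smul _)
    rw [fderiv_fun_const_smul k1, fderiv_fun_sub (hd' 1) hdI, smul_apply, sub_apply, h1, hi]
  have e2 : ∀ w, fderiv ℝ (dxbar G) z w = (1 / 2 : ℂ) • (fderiv ℝ (fderiv ℝ G) z w 1 +
      Complex.I • fderiv ℝ (fderiv ℝ G) z w Complex.I) := by
    intro w
    change fderiv ℝ (fun z => (1 / 2 : ℂ) • (fderiv ℝ G z 1 +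
      Complex.I • fderiv ℝ G z Complex.I)) z w = _
    have k1 : DifferentiableAt ℝ (fun z => fderiv ℝ G z 1 +
        Complex.I • fderiv ℝ G z Complex.I) z := (hd' 1).add ((hd' _).const_smul _)
    rw [fderiv_fun_const_smul k1, fderiv_fun_add (hd' 1) hdI, smul_apply, add_apply, h1, hi]
  have e3 := hs.eq 1 Complex.I
  rw [dxbar, dx, e1, e1, e2, e2, e3]
  module

end Wirtinger

/-! ### Calculus of superfunctions and local solvability -/

section GrassCalculus
variable {n : ℕ}

theorem dx_mul {G H : ℂ → Grass n} {z : ℂ} (hG : DifferentiableAt ℝ G z)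
    (hH : DifferentiableAt ℝ H z) :
    dx (fun w => G w * H w) z = dx G z * H z + G z * dx H z := by
  simp only [dx, fderiv_fun_mul' hG hH, add_apply,
    smul_apply, smul_eq_mul, MulOpposite.smul_eq_mul_unop,
    MulOpposite.unop_op, smul_add, mul_sub, sub_mul, smul_mul_assoc, mul_smul_comm, smul_sub]
  abel

theorem dx_linear (L : Grass n →ₗ[ℂ] Grass n) {G : ℂ → Grass n} {z : ℂ}
    (hG : DifferentiableAt ℝ G z) : dx (fun w => L (G w)) z = L (dx G z) :=
  dx_clm L.toContinuousLinearMap hG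

theorem dx_const_mul (x : Grass n) {G : ℂ → Grass n} {z : ℂ} (hG : DifferentiableAt ℝ G z) :
    dx (fun w => x * G w) z = x * dx G z :=
  dx_linear (LinearMap.mulLeft ℂ x) hG

theorem dxbar_const_mul (x : Grass n) {G : ℂ → Grass n} {z : ℂ} (hG : DifferentiableAt ℝ G z) :
    dxbar (fun w => x * G w) z = x * dxbar G z :=
  dxbar_linear (LinearMap.mulLeft ℂ x) hG

theorem contDiffOn_linear (L : Grass n →ₗ[ℂ] Grass n) {G : ℂ → Grass n} {V : Set ℂ}
    (hG : ContDiffOn ℝ ∞ G V) : ContDiffOn ℝ ∞ (fun w => L (G w)) V :=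
  (realCLM L).contDiff.comp_contDiffOn hG

theorem differentiableAt_linear (L : Grass n →ₗ[ℂ] Grass n) {G : ℂ → Grass n} {z : ℂ}
    (hG : DifferentiableAt ℝ G z) : DifferentiableAt ℝ (fun w => L (G w)) z :=
  (realCLM L).differentiableAt.comp z hG

theorem dx_algebraMap {h : ℂ → ℂ} {z : ℂ} (hh : DifferentiableAt ℂ h z) :
    dx (fun w => algebraMap ℂ (Grass n) (h w)) z = algebraMap ℂ (Grass n) (deriv h z) := by
  rw [← dx_of_differentiableAt hh]
  exact dx_clm (Algebra.linearMap ℂ (Grass n)).toContinuousLinearMap (hh.restrictScalars ℝ)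

theorem dxbar_algebraMap {h : ℂ → ℂ} {z : ℂ} (hh : DifferentiableAt ℂ h z) :
    dxbar (fun w => algebraMap ℂ (Grass n) (h w)) z = 0 := by
  have := dxbar_clm (Algebra.linearMap ℂ (Grass n)).toContinuousLinearMap (hh.restrictScalars ℝ)
  rw [dxbar_of_differentiableAt hh, map_zero] at this
  exact this

/-- Serves `dx_mem`: linear maps commute with ∂/∂x, so a condition of the form "values in a fixed
subspace" (given degree, given order in ξ, no θ) passes to derivatives once the subspace is a
kernel. -/
theorem exists_linear_ker_eq (P : Submodule ℂ (Grass n)) :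
    ∃ L : Grass n →ₗ[ℂ] Grass n, LinearMap.ker L = P := by
  obtain ⟨Q, hQ⟩ := P.exists_isCompl
  exact ⟨Q.projection P hQ.symm, Submodule.ker_projection hQ.symm⟩

theorem dx_mem {P : Submodule ℂ (Grass n)} {G : ℂ → Grass n} {z : ℂ}
    (hG : DifferentiableAt ℝ G z) (h : ∀ᶠ w in nhds z, G w ∈ P) : dx G z ∈ P := by
  obtain ⟨L, rfl⟩ := exists_linear_ker_eq P
  rw [LinearMap.mem_ker, ← dx_linear L hG,
    dx_congr (H := fun _ => 0) (h.mono fun w hw => hw), dx_const]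

theorem dx_rescale {c h : ℂ → ℂ} {G : ℂ → Grass n} {z : ℂ}
    (hc : DifferentiableAt ℂ c z) (hh : DifferentiableAt ℂ h z)
    (hG : DifferentiableAt ℝ G (h z)) :
    dx (fun w => rescale (c w) (G (h w))) z =
      deriv h z • rescale (c z) (dx G (h z)) + deriv c z • (theta * dOdd 0 (G (h z))) := by
  simp only [rescale_eq]
  have h1 : DifferentiableAt ℝ (fun w => G (h w)) z := hG.comp z (hh.restrictScalars ℝ)
  have h2 : DifferentiableAt ℝ (fun w => theta * dOdd 0 (G (h w))) z :=
    differentiableAt_linear (LinearMap.mulLeft ℂ theta ∘ₗ dOdd 0) h1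
  have h3 : dx (fun w => theta * dOdd 0 (G (h w))) z =
    theta * dOdd 0 (dx (fun w => G (h w)) z) :=
    dx_linear (LinearMap.mulLeft ℂ theta ∘ₗ dOdd 0) h1
  have hc' : DifferentiableAt ℂ (fun w => c w - 1) z := hc.sub_const 1
  have hc1 := hc'.restrictScalars ℝ
  have h4 : DifferentiableAt ℝ (fun w => (c w - 1) • (theta * dOdd 0 (G (h w)))) z := hc1.smul h2
  rw [dx_add h1 h4, dx_smul hc1 h2, h3, dx_comp_holomorphic hh hG,
    dx_of_differentiableAt hc', deriv_sub_const, map_smul, mul_smul_comm]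
  module

theorem dxbar_rescale {c h : ℂ → ℂ} {G : ℂ → Grass n} {z : ℂ}
    (hc : DifferentiableAt ℂ c z) (hh : DifferentiableAt ℂ h z)
    (hG : DifferentiableAt ℝ G (h z)) :
    dxbar (fun w => rescale (c w) (G (h w))) z =
      starRingEnd ℂ (deriv h z) • rescale (c z) (dxbar G (h z)) := by
  simp only [rescale_eq]
  have h1 : DifferentiableAt ℝ (fun w => G (h w)) z := hG.comp z (hh.restrictScalars ℝ)
  have h2 : DifferentiableAt ℝ (fun w => theta * dOdd 0 (G (h w))) z :=
    differentiableAt_linear (LinearMap.mulLeft ℂ theta ∘ₗ dOdd 0) h1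
  have h3 : dxbar (fun w => theta * dOdd 0 (G (h w))) z =
    theta * dOdd 0 (dxbar (fun w => G (h w)) z) :=
    dxbar_linear (LinearMap.mulLeft ℂ theta ∘ₗ dOdd 0) h1
  have hc' : DifferentiableAt ℂ (fun w => c w - 1) z := hc.sub_const 1
  have hc1 := hc'.restrictScalars ℝ
  have h4 : DifferentiableAt ℝ (fun w => (c w - 1) • (theta * dOdd 0 (G (h w)))) z := hc1.smul h2
  rw [dxbar_add h1 h4, dxbar_smul hc1 h2, h3, dxbar_comp_holomorphic hh hG,
    dxbar_of_differentiableAt hc', map_smul, mul_smul_comm]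
  module

theorem contDiffOn_rescale {c h : ℂ → ℂ} {G : ℂ → Grass n} {V W : Set ℂ}
    (hc : ContDiffOn ℝ ∞ c V) (hh : ContDiffOn ℝ ∞ h V) (hG : ContDiffOn ℝ ∞ G W)
    (hm : Set.MapsTo h V W) : ContDiffOn ℝ ∞ (fun w => rescale (c w) (G (h w))) V := by
  simp only [rescale_eq]
  have h1 : ContDiffOn ℝ ∞ (fun w => G (h w)) V := hG.comp hh hm
  have h2 : ContDiffOn ℝ ∞ (fun w => theta * dOdd 0 (G (h w))) V :=
    contDiffOn_linear (LinearMap.mulLeft ℂ theta ∘ₗ dOdd 0) h1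
  exact h1.add ((hc.sub contDiffOn_const).smul h2)

theorem contDiff_cutoff {G : ℂ → Grass n} {V : Set ℂ} (hV : IsOpen V) (hG : ContDiffOn ℝ ∞ G V)
    {z₀ : ℂ} (b : ContDiffBump z₀) (hb : Metric.closedBall z₀ b.rOut ⊆ V) :
    ContDiff ℝ ∞ (fun z => (b z : ℂ) • G z) := by
  rw [contDiff_iff_contDiffAt]
  intro z
  by_cases hz : z ∈ V
  · exact (Complex.ofRealCLM.contDiff.contDiffAt.comp z b.contDiffAt).smul
      (hG.contDiffAt (hV.mem_nhds hz))
  · have h1 : z ∉ tsupport b := by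
      rw [b.tsupport_eq]
      exact fun h => hz (hb h)
    have h2 : (fun z => (b z : ℂ) • G z) =ᶠ[nhds z] fun _ => 0 := by
      filter_upwards [(isClosed_tsupport b).isOpen_compl.mem_nhds h1] with w hw
      rw [image_eq_zero_of_notMem_tsupport hw, Complex.ofReal_zero, zero_smul]
    exact contDiffAt_const.congr_of_eventuallyEq h2

/-- Local solvability of the inhomogeneous equation for the operator `∂̄ - l ∂/∂θ`. -/
theorem exists_local_solution {V : Set ℂ} (hV : IsOpen V) {z₀ : ℂ} (hz₀ : z₀ ∈ V)
    {l F : ℂ → Grass n} (hl : ContDiffOn ℝ ∞ l V) (hF : ContDiffOn ℝ ∞ F V)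
    (hl0 : ∀ z ∈ V, dOdd 0 (l z) = 0) :
    ∃ V' : Set ℂ, IsOpen V' ∧ z₀ ∈ V' ∧ V' ⊆ V ∧ ∃ m : ℂ → Grass n, ContDiff ℝ ∞ m ∧
      ∀ z ∈ V', dxbar m z - l z * dOdd 0 (m z) = F z := by
  obtain ⟨r, hr, hrV⟩ := Metric.nhds_basis_closedBall.mem_iff.mp (hV.mem_nhds hz₀)
  -- The cutoff equals 1 on the ball of radius r/2, where the equation is to be solved.
  let b : ContDiffBump z₀ := ⟨r / 2, r, by positivity, by linarith⟩
  have hb : Metric.closedBall z₀ b.rOut ⊆ V := hrV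
  have hcs : ∀ G : ℂ → Grass n, HasCompactSupport fun z => (b z : ℂ) • G z := fun G =>
    HasCompactSupport.smul_right (f := fun z => (b z : ℂ))
      (b.hasCompactSupport.comp_left (g := fun x : ℝ => (x : ℂ)) Complex.ofReal_zero)
  obtain ⟨m₁, hm₁, e₁⟩ := exists_dxbar_eq (contDiff_cutoff hV hF b hb) (hcs F)
  have hl' := contDiff_cutoff hV hl b hb
  have hd₁ : ContDiff ℝ ∞ fun z => dOdd 0 (m₁ z) := (realCLM (dOdd 0)).contDiff.comp hm₁
  have hs₂ : HasCompactSupport fun z => ((b z : ℂ) • l z) * dOdd 0 (m₁ z) := (hcs l).mul_right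
  -- The operator is triangular in θ: after ∂̄m₁ = F, the error l ∂m₁/∂θ is removed by a solution of
  -- ∂̄m₂ = l ∂m₁/∂θ. On the ball this right-hand side is free of θ, so m₂ may be evaluated at θ =
  -- 0, and then ∂/∂θ produces no further error.
  obtain ⟨m₂, hm₂, e₂⟩ := exists_dxbar_eq (hl'.mul hd₁) hs₂
  have hm₂' : ContDiff ℝ ∞ fun z => rescale 0 (m₂ z) :=
    (realCLM (rescale (n := n) 0).toLinearMap).contDiff.comp hm₂
  refine ⟨Metric.ball z₀ (r / 2), Metric.isOpen_ball, Metric.mem_ball_self (by positivity),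
    fun z hz => hrV (Metric.ball_subset_closedBall.trans
      (Metric.closedBall_subset_closedBall (by linarith)) hz),
    fun z => m₁ z + rescale 0 (m₂ z), hm₁.add hm₂', fun z hz => ?_⟩
  have hzV : z ∈ V := hrV (Metric.ball_subset_closedBall.trans
      (Metric.closedBall_subset_closedBall (by linarith)) hz)
  have hb1 : b z = 1 := b.one_of_mem_closedBall (Metric.ball_subset_closedBall hz)
  have d₁ : DifferentiableAt ℝ m₁ z := (hm₁.differentiable (by simp)) z
  have d₂ : DifferentiableAt ℝ m₂ z := (hm₂.differentiable (by simp)) z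
  have e₃ : dxbar (fun z => rescale 0 (m₂ z)) z = rescale 0 (dxbar m₂ z) :=
    dxbar_linear (rescale (n := n) 0).toLinearMap d₂
  rw [dxbar_add d₁ ((hm₂'.differentiable (by simp)) z), e₁, e₃, e₂, hb1, map_add,
    dOdd_zero_rescale_zero, Complex.ofReal_one, one_smul, one_smul, add_zero, rescale_eq_self,
    add_sub_cancel_right]
  rw [dOdd_mul, hl0 z hzV, dOdd_dOdd, zero_mul, mul_zero, add_zero]

end GrassCalculus

/-! ### Transition functions and gluing of vector fields -/

section Gluing

variable {C : Type u} [TopologicalSpace C] [ChartedSpace ℂ C]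

namespace SpinAtlas

variable (S : SpinAtlas C) {n : ℕ}

theorem mem_overlap {α β : S.ι} {z : ℂ} :
    z ∈ S.overlap α β ↔ z ∈ (S.chart α).target ∧ (S.chart α).symm z ∈ (S.chart β).source := by
  simp only [overlap, OpenPartialHomeomorph.trans_source, Set.mem_inter_iff,
    OpenPartialHomeomorph.symm_source, Set.mem_preimage]

theorem isOpen_overlap (α β : S.ι) : IsOpen (S.overlap α β) :=
  ((S.chart α).symm.trans (S.chart β)).open_source

theorem trans_apply (α β : S.ι) (z : ℂ) : S.trans α β z = S.chart β ((S.chart α).symm z) := rfl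

theorem symm_trans_apply {α β : S.ι} {z : ℂ} (hz : z ∈ S.overlap α β) :
    (S.chart β).symm (S.trans α β z) = (S.chart α).symm z :=
  (S.chart β).left_inv (S.mem_overlap.mp hz).2

theorem trans_mem_target {α β : S.ι} {z : ℂ} (hz : z ∈ S.overlap α β) :
    S.trans α β z ∈ (S.chart β).target :=
  (S.chart β).map_source (S.mem_overlap.mp hz).2

theorem trans_mem_overlap {α β : S.ι} {z : ℂ} (hz : z ∈ S.overlap α β) :
    S.trans α β z ∈ S.overlap β α := by
  rw [mem_overlap, S.symm_trans_apply hz]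
  exact ⟨S.trans_mem_target hz, (S.chart α).map_target (S.mem_overlap.mp hz).1⟩

theorem trans_trans {α β : S.ι} (γ : S.ι) {z : ℂ} (hz : z ∈ S.overlap α β) :
    S.trans β γ (S.trans α β z) = S.trans α γ z := by
  rw [trans_apply, S.symm_trans_apply hz, trans_apply]

theorem trans_self {α : S.ι} {z : ℂ} (hz : z ∈ (S.chart α).target) : S.trans α α z = z :=
  (S.chart α).right_inv hz

theorem mem_overlap_self {α : S.ι} {z : ℂ} (hz : z ∈ (S.chart α).target) :
    z ∈ S.overlap α α := by
  rw [mem_overlap]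
  exact ⟨hz, (S.chart α).map_target hz⟩

theorem differentiableOn_trans (α β : S.ι) :
    DifferentiableOn ℂ (S.trans α β) (S.overlap α β) := by
  have h := StructureGroupoid.compatible_of_mem_maximalAtlas (S.chart_mem α) (S.chart_mem β)
  rw [contDiffGroupoid, mem_groupoid_of_pregroupoid] at h
  have h1 := h.1
  simp only [contDiffPregroupoid, modelWithCornersSelf_coe, modelWithCornersSelf_coe_symm,
    Function.id_comp, Function.comp_id, Set.range_id, Set.inter_univ, Set.preimage_id] at h1
  exact h1.differentiableOn (by simp)

theorem differentiableAt_trans {α β : S.ι} {z : ℂ} (hz : z ∈ S.overlap α β) :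
    DifferentiableAt ℂ (S.trans α β) z :=
  (S.differentiableOn_trans α β).differentiableAt ((S.isOpen_overlap α β).mem_nhds hz)

theorem differentiableAt_root {α β : S.ι} {z : ℂ} (hz : z ∈ S.overlap α β) :
    DifferentiableAt ℂ (S.root α β) z :=
  (S.root_holomorphic α β).differentiableAt ((S.isOpen_overlap α β).mem_nhds hz)

theorem contDiffOn_trans (α β : S.ι) : ContDiffOn ℝ ∞ (S.trans α β) (S.overlap α β) :=
  ((S.differentiableOn_trans α β).contDiffOn (S.isOpen_overlap α β)).restrict_scalars ℝ

theorem contDiffOn_root (α β : S.ι) : ContDiffOn ℝ ∞ (S.root α β) (S.overlap α β) :=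
  ((S.root_holomorphic α β).contDiffOn (S.isOpen_overlap α β)).restrict_scalars ℝ

theorem deriv_trans_ne_zero {α β : S.ι} {z : ℂ} (hz : z ∈ S.overlap α β) :
    deriv (S.trans α β) z ≠ 0 := by
  intro h0
  have h1 := (S.differentiableAt_trans hz).hasDerivAt
  have h2 := (S.differentiableAt_trans (S.trans_mem_overlap hz)).hasDerivAt
  have h3 := h2.comp z h1
  have h4 : S.trans β α ∘ S.trans α β =ᶠ[nhds z] id := by
    filter_upwards [(S.isOpen_overlap α β).mem_nhds hz] with w hw
    rw [Function.comp_apply, S.trans_trans α hw, S.trans_self (S.mem_overlap.mp hw).1, id]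
  have h5 := (hasDerivAt_id z).unique (h3.congr_of_eventuallyEq h4.symm)
  rw [h0, mul_zero] at h5
  exact one_ne_zero h5

theorem root_sq_eq {α β : S.ι} {z : ℂ} (hz : z ∈ S.overlap α β) :
    S.root α β z ^ 2 = deriv (S.trans α β) z := S.root_sq α β z hz

theorem root_ne_zero {α β : S.ι} {z : ℂ} (hz : z ∈ S.overlap α β) : S.root α β z ≠ 0 := by
  intro h
  apply S.deriv_trans_ne_zero hz
  rw [← S.root_sq_eq hz, h]
  simp

theorem root_mul {α β γ : S.ι} {z : ℂ} (hz : z ∈ S.overlap α β) (hz' : z ∈ S.overlap α γ) :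
    S.root β γ (S.trans α β z) * S.root α β z = S.root α γ z :=
  (S.root_cocycle α β γ z hz hz').symm

/-- The cocycle condition for α, α, α reads ζ = ζ², and ζ does not vanish. -/
theorem root_self {α : S.ι} {z : ℂ} (hz : z ∈ (S.chart α).target) : S.root α α z = 1 := by
  have h := S.mem_overlap_self hz
  have h1 := S.root_mul h h
  rw [S.trans_self hz] at h1
  exact mul_right_cancel₀ (S.root_ne_zero h) (h1.trans (one_mul _).symm)

theorem pullback_self {α : S.ι} {z : ℂ} (hz : z ∈ (S.chart α).target) (G : ℂ → Grass n) :
    S.pullback α α G z = G z := by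
  rw [pullback, S.root_self hz, S.trans_self hz, rescale_one]

theorem pullback_pullback {α β γ : S.ι} {z : ℂ} (hz : z ∈ S.overlap α β)
    (hz' : z ∈ S.overlap α γ) (G : ℂ → Grass n) :
    S.pullback α β (S.pullback β γ G) z = S.pullback α γ G z := by
  simp only [pullback]
  rw [rescale_rescale, S.root_mul hz hz', S.trans_trans γ hz]

/-- The second term is the derivative of ζ in ζ(x)θ: under a change of coordinates ∂/∂x acquires a
multiple of θ ∂/∂θ. -/
theorem dx_pullback {α β : S.ι} {z : ℂ} (hz : z ∈ S.overlap α β) {G : ℂ → Grass n}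
    (hG : DifferentiableAt ℝ G (S.trans α β z)) :
    dx (S.pullback α β G) z = deriv (S.trans α β) z • S.pullback α β (dx G) z +
      deriv (S.root α β) z • (theta * dOdd 0 (G (S.trans α β z))) :=
  dx_rescale (S.differentiableAt_root hz) (S.differentiableAt_trans hz) hG

theorem dxbar_pullback {α β : S.ι} {z : ℂ} (hz : z ∈ S.overlap α β) {G : ℂ → Grass n}
    (hG : DifferentiableAt ℝ G (S.trans α β z)) :
    dxbar (S.pullback α β G) z =
      starRingEnd ℂ (deriv (S.trans α β) z) • S.pullback α β (dxbar G) z :=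
  dxbar_rescale (S.differentiableAt_root hz) (S.differentiableAt_trans hz) hG

/-- The two hypotheses express the equality of the operators on the generators x_β and θ_β. Testing
on these two functions gives the converse, `Glues.cx_eq` and `Glues.cθ_eq`, so gluing amounts to two
identities between coefficients. -/
theorem app_pullback {α β : S.ι} {z c : ℂ} (hz : z ∈ S.overlap α β) {W W' : VField n}
    (h1 : deriv (S.trans α β) z • W.cx z = c • S.pullback α β W'.cx z)
    (h2 : deriv (S.root α β) z • (W.cx z * theta) + S.root α β z • W.cθ z =
      c • S.pullback α β W'.cθ z)
    {G : ℂ → Grass n} (hG : DifferentiableAt ℝ G (S.trans α β z)) :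
    W.app (S.pullback α β G) z = c • S.pullback α β (W'.app G) z := by
  have e : S.pullback α β (W'.app G) z = S.pullback α β W'.cx z * S.pullback α β (dx G) z +
      S.pullback α β W'.cθ z * dOdd 0 (G (S.trans α β z)) := by
    simp only [pullback, VField.app, map_add, map_mul, rescale_dOdd_zero]
  rw [e, smul_add, ← smul_mul_assoc, ← smul_mul_assoc, ← h1, ← h2, VField.app,
    S.dx_pullback hz hG]
  have e2 : dOdd 0 (S.pullback α β G z) = S.root α β z • dOdd 0 (G (S.trans α β z)) :=
    dOdd_zero_rescale _ _
  rw [e2, mul_add, add_mul]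
  simp only [smul_mul_assoc, mul_smul_comm, mul_assoc, add_assoc]

theorem Glues.cx_eq {c : S.ι → S.ι → ℂ → ℂ} {W : S.ι → VField n} (h : S.Glues c W) {α β : S.ι}
    {z : ℂ} (hz : z ∈ S.overlap α β) :
    deriv (S.trans α β) z • (W α).cx z = c α β z • S.pullback α β (W β).cx z := by
  have hG : ContDiff ℝ ∞ fun w : ℂ => algebraMap ℂ (Grass n) w :=
    ((Algebra.linearMap ℂ (Grass n)).toContinuousLinearMap.restrictScalars ℝ).contDiff
  have h1 := h α β _ hG.contDiffOn z hz
  have e1 : ∀ w, dx (fun w : ℂ => algebraMap ℂ (Grass n) w) w = 1 := fun w => by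
    rw [dx_algebraMap (h := fun w => w) differentiableAt_fun_id]; simp
  simp only [VField.app, S.dx_pullback hz ((hG.differentiable (by simp)) _)] at h1
  simp only [pullback, VField.app, e1, AlgHom.commutes, dOdd_algebraMap, map_one, mul_zero,
    smul_zero, add_zero, mul_one, mul_smul_comm] at h1
  exact h1

theorem Glues.cθ_eq {c : S.ι → S.ι → ℂ → ℂ} {W : S.ι → VField n} (h : S.Glues c W) {α β : S.ι}
    {z : ℂ} (hz : z ∈ S.overlap α β) :
    deriv (S.root α β) z • ((W α).cx z * theta) + S.root α β z • (W α).cθ z =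
      c α β z • S.pullback α β (W β).cθ z := by
  have h1 := h α β (fun _ => theta) contDiffOn_const z hz
  simp only [VField.app, S.dx_pullback hz (differentiableAt_const _)] at h1
  simp only [pullback, VField.app, dx_const, map_zero, dOdd_zero_theta, mul_zero,
    smul_zero, zero_add, mul_one, mul_smul_comm, dOdd_zero_rescale] at h1
  exact h1

theorem glues_of_eq {c : S.ι → S.ι → ℂ → ℂ} {W : S.ι → VField n}
    (h1 : ∀ α β, ∀ z ∈ S.overlap α β,
      deriv (S.trans α β) z • (W α).cx z = c α β z • S.pullback α β (W β).cx z)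
    (h2 : ∀ α β, ∀ z ∈ S.overlap α β,
      deriv (S.root α β) z • ((W α).cx z * theta) + S.root α β z • (W α).cθ z =
        c α β z • S.pullback α β (W β).cθ z) : S.Glues c W :=
  fun α β _ hG z hz => S.app_pullback hz (h1 α β z hz) (h2 α β z hz)
    (differentiableAt_of_isOpen (S.chart β).open_target hG (S.trans_mem_target hz))

end SpinAtlas

end Gluing

/-! ### Even vector fields as derivations -/

section VectorFields
variable {n : ℕ}

theorem VField.app_congr (W : VField n) {G H : ℂ → Grass n} {z : ℂ} (h : G =ᶠ[nhds z] H) :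
    W.app G z = W.app H z := by
  simp only [app, dx_congr h, h.eq_of_nhds]

theorem VField.app_add (W : VField n) {G H : ℂ → Grass n} {z : ℂ} (hG : DifferentiableAt ℝ G z)
    (hH : DifferentiableAt ℝ H z) :
    W.app (fun w => G w + H w) z = W.app G z + W.app H z := by
  simp only [app, dx_add hG hH, map_add, mul_add]
  abel

theorem VField.app_sub (W : VField n) {G H : ℂ → Grass n} {z : ℂ} (hG : DifferentiableAt ℝ G z)
    (hH : DifferentiableAt ℝ H z) :
    W.app (fun w => G w - H w) z = W.app G z - W.app H z := by
  simp only [app, dx_sub hG hH, map_sub, mul_sub]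
  abel

theorem VField.app_const (W : VField n) (r : ℂ) (z : ℂ) :
    W.app (fun _ => algebraMap ℂ (Grass n) r) z = 0 := by
  simp only [app, dx_const, dOdd_algebraMap, mul_zero, add_zero]

theorem VField.app_mul (W : VField n) {G H : ℂ → Grass n} {z : ℂ}
    (hx : parity (W.cx z) = W.cx z) (hθ : parity (W.cθ z) = -W.cθ z)
    (hG : DifferentiableAt ℝ G z) (hH : DifferentiableAt ℝ H z) :
    W.app (fun w => G w * H w) z = W.app G z * H z + G z * W.app H z := by
  simp only [app, dx_mul hG hH, dOdd_mul, mul_add, add_mul]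
  rw [← mul_assoc (G z) (W.cx z), mul_eq_of_even hx, ← mul_assoc (G z) (W.cθ z),
    mul_eq_of_odd hθ]
  noncomm_ring

theorem VField.contDiffOn_app {W : VField n} {V : Set ℂ} (hV : IsOpen V)
    (hx : ContDiffOn ℝ ∞ W.cx V) (hθ : ContDiffOn ℝ ∞ W.cθ V) {G : ℂ → Grass n}
    (hG : ContDiffOn ℝ ∞ G V) : ContDiffOn ℝ ∞ (W.app G) V :=
  (hx.mul (contDiffOn_dx hV hG)).add (hθ.mul (contDiffOn_linear (dOdd 0) hG))

theorem VField.parity_app (W : VField n) {G : ℂ → Grass n} {z : ℂ}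
    (hx : parity (W.cx z) = W.cx z) (hθ : parity (W.cθ z) = -W.cθ z)
    (hG : DifferentiableAt ℝ G z) :
    W.app (fun w => parity (G w)) z = parity (W.app G z) := by
  have h : dx (fun w => parity (G w)) z = parity (dx G z) :=
    dx_linear (parity (n := n)).toLinearMap hG
  simp only [app, h, map_add, map_mul, hx, hθ, dOdd_parity, neg_mul, mul_neg]

/-- The operator `∂̄ - W`. -/
def VField.dbar (W : VField n) (G : ℂ → Grass n) (z : ℂ) : Grass n := dxbar G z - W.app G z

theorem VField.dbar_congr (W : VField n) {G H : ℂ → Grass n} {z : ℂ} (h : G =ᶠ[nhds z] H) :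
    W.dbar G z = W.dbar H z := by
  simp only [dbar, dxbar_congr h, W.app_congr h]

theorem VField.dbar_add (W : VField n) {G H : ℂ → Grass n} {z : ℂ}
    (hG : DifferentiableAt ℝ G z) (hH : DifferentiableAt ℝ H z) :
    W.dbar (fun w => G w + H w) z = W.dbar G z + W.dbar H z := by
  simp only [dbar, dxbar_add hG hH, W.app_add hG hH]
  abel

theorem VField.dbar_const (W : VField n) (r : ℂ) (z : ℂ) :
    W.dbar (fun _ => algebraMap ℂ (Grass n) r) z = 0 := by
  rw [dbar, dxbar_const, app_const, sub_zero]

theorem VField.dbar_mul (W : VField n) {G H : ℂ → Grass n} {z : ℂ}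
    (hx : parity (W.cx z) = W.cx z) (hθ : parity (W.cθ z) = -W.cθ z)
    (hG : DifferentiableAt ℝ G z) (hH : DifferentiableAt ℝ H z) :
    W.dbar (fun w => G w * H w) z = W.dbar G z * H z + G z * W.dbar H z := by
  simp only [dbar, dxbar_mul hG hH, W.app_mul hx hθ hG hH]
  noncomm_ring

theorem VField.parity_dbar (W : VField n) {G : ℂ → Grass n} {z : ℂ}
    (hx : parity (W.cx z) = W.cx z) (hθ : parity (W.cθ z) = -W.cθ z)
    (hG : DifferentiableAt ℝ G z) :
    W.dbar (fun w => parity (G w)) z = parity (W.dbar G z) := by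
  have h : dxbar (fun w => parity (G w)) z = parity (dxbar G z) :=
    dxbar_linear (parity (n := n)).toLinearMap hG
  rw [dbar, dbar, W.parity_app hx hθ hG, h, map_sub]

end VectorFields

/-! ### The sheaf of superfunctions annihilated by a complex structure -/

section KernelSheaf

variable {C : Type u} [TopologicalSpace C] [ChartedSpace ℂ C]

namespace SpinAtlas

variable {S : SpinAtlas C} {n : ℕ}

/-- `Λ`, locally `dx̃_α Λ_α`, is a global even vector `(0,1)`-form, so that `∂̄ - Λ` is a complex
structure on the smooth supermanifold. -/
structure IsComplexStructure (Λ : S.ι → VField n) : Prop where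
  parity_cx : ∀ α, ∀ z ∈ (S.chart α).target, parity ((Λ α).cx z) = (Λ α).cx z
  parity_cθ : ∀ α, ∀ z ∈ (S.chart α).target, parity ((Λ α).cθ z) = -(Λ α).cθ z
  glues : S.Glues (fun α β z => starRingEnd ℂ (deriv (S.trans α β) z)) Λ

/-- A smooth family of local superfunctions which is compatible on overlaps and annihilated by
`∂̄ - Λ`. -/
structure IsSection (Λ : S.ι → VField n) {U : Opens C} (s : S.Fam n U) : Prop where
  smooth : ∀ α, ContDiffOn ℝ ∞ (S.ext s α) (S.dom α U)
  compat : ∀ α β, ∀ z ∈ S.dom α U, z ∈ S.overlap α β →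
    S.ext s α z = S.pullback α β (S.ext s β) z
  dbar_eq : ∀ α, ∀ z ∈ S.dom α U, (Λ α).dbar (S.ext s α) z = 0

theorem eventuallyEq_of_dom {U : Opens C} {α : S.ι} {G H : ℂ → Grass n}
    (h : ∀ z ∈ S.dom α U, G z = H z) {z : ℂ} (hz : z ∈ S.dom α U) : G =ᶠ[nhds z] H := by
  filter_upwards [(S.isOpen_dom α U).mem_nhds hz] with w hw using h w hw

/-- To be a section may be checked on functions on the plane inducing the family. -/
theorem IsSection.of_eq {Λ : S.ι → VField n} {U : Opens C} {s : S.Fam n U}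
    (K : S.ι → ℂ → Grass n) (h : ∀ α, ∀ z ∈ S.dom α U, S.ext s α z = K α z)
    (h1 : ∀ α, ContDiffOn ℝ ∞ (K α) (S.dom α U))
    (h2 : ∀ α β, ∀ z ∈ S.dom α U, z ∈ S.overlap α β → K α z = S.pullback α β (K β) z)
    (h3 : ∀ α, ∀ z ∈ S.dom α U, (Λ α).dbar (K α) z = 0) : IsSection Λ s where
  smooth α := (h1 α).congr (h α)
  compat α β z hz hz' := by
    rw [h α z hz, h2 α β z hz hz']
    simp only [pullback, h β _ (S.trans_mem_dom hz hz')]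
  dbar_eq α z hz := by
    rw [(Λ α).dbar_congr (eventuallyEq_of_dom (h α) hz), h3 α z hz]

theorem IsSection.differentiableAt {Λ : S.ι → VField n} {U : Opens C} {s : S.Fam n U}
    (hs : IsSection Λ s) {α : S.ι} {z : ℂ} (hz : z ∈ S.dom α U) :
    DifferentiableAt ℝ (S.ext s α) z :=
  S.differentiableAt_of_contDiffOn (hs.smooth α) hz

theorem ext_add {U : Opens C} (s t : S.Fam n U) {α : S.ι} {z : ℂ} (hz : z ∈ S.dom α U) :
    S.ext (s + t) α z = S.ext s α z + S.ext t α z := by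
  rw [S.ext_apply _ hz, S.ext_apply _ hz, S.ext_apply _ hz]; rfl

theorem ext_mul {U : Opens C} (s t : S.Fam n U) {α : S.ι} {z : ℂ} (hz : z ∈ S.dom α U) :
    S.ext (s * t) α z = S.ext s α z * S.ext t α z := by
  rw [S.ext_apply _ hz, S.ext_apply _ hz, S.ext_apply _ hz]; rfl

theorem ext_famRes {U V : Opens C} (h : U ≤ V) (s : S.Fam n V) {α : S.ι} {z : ℂ}
    (hz : z ∈ S.dom α U) : S.ext (S.famRes h s) α z = S.ext s α z := by
  rw [S.ext_apply _ hz, S.ext_apply _ (S.dom_mono h hz)]; rfl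

theorem ext_famParity {U : Opens C} (s : S.Fam n U) {α : S.ι} {z : ℂ}
    (hz : z ∈ S.dom α U) : S.ext (S.famParity U s) α z = parity (S.ext s α z) := by
  rw [S.ext_apply _ hz, S.ext_apply _ hz]; rfl

theorem fam_ext {U : Opens C} {s t : S.Fam n U}
    (h : ∀ α, ∀ z ∈ S.dom α U, S.ext s α z = S.ext t α z) : s = t := by
  funext α z
  have := h α z.1 z.2
  rwa [S.ext_apply _ z.2, S.ext_apply _ z.2] at this

theorem IsSection.famRes {Λ : S.ι → VField n} {U V : Opens C} (h : U ≤ V) {s : S.Fam n V}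
    (hs : IsSection Λ s) : IsSection Λ (S.famRes h s) :=
  .of_eq (S.ext s) (fun _ _ hz => ext_famRes h s hz) (fun α => (hs.smooth α).mono (S.dom_mono h))
    (fun α β z hz hz' => hs.compat α β z (S.dom_mono h hz) hz')
    fun α z hz => hs.dbar_eq α z (S.dom_mono h hz)

theorem IsComplexStructure.isSection_famParity {Λ : S.ι → VField n} (hΛ : IsComplexStructure Λ)
    {U : Opens C} {s : S.Fam n U} (hs : IsSection Λ s) : IsSection Λ (S.famParity U s) :=
  .of_eq (fun α z => parity (S.ext s α z)) (fun _ _ hz => ext_famParity s hz)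
    (fun α => contDiffOn_linear (parity (n := n)).toLinearMap (hs.smooth α))
    (fun α β z hz hz' => by
      rw [hs.compat α β z hz hz']; simp only [pullback, rescale_parity])
    fun α z hz => by
      rw [(Λ α).parity_dbar (hΛ.parity_cx α z hz.1) (hΛ.parity_cθ α z hz.1)
        (hs.differentiableAt hz), hs.dbar_eq α z hz, map_zero]

/-- The algebra of sections over `U` of the kernel of `∂̄ - Λ`. -/
def kernelSections {Λ : S.ι → VField n} (hΛ : IsComplexStructure Λ) (U : Opens C) :
    Subalgebra ℂ (S.Fam n U) where
  carrier := {s | IsSection Λ s}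
  mul_mem' {s t} hs ht :=
    IsSection.of_eq (fun α z => S.ext s α z * S.ext t α z) (fun _ _ hz => ext_mul s t hz)
      (fun α => (hs.smooth α).mul (ht.smooth α))
      (fun α β z hz hz' => by
        rw [hs.compat α β z hz hz', ht.compat α β z hz hz']; simp only [pullback, map_mul])
      fun α z hz => by
        rw [(Λ α).dbar_mul (hΛ.parity_cx α z hz.1) (hΛ.parity_cθ α z hz.1)
          (hs.differentiableAt hz) (ht.differentiableAt hz), hs.dbar_eq α z hz,
          ht.dbar_eq α z hz, zero_mul, mul_zero, add_zero]
  add_mem' {s t} hs ht :=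
    IsSection.of_eq (fun α z => S.ext s α z + S.ext t α z) (fun _ _ hz => ext_add s t hz)
      (fun α => (hs.smooth α).add (ht.smooth α))
      (fun α β z hz hz' => by
        rw [hs.compat α β z hz hz', ht.compat α β z hz hz']; simp only [pullback, map_add])
      fun α z hz => by
        rw [(Λ α).dbar_add (hs.differentiableAt hz) (ht.differentiableAt hz), hs.dbar_eq α z hz,
          ht.dbar_eq α z hz, add_zero]
  algebraMap_mem' r :=
    IsSection.of_eq (fun _ _ => algebraMap ℂ (Grass n) r)
      (fun α z hz => by rw [S.ext_apply _ hz]; rfl) (fun _ => contDiffOn_const)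
      (fun α β z _ _ => by simp only [pullback, AlgHom.commutes])
      fun α z _ => (Λ α).dbar_const r z

/-- The sheaf of superalgebras of functions annihilated by `∂̄ - Λ`. -/
def kernelPresheaf {Λ : S.ι → VField n} (hΛ : IsComplexStructure Λ) : SuperPresheaf C where
  presheaf :=
    { obj := fun U => AlgCat.of ℂ (kernelSections hΛ (unop U))
      map := fun i => AlgCat.ofHom
        (((S.famRes (leOfHom i.unop)).comp (kernelSections hΛ _).val).codRestrict
          (kernelSections hΛ _) fun s => IsSection.famRes (leOfHom i.unop) s.2)
      map_id := fun _ => rfl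
      map_comp := fun _ _ => rfl }
  parity :=
    { app := fun U => AlgCat.ofHom
        (((S.famParity (unop U)).comp (kernelSections hΛ _).val).codRestrict (kernelSections hΛ _)
          fun s => hΛ.isSection_famParity s.2)
      naturality := fun _ _ _ => rfl }
  parity_parity := by
    ext U s α z
    exact SuperRiemann.parity_parity _

theorem exists_glued {Λ : S.ι → VField n} {I : Type*} (U : I → Opens C)
    (sf : ∀ i, S.Fam n (U i)) (hsf : ∀ i, IsSection Λ (sf i))
    (hc : ∀ i j, ∀ α, ∀ z ∈ S.dom α (U i), z ∈ S.dom α (U j) →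
      S.ext (sf i) α z = S.ext (sf j) α z) :
    ∃ s : S.Fam n (iSup U), IsSection Λ s ∧
      ∀ i, ∀ α, ∀ z ∈ S.dom α (U i), S.ext s α z = S.ext (sf i) α z := by
  have hex : ∀ (α : S.ι) (z : S.dom α (iSup U)), ∃ i, z.1 ∈ S.dom α (U i) := by
    intro α z
    have h : (S.chart α).symm z.1 ∈ iSup U := z.2.2
    obtain ⟨i, hi⟩ := Opens.mem_iSup.mp h
    exact ⟨i, z.2.1, hi⟩
  choose ix hix using hex
  let s : S.Fam n (iSup U) := fun α z => S.ext (sf (ix α z)) α z.1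
  have key : ∀ i, ∀ α, ∀ z ∈ S.dom α (U i), S.ext s α z = S.ext (sf i) α z := by
    intro i α z hz
    have hz' := S.dom_mono (le_iSup U i) hz
    rw [S.ext_apply _ hz']
    exact hc _ _ α z (hix α ⟨z, hz'⟩) hz
  have hev : ∀ i, ∀ α, ∀ z ∈ S.dom α (U i), S.ext s α =ᶠ[nhds z] S.ext (sf i) α :=
    fun i α z hz => eventuallyEq_of_dom (key i α) hz
  refine ⟨s, ⟨fun α z hz => ?_, fun α β z hz hz' => ?_, fun α z hz => ?_⟩, key⟩
  · have hi := hix α ⟨z, hz⟩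
    exact ((((hsf _).smooth α).contDiffAt ((S.isOpen_dom α _).mem_nhds hi)).congr_of_eventuallyEq
      (hev _ α z hi)).contDiffWithinAt
  · have hi := hix α ⟨z, hz⟩
    rw [key _ α z hi, (hsf _).compat α β z hi hz']
    simp only [pullback]
    rw [key _ β _ (S.trans_mem_dom hi hz')]
  · have hi := hix α ⟨z, hz⟩
    rw [(Λ α).dbar_congr (hev _ α z hi), (hsf _).dbar_eq α z hi]

theorem isSheaf_kernelPresheaf {Λ : S.ι → VField n} (hΛ : IsComplexStructure Λ) :
    (kernelPresheaf hΛ).presheaf.IsSheaf := by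
  rw [TopCat.Presheaf.isSheaf_iff_isSheafUniqueGluing]
  intro I U sf hsf
  let sf' : ∀ i, S.Fam n (U i) := fun i => (show kernelSections hΛ (U i) from sf i).1
  have hc : ∀ i j, ∀ α, ∀ z ∈ S.dom α (U i), z ∈ S.dom α (U j) →
      S.ext (sf' i) α z = S.ext (sf' j) α z := by
    intro i j α z hi hj
    have h := congrArg (fun t => (show kernelSections hΛ (U i ⊓ U j) from t).1) (hsf i j)
    have hz : z ∈ S.dom α (U i ⊓ U j) := ⟨hi.1, hi.2, hj.2⟩
    have h' := congrFun (congrFun h α) ⟨z, hz⟩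
    rw [S.ext_apply _ hi, S.ext_apply _ hj]
    exact h'
  obtain ⟨s, hs, key⟩ := exists_glued U sf' (fun i => (show kernelSections hΛ (U i) from sf i).2) hc
  refine ⟨(⟨s, hs⟩ : kernelSections hΛ (iSup U)), fun i => ?_, fun t ht => ?_⟩
  · refine Subtype.ext (fam_ext (S := S) fun α z hz => ?_)
    exact (ext_famRes (le_iSup U i) s hz).trans (key i α z hz)
  · refine Subtype.ext (fam_ext (S := S) fun α z hz => ?_)
    have h : (S.chart α).symm z ∈ iSup U := hz.2
    obtain ⟨i, hi⟩ := Opens.mem_iSup.mp h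
    have hzi : z ∈ S.dom α (U i) := ⟨hz.1, hi⟩
    have h1 := congrArg (fun t => (show kernelSections hΛ (U i) from t).1) (ht i)
    have h2 := congrFun (congrFun h1 α) ⟨z, hzi⟩
    rw [key i α z hzi, S.ext_apply _ hzi, S.ext_apply _ hz]
    exact h2

/-- The factor conj(f') is common to ∂̄ and to the (0,1)-form Λ, so being annihilated by ∂̄ - Λ does
not depend on the chart. -/
theorem dbar_pullback {Λ : S.ι → VField n} (hΛ : IsComplexStructure Λ) {α β : S.ι} {z : ℂ}
    (hz : z ∈ S.overlap α β) {G : ℂ → Grass n} (hG : DifferentiableAt ℝ G (S.trans α β z)) :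
    (Λ α).dbar (S.pullback α β G) z =
      starRingEnd ℂ (deriv (S.trans α β) z) • S.pullback α β ((Λ β).dbar G) z := by
  rw [VField.dbar, S.dxbar_pullback hz hG,
    S.app_pullback hz (hΛ.glues.cx_eq S hz) (hΛ.glues.cθ_eq S hz) hG, ← smul_sub]
  simp only [pullback, VField.dbar, map_sub]

/-- The family over `U` obtained from a function in the coordinates `(x_α | θ_α, ξ)`. -/
def extendFrom (α : S.ι) (U : Opens C) (H : ℂ → Grass n) : S.Fam n U :=
  fun β z => S.pullback β α H z

theorem dom_subset_overlap {α : S.ι} {U : Opens C} (hU : (U : Set C) ⊆ (S.chart α).source)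
    {β : S.ι} {z : ℂ} (hz : z ∈ S.dom β U) : z ∈ S.overlap β α :=
  S.mem_overlap.mpr ⟨hz.1, hU hz.2⟩

theorem ext_extendFrom {α : S.ι} {U : Opens C} (H : ℂ → Grass n) {β : S.ι} {z : ℂ}
    (hz : z ∈ S.dom β U) : S.ext (extendFrom α U H) β z = S.pullback β α H z := by
  rw [S.ext_apply _ hz]; rfl

theorem ext_extendFrom_self {α : S.ι} {U : Opens C} (H : ℂ → Grass n) {z : ℂ}
    (hz : z ∈ S.dom α U) : S.ext (extendFrom α U H) α z = H z := by
  rw [ext_extendFrom H hz, S.pullback_self hz.1]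

/-- Over an open set inside one chart domain a section is the same as one function in that chart,
the other local expressions being its pull-backs. Together with `IsSection.eq_of_ext_eq` this
reduces constructions and identities over small open sets to a single chart. -/
theorem isSection_extendFrom {Λ : S.ι → VField n} (hΛ : IsComplexStructure Λ) {α : S.ι}
    {U : Opens C} (hU : (U : Set C) ⊆ (S.chart α).source) {H : ℂ → Grass n}
    (hH : ContDiffOn ℝ ∞ H (S.dom α U)) (hd : ∀ z ∈ S.dom α U, (Λ α).dbar H z = 0) :
    IsSection Λ (extendFrom α U H) := by
  have hm : ∀ β, Set.MapsTo (S.trans β α) (S.dom β U) (S.dom α U) := fun β z hz =>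
    S.trans_mem_dom hz (dom_subset_overlap hU hz)
  refine .of_eq (fun β => S.pullback β α H) (fun β z hz => ext_extendFrom H hz) (fun β => ?_)
    (fun β γ z hz hz' => ?_) (fun β z hz => ?_)
  · exact contDiffOn_rescale ((S.contDiffOn_root β α).mono fun z => dom_subset_overlap hU)
      ((S.contDiffOn_trans β α).mono fun z => dom_subset_overlap hU) hH (hm β)
  · exact (S.pullback_pullback hz' (dom_subset_overlap hU hz) H).symm
  · rw [dbar_pullback hΛ (dom_subset_overlap hU hz)
      (S.differentiableAt_of_contDiffOn hH (hm β hz))]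
    simp only [pullback, hd _ (hm β hz), map_zero, smul_zero]

theorem IsSection.eq_of_ext_eq {Λ Λ' : S.ι → VField n} {α : S.ι} {U : Opens C}
    (hU : (U : Set C) ⊆ (S.chart α).source) {s t : S.Fam n U} (hs : IsSection Λ s)
    (ht : IsSection Λ' t) (h : ∀ z ∈ S.dom α U, S.ext s α z = S.ext t α z) : s = t := by
  refine fam_ext fun β z hz => ?_
  have ho := dom_subset_overlap hU hz
  rw [hs.compat β α z hz ho, ht.compat β α z hz ho, pullback, pullback,
    h _ (S.trans_mem_dom hz ho)]

end SpinAtlas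

end KernelSheaf

/-! ### Low-degree consequences of vanishing modulo (ξ) -/

section XiIdeal
variable {n : ℕ}

theorem body_of_mem_xiIdeal {x : Grass n} (hx : x ∈ xiIdeal n) : body x = 0 := by
  refine Submodule.span_induction (p := fun x _ => body x = 0) ?_ (map_zero _) ?_ ?_ hx
  · rintro _ ⟨i, rfl⟩
    exact body_xi i
  · intro x y _ _ hx hy
    rw [map_add, hx, hy, add_zero]
  · intro a x _ hx
    rw [smul_eq_mul, map_mul, hx, mul_zero]

/-- This scalar is the coefficient of θ in the degree-one part of x. Applied to φ, it shows that β
contains no θ. -/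
theorem body_dOdd_zero_of_mem_xiIdeal {x : Grass n} (hx : x ∈ xiIdeal n) :
    body (dOdd 0 x) = 0 := by
  refine Submodule.span_induction (p := fun x hx => body (dOdd 0 x) = 0) ?_ (by simp) ?_ ?_ hx
  · rintro _ ⟨i, rfl⟩
    rw [dOdd_zero_xi, map_zero]
  · intro x y _ _ hx hy
    rw [map_add, map_add, hx, hy, add_zero]
  · intro a x hx' hx
    rw [smul_eq_mul, dOdd_mul, map_add, map_mul, map_mul, hx, body_of_mem_xiIdeal hx', mul_zero,
      mul_zero, add_zero]

end XiIdeal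

/-! ### Nilpotent perturbations and the supermanifolds they define -/

section Perturbations

variable {C : Type u} [TopologicalSpace C] [ChartedSpace ℂ C]

namespace AnalyticDeformation

open SpinAtlas

variable {S : SpinAtlas C} {n : ℕ} (D : AnalyticDeformation S n)

theorem contDiffOn_lin (α : S.ι) : ContDiffOn ℝ ∞ (D.lin α) (S.chart α).target :=
  contDiffOn_linear (degPart 1) (D.superconformal α).smooth_cθ

theorem lin_mem_deg (α : S.ι) (z : ℂ) : D.lin α z ∈ deg n 1 := degPart_mem 1 _

theorem dOdd_zero_lin {α : S.ι} {z : ℂ} (hz : z ∈ (S.chart α).target) :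
    dOdd 0 (D.lin α z) = 0 := by
  rw [lin, ← degPart_dOdd, degPart_zero_eq, body_dOdd_zero_of_mem_xiIdeal (D.vanishes α z hz).2,
    map_zero]

/-- This is the degree-one part of the law for the θ-coefficient. The inhomogeneous term `cx *
theta` does not contribute: `cx` has zero body, so the product starts in degree two. -/
theorem lin_glues {α β : S.ι} {z : ℂ} (hz : z ∈ S.overlap α β) :
    S.root α β z • D.lin α z =
      starRingEnd ℂ (deriv (S.trans α β) z) • S.pullback α β (D.lin β) z := by
  have h := congrArg (degPart 1) (D.glues.cθ_eq S hz)
  have h0 : degPart 1 ((D.φ α).cx z * theta) = 0 := by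
    refine degPart_mul_of_lt (k := 1) (l := 1) (fun m hm => ?_) (fun m hm => ?_) 1 (by norm_num)
    · obtain rfl : m = 0 := by omega
      rw [degPart_zero_eq,
        body_of_mem_xiIdeal (D.vanishes α z (S.mem_overlap.mp hz).1).1, map_zero]
    · obtain rfl : m = 0 := by omega
      rw [degPart_zero_eq, body_theta, map_zero]
  rw [map_add, map_smul, map_smul, map_smul, h0, smul_zero, zero_add] at h
  rw [lin, h, pullback, degPart_rescale]
  rfl

/-- The vector `(0,1)`-form `β ∂/∂θ` defining the holomorphic structure of `T^*_{𝒳^an,-}`. -/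
def base (α : S.ι) : VField n := ⟨fun _ => 0, D.lin α⟩

theorem base_dbar (α : S.ι) (G : ℂ → Grass n) (z : ℂ) :
    (D.base α).dbar G z = dxbar G z - D.lin α z * dOdd 0 (G z) := by
  rw [VField.dbar, VField.app, base, zero_mul, zero_add]

theorem isComplexStructure_base : IsComplexStructure D.base where
  parity_cx _ _ _ := map_zero _
  parity_cθ α z _ := parity_of_mem_deg_one (D.lin_mem_deg α z)
  glues := S.glues_of_eq
    (fun α β z _ => by simp only [base, pullback, map_zero, smul_zero])
    fun α β z hz => by
      simp only [base, zero_mul, smul_zero, zero_add]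
      exact D.lin_glues hz

theorem mem_extSections {U : Opens C} {s : S.Fam n U} :
    s ∈ D.extSections U ↔ IsSection D.base s := by
  have h : ∀ α G z, (D.base α).dbar G z = D.dbarE α G z := fun α G z => D.base_dbar α G z
  refine ⟨fun hs => ⟨hs.1, hs.2.1, fun α z hz => ?_⟩, fun hs => ⟨hs.1, hs.2, fun α z hz => ?_⟩⟩
  · rw [h, hs.2.2 α z hz]
  · rw [← h, hs.3 α z hz]

/-- Multiplication by β raises the degree by one and ∂/∂θ lowers it by one. -/
theorem base_dbar_degPart (α : S.ι) (k : ℕ) {G : ℂ → Grass n} {z : ℂ}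
    (hG : DifferentiableAt ℝ G z) :
    (D.base α).dbar (fun w => degPart k (G w)) z = degPart k ((D.base α).dbar G z) := by
  rw [base_dbar, base_dbar, dxbar_linear (degPart k) hG, map_sub]
  congr 1
  rcases k with _ | k
  · rw [degPart_mul_left_of_lt (D.lin_mem_deg α z) _ one_pos, degPart_zero_eq, dOdd_algebraMap,
      mul_zero]
  · rw [Nat.add_comm k 1, degPart_mul_left (D.lin_mem_deg α z), degPart_dOdd, Nat.add_comm k 1]

/-- A nilpotent perturbation `ξ_i ρ ∂/∂x + ξ_i κ ∂/∂θ` of the holomorphic structure of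
`⋀^• T^*_{𝒳^an,-}`. -/
structure Perturbation (_D : AnalyticDeformation S n) where
  i : Fin n
  ρ : S.ι → ℂ → Grass n
  κ : S.ι → ℂ → Grass n
  smooth_ρ : ∀ α, ContDiffOn ℝ ∞ (ρ α) (S.chart α).target
  smooth_κ : ∀ α, ContDiffOn ℝ ∞ (κ α) (S.chart α).target
  ρ_mem : ∀ α, ∀ z ∈ (S.chart α).target, ρ α z ∈ deg n 1
  κ_mem : ∀ α, ∀ z ∈ (S.chart α).target, κ α z ∈ deg n 2
  glues : S.Glues (fun α β z => starRingEnd ℂ (deriv (S.trans α β) z))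
    fun α => ⟨fun z => xi i * ρ α z, fun z => xi i * κ α z⟩

end AnalyticDeformation

/-- The vector field `ξ_i a ∂/∂x + ξ_i b ∂/∂θ`. -/
def VField.xiMul {n : ℕ} (i : Fin n) (a b : ℂ → Grass n) : VField n :=
  ⟨fun z => xi i * a z, fun z => xi i * b z⟩

theorem VField.xiMul_app {n : ℕ} (i : Fin n) (a b : ℂ → Grass n) (G : ℂ → Grass n) (z : ℂ) :
    (VField.xiMul i a b).app G z = xi i * (VField.mk a b).app G z := by
  simp only [VField.xiMul, VField.app, mul_add, mul_assoc]

theorem VField.xiMul_app_xi_mul {n : ℕ} (i : Fin n) (a b : ℂ → Grass n) {H : ℂ → Grass n} {z : ℂ}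
    (hH : DifferentiableAt ℝ H z) :
    (VField.xiMul i a b).app (fun w => xi i * H w) z = 0 := by
  simp only [VField.xiMul, VField.app, dx_const_mul _ hH, dOdd_zero_xi_mul, mul_neg,
    xi_mul_mul_xi_mul, neg_zero, add_zero]

theorem VField.xiMul_app_xiMul_app {n : ℕ} (i : Fin n) (a b a' b' : ℂ → Grass n)
    {V : Set ℂ} (hV : IsOpen V) (ha : ContDiffOn ℝ ∞ a' V) (hb : ContDiffOn ℝ ∞ b' V)
    {G : ℂ → Grass n} (hG : ContDiffOn ℝ ∞ G V) {z : ℂ} (hz : z ∈ V) :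
    (VField.xiMul i a b).app ((VField.xiMul i a' b').app G) z = 0 := by
  have h : (VField.xiMul i a' b').app G = fun w => xi i * (VField.mk a' b').app G w :=
    funext fun w => VField.xiMul_app i a' b' G w
  rw [h]
  exact VField.xiMul_app_xi_mul i a b (differentiableAt_of_isOpen hV
    (VField.contDiffOn_app (W := VField.mk a' b') hV ha hb hG) hz)

namespace AnalyticDeformation

open SpinAtlas

variable {S : SpinAtlas C} {n : ℕ} {D : AnalyticDeformation S n}

namespace Perturbation

variable (P : D.Perturbation)

/-- The local expression of the perturbation. -/
abbrev delta (α : S.ι) : VField n := VField.xiMul P.i (P.ρ α) (P.κ α)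

/-- The vector `(0,1)`-form of the perturbed complex structure. -/
def field (α : S.ι) : VField n :=
  ⟨fun z => xi P.i * P.ρ α z, fun z => D.lin α z + xi P.i * P.κ α z⟩

theorem field_dbar (α : S.ι) (G : ℂ → Grass n) (z : ℂ) :
    (P.field α).dbar G z = (D.base α).dbar G z - (P.delta α).app G z := by
  simp only [VField.dbar, VField.app, field, base, delta, VField.xiMul, add_mul, zero_mul]
  abel

theorem isComplexStructure : IsComplexStructure P.field where
  parity_cx α z hz := parity_of_mem_deg_two (mul_mem_deg (xi_mem_deg P.i) (P.ρ_mem α z hz))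
  parity_cθ α z hz := by
    have h : parity (xi P.i * P.κ α z) = -(xi P.i * P.κ α z) := by
      rw [map_mul, parity_xi, parity_of_mem_deg_two (P.κ_mem α z hz), neg_mul]
    simp only [field]
    rw [map_add, parity_of_mem_deg_one (D.lin_mem_deg α z), h, neg_add]
  glues := S.glues_of_eq
    (fun α β z hz => P.glues.cx_eq S hz)
    fun α β z hz => by
      have h1 := P.glues.cθ_eq S hz
      have h2 := D.lin_glues hz
      simp only [field, smul_add, pullback, map_add] at h1 h2 ⊢
      rw [h2, ← h1]
      abel

/-- A local trivialization `1 + ξ_i m ∂/∂x + ξ_i k ∂/∂θ` of the perturbation. -/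
structure Gauge where
  α : S.ι
  N : Opens C
  subset : (N : Set C) ⊆ (S.chart α).source
  m : ℂ → Grass n
  k : ℂ → Grass n
  smooth_m : ContDiffOn ℝ ∞ m (S.dom α N)
  smooth_k : ContDiffOn ℝ ∞ k (S.dom α N)
  m_mem : ∀ z, m z ∈ deg n 1
  k_mem : ∀ z, k z ∈ deg n 2
  dbar_m : ∀ z ∈ S.dom α N, (D.base α).dbar m z = -P.ρ α z
  dbar_k : ∀ z ∈ S.dom α N, (D.base α).dbar k z = -P.κ α z - m z * dx (D.lin α) z

theorem exists_gauge (p : C) : ∃ g : P.Gauge, p ∈ g.N := by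
  obtain ⟨α, hα⟩ := S.cover p
  have hz₀ : S.chart α p ∈ (S.chart α).target := (S.chart α).map_source hα
  -- The equation for m comes first because m enters the equation for k. Keeping only the components
  -- of degree one and two is harmless, since ∂̄_E preserves degrees and the right-hand sides are
  -- homogeneous.
  obtain ⟨V₁, hV₁, hp₁, hsub₁, m', hm', em'⟩ := exists_local_solution (S.chart α).open_target hz₀
    (D.contDiffOn_lin α) (P.smooth_ρ α).neg (fun z hz => D.dOdd_zero_lin hz)
  have hm : ContDiff ℝ ∞ fun z => degPart 1 (m' z) := (realCLM (degPart 1)).contDiff.comp hm'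
  have hlin := contDiffOn_dx (S.chart α).open_target (D.contDiffOn_lin α)
  obtain ⟨V₂, hV₂, hp₂, hsub₂, k', hk', ek'⟩ := exists_local_solution hV₁ hp₁
    ((D.contDiffOn_lin α).mono hsub₁)
    (((P.smooth_κ α).neg.mono hsub₁).sub (hm.contDiffOn.mul (hlin.mono hsub₁)))
    (fun z hz => D.dOdd_zero_lin (hsub₁ hz))
  have hk : ContDiff ℝ ∞ fun z => degPart 2 (k' z) := (realCLM (degPart 2)).contDiff.comp hk'
  let N : Opens C := ⟨(S.chart α).source ∩ S.chart α ⁻¹' V₂, (S.chart α).isOpen_inter_preimage hV₂⟩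
  have hdom : ∀ z ∈ S.dom α N, z ∈ V₂ := by
    intro z hz
    have h : S.chart α ((S.chart α).symm z) ∈ V₂ := hz.2.2
    rwa [(S.chart α).right_inv hz.1] at h
  refine ⟨⟨α, N, Set.inter_subset_left, fun z => degPart 1 (m' z), fun z => degPart 2 (k' z),
    hm.contDiffOn, hk.contDiffOn, fun z => degPart_mem 1 _, fun z => degPart_mem 2 _,
    fun z hz => ?_, fun z hz => ?_⟩, hα, hp₂⟩
  · have h := em' z (hsub₂ (hdom z hz))
    rw [D.base_dbar_degPart α 1 ((hm'.differentiable (by simp)) z), base_dbar, h]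
    simp only [map_neg, degPart_of_mem (P.ρ_mem α z hz.1)]
  · have h := ek' z (hdom z hz)
    rw [D.base_dbar_degPart α 2 ((hk'.differentiable (by simp)) z), base_dbar, h]
    have hx : dx (D.lin α) z ∈ deg n 1 := dx_mem
      (differentiableAt_of_isOpen (S.chart α).open_target (D.contDiffOn_lin α) hz.1)
      (Filter.Eventually.of_forall fun w => D.lin_mem_deg α w)
    have h2 : degPart 1 (m' z) * dx (D.lin α) z ∈ deg n 2 := mul_mem_deg (degPart_mem 1 _) hx
    simp only [map_sub, map_neg, degPart_of_mem (P.κ_mem α z hz.1),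
      degPart_of_mem h2]

namespace Gauge

variable {P} (g : P.Gauge)

/-- The nilpotent vector field of a gauge transformation. -/
abbrev nu : VField n := VField.xiMul P.i g.m g.k

theorem dom_subset_target {V : Opens C} : S.dom g.α V ⊆ (S.chart g.α).target := fun _ hz => hz.1

theorem contDiffOn_nu_app {V : Opens C} (hV : V ≤ g.N) {G : ℂ → Grass n}
    (hG : ContDiffOn ℝ ∞ G (S.dom g.α V)) : ContDiffOn ℝ ∞ (g.nu.app G) (S.dom g.α V) :=
  VField.contDiffOn_app (S.isOpen_dom g.α V)
    (contDiffOn_const.mul (g.smooth_m.mono (S.dom_mono hV)))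
    (contDiffOn_const.mul (g.smooth_k.mono (S.dom_mono hV))) hG

/-- ξ_i passes the two odd factors β and ∂/∂θ, and the two signs cancel. -/
theorem base_dbar_xi_mul (D : AnalyticDeformation S n) (α : S.ι) (i : Fin n) {H : ℂ → Grass n}
    {z : ℂ} (hH : DifferentiableAt ℝ H z) :
    (D.base α).dbar (fun w => xi i * H w) z = xi i * (D.base α).dbar H z := by
  rw [base_dbar, base_dbar, dxbar_const_mul _ hH, dOdd_zero_xi_mul, mul_sub, mul_neg,
    ← mul_assoc, mul_xi, parity_of_mem_deg_one (D.lin_mem_deg α z), mul_neg, neg_mul, neg_neg,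
    mul_assoc]

/-- The commutator of the gauge field with the holomorphic structure is the perturbation. -/
theorem base_dbar_nu_app {V : Opens C} (hV : V ≤ g.N) {G : ℂ → Grass n}
    (hG : ContDiffOn ℝ ∞ G (S.dom g.α V)) {z : ℂ} (hz : z ∈ S.dom g.α V) :
    (D.base g.α).dbar (g.nu.app G) z =
      g.nu.app ((D.base g.α).dbar G) z - (P.delta g.α).app G z := by
  have hO := S.isOpen_dom g.α V
  have hm := differentiableAt_of_isOpen hO (g.smooth_m.mono (S.dom_mono hV)) hz
  have hk := differentiableAt_of_isOpen hO (g.smooth_k.mono (S.dom_mono hV)) hz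
  have hG1 := differentiableAt_of_isOpen hO hG hz
  have hdx := contDiffOn_dx hO hG
  have hdx1 := differentiableAt_of_isOpen hO hdx hz
  have hd := contDiffOn_linear (dOdd 0) hG
  have hd1 := differentiableAt_of_isOpen hO hd hz
  have hlin : ContDiffOn ℝ ∞ (D.lin g.α) (S.dom g.α V) :=
    (D.contDiffOn_lin g.α).mono g.dom_subset_target
  have hlin1 := differentiableAt_of_isOpen hO hlin hz
  have hz' := S.dom_mono hV hz
  have hH : DifferentiableAt ℝ (fun w => g.m w * dx G w + g.k w * dOdd 0 (G w)) z :=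
    (hm.mul hdx1).add (hk.mul hd1)
  have e0 : g.nu.app G = fun w => xi P.i * (g.m w * dx G w + g.k w * dOdd 0 (G w)) :=
    funext fun w => VField.xiMul_app P.i g.m g.k G w
  have hbx := fun w => D.isComplexStructure_base.parity_cx g.α w
  have hbθ := fun w => D.isComplexStructure_base.parity_cθ g.α w
  -- Since β depends on x, ∂̄_E and ∂/∂x do not commute; their commutator is (∂β/∂x) ∂/∂θ. The term
  -- m ∂β/∂x in the equation for k cancels this defect.
  have ex : (D.base g.α).dbar (dx G) z =
      dx ((D.base g.α).dbar G) z + dx (D.lin g.α) z * dOdd 0 (G z) := by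
    have e1 : (D.base g.α).dbar G = fun w => dxbar G w - D.lin g.α w * dOdd 0 (G w) :=
      funext fun w => D.base_dbar g.α G w
    have e2 : dx (fun w => dOdd 0 (G w)) z = dOdd 0 (dx G z) := dx_linear (dOdd 0) hG1
    rw [e1, dx_sub (differentiableAt_of_isOpen hO (contDiffOn_dxbar hO hG) hz) (hlin1.fun_mul hd1),
      dx_mul hlin1 hd1, e2, base_dbar, dxbar_dx_comm hO hG hz]
    abel
  have eθ : (D.base g.α).dbar (fun w => dOdd 0 (G w)) z = dOdd 0 ((D.base g.α).dbar G z) := by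
    rw [base_dbar, base_dbar, dxbar_linear (dOdd 0) hG1, map_sub, dOdd_mul, dOdd_dOdd,
      D.dOdd_zero_lin hz.1, zero_mul, mul_zero, mul_zero, add_zero]
  rw [e0, base_dbar_xi_mul D g.α P.i hH, (D.base g.α).dbar_add (hm.fun_mul hdx1) (hk.fun_mul hd1),
    (D.base g.α).dbar_mul (hbx z hz.1) (hbθ z hz.1) hm hdx1,
    (D.base g.α).dbar_mul (hbx z hz.1) (hbθ z hz.1) hk hd1, g.dbar_m z hz', g.dbar_k z hz', ex, eθ,
    VField.xiMul_app, VField.xiMul_app]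
  simp only [VField.app]
  noncomm_ring

theorem nu_app_delta_app {V : Opens C} {G : ℂ → Grass n}
    (hG : ContDiffOn ℝ ∞ G (S.dom g.α V)) {z : ℂ} (hz : z ∈ S.dom g.α V) :
    g.nu.app ((P.delta g.α).app G) z = 0 :=
  VField.xiMul_app_xiMul_app _ _ _ _ _ (S.isOpen_dom g.α V)
    ((P.smooth_ρ g.α).mono g.dom_subset_target) ((P.smooth_κ g.α).mono g.dom_subset_target) hG hz

theorem delta_app_nu_app {V : Opens C} (hV : V ≤ g.N) {G : ℂ → Grass n}
    (hG : ContDiffOn ℝ ∞ G (S.dom g.α V)) {z : ℂ} (hz : z ∈ S.dom g.α V) :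
    (P.delta g.α).app (g.nu.app G) z = 0 :=
  VField.xiMul_app_xiMul_app _ _ _ _ _ (S.isOpen_dom g.α V)
    (g.smooth_m.mono (S.dom_mono hV)) (g.smooth_k.mono (S.dom_mono hV)) hG hz

theorem nu_app_nu_app {V : Opens C} (hV : V ≤ g.N) {G : ℂ → Grass n}
    (hG : ContDiffOn ℝ ∞ G (S.dom g.α V)) {z : ℂ} (hz : z ∈ S.dom g.α V) :
    g.nu.app (g.nu.app G) z = 0 :=
  VField.xiMul_app_xiMul_app _ _ _ _ _ (S.isOpen_dom g.α V)
    (g.smooth_m.mono (S.dom_mono hV)) (g.smooth_k.mono (S.dom_mono hV)) hG hz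

/-- The gauge transformation. -/
def act (G : ℂ → Grass n) (z : ℂ) : Grass n := G z + g.nu.app G z

/-- The inverse gauge transformation. -/
def actInv (G : ℂ → Grass n) (z : ℂ) : Grass n := G z - g.nu.app G z

theorem subset_of_le {V : Opens C} (hV : V ≤ g.N) : (V : Set C) ⊆ (S.chart g.α).source :=
  fun _ hx => g.subset (hV hx)

theorem parity_nu_cx (z : ℂ) : parity (g.nu.cx z) = g.nu.cx z :=
  parity_of_mem_deg_two (mul_mem_deg (xi_mem_deg P.i) (g.m_mem z))

theorem parity_nu_cθ (z : ℂ) : parity (g.nu.cθ z) = -g.nu.cθ z := by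
  simp only [nu, VField.xiMul]
  rw [map_mul, parity_xi, parity_of_mem_deg_two (g.k_mem z), neg_mul]

theorem act_congr {G H : ℂ → Grass n} {z : ℂ} (h : G =ᶠ[nhds z] H) : g.act G z = g.act H z := by
  rw [act, act, h.eq_of_nhds, g.nu.app_congr h]

theorem actInv_congr {G H : ℂ → Grass n} {z : ℂ} (h : G =ᶠ[nhds z] H) :
    g.actInv G z = g.actInv H z := by
  rw [actInv, actInv, h.eq_of_nhds, g.nu.app_congr h]

/-- For a derivation ν, the map 1 + ν is multiplicative as soon as the values of ν multiply to zero,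
and here they share the factor ξ_i. -/
theorem act_mul {G H : ℂ → Grass n} {z : ℂ} (hG : DifferentiableAt ℝ G z)
    (hH : DifferentiableAt ℝ H z) :
    g.act (fun w => G w * H w) z = g.act G z * g.act H z := by
  have h : g.nu.app G z * g.nu.app H z = 0 := by
    rw [VField.xiMul_app, VField.xiMul_app, xi_mul_mul_xi_mul]
  rw [act, act, act, g.nu.app_mul (g.parity_nu_cx z) (g.parity_nu_cθ z) hG hH, add_mul, mul_add,
    mul_add, h]
  abel

/-- If ∂̄_E s = δs, then [∂̄_E, ν] = -δ and νδ = 0 give ∂̄_E (s + νs) = δs + νδs - δs = 0. -/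
theorem isSection_act {V : Opens C} (hV : V ≤ g.N) {s : S.Fam n V} (hs : IsSection P.field s) :
    IsSection D.base (extendFrom g.α V (g.act (S.ext s g.α))) := by
  have hG := hs.smooth g.α
  have hO := S.isOpen_dom g.α V
  refine isSection_extendFrom D.isComplexStructure_base (g.subset_of_le hV)
    (hG.add (g.contDiffOn_nu_app hV hG)) fun z hz => ?_
  have e : ∀ w ∈ S.dom g.α V, (D.base g.α).dbar (S.ext s g.α) w =
      (P.delta g.α).app (S.ext s g.α) w := fun w hw => by
    have := hs.dbar_eq g.α w hw
    rwa [field_dbar, sub_eq_zero] at this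
  change (D.base g.α).dbar (fun w => S.ext s g.α w + g.nu.app (S.ext s g.α) w) z = 0
  rw [VField.dbar_add _ (hs.differentiableAt hz)
    (differentiableAt_of_isOpen hO (g.contDiffOn_nu_app hV hG) hz), g.base_dbar_nu_app hV hG hz,
    g.nu.app_congr (eventuallyEq_of_dom e hz), g.nu_app_delta_app hG hz, e z hz]
  abel

/-- If ∂̄_E t = 0, then (∂̄_E - δ)(t - νt) = δt - δt + δνt = 0, because δν = 0. -/
theorem isSection_actInv {V : Opens C} (hV : V ≤ g.N) {t : S.Fam n V}
    (ht : IsSection D.base t) :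
    IsSection P.field (extendFrom g.α V (g.actInv (S.ext t g.α))) := by
  have hG := ht.smooth g.α
  have hO := S.isOpen_dom g.α V
  have hν := g.contDiffOn_nu_app hV hG
  refine isSection_extendFrom P.isComplexStructure (g.subset_of_le hV) (hG.sub hν)
    fun z hz => ?_
  have e : ∀ w ∈ S.dom g.α V, (D.base g.α).dbar (S.ext t g.α) w = 0 := ht.dbar_eq g.α
  have e' : g.nu.app ((D.base g.α).dbar (S.ext t g.α)) z = 0 := by
    rw [g.nu.app_congr (H := fun _ => algebraMap ℂ (Grass n) 0)
      (eventuallyEq_of_dom (fun w hw => (e w hw).trans (map_zero _).symm) hz), VField.app_const]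
  have d1 := ht.differentiableAt (α := g.α) hz
  have d2 := differentiableAt_of_isOpen hO hν hz
  change (P.field g.α).dbar (fun w => S.ext t g.α w - g.nu.app (S.ext t g.α) w) z = 0
  have e2 : (D.base g.α).dbar (fun w => S.ext t g.α w - g.nu.app (S.ext t g.α) w) z =
      (D.base g.α).dbar (S.ext t g.α) z - (D.base g.α).dbar (g.nu.app (S.ext t g.α)) z := by
    rw [VField.dbar, VField.dbar, VField.dbar, dxbar_sub d1 d2, VField.app_sub _ d1 d2]
    abel
  rw [field_dbar, e2, VField.app_sub _ d1 d2, g.base_dbar_nu_app hV hG hz, e', e z hz,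
    g.delta_app_nu_app hV hG hz]
  abel

theorem act_actInv {V : Opens C} (hV : V ≤ g.N) {G : ℂ → Grass n}
    (hG : ContDiffOn ℝ ∞ G (S.dom g.α V)) {z : ℂ} (hz : z ∈ S.dom g.α V) :
    g.act (g.actInv G) z = G z := by
  have d1 := differentiableAt_of_isOpen (S.isOpen_dom g.α V) hG hz
  have d2 := differentiableAt_of_isOpen (S.isOpen_dom g.α V) (g.contDiffOn_nu_app hV hG) hz
  have e : g.nu.app (g.actInv G) z = g.nu.app G z - g.nu.app (g.nu.app G) z :=
    VField.app_sub _ d1 d2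
  rw [act, e, g.nu_app_nu_app hV hG hz, actInv]
  abel

theorem actInv_act {V : Opens C} (hV : V ≤ g.N) {G : ℂ → Grass n}
    (hG : ContDiffOn ℝ ∞ G (S.dom g.α V)) {z : ℂ} (hz : z ∈ S.dom g.α V) :
    g.actInv (g.act G) z = G z := by
  have d1 := differentiableAt_of_isOpen (S.isOpen_dom g.α V) hG hz
  have d2 := differentiableAt_of_isOpen (S.isOpen_dom g.α V) (g.contDiffOn_nu_app hV hG) hz
  have e : g.nu.app (g.act G) z = g.nu.app G z + g.nu.app (g.nu.app G) z :=
    VField.app_add _ d1 d2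
  rw [actInv, e, g.nu_app_nu_app hV hG hz, act]
  abel

theorem act_parity {G : ℂ → Grass n} {z : ℂ} (hG : DifferentiableAt ℝ G z) :
    g.act (fun w => parity (G w)) z = parity (g.act G z) := by
  rw [act, act, g.nu.parity_app (g.parity_nu_cx z) (g.parity_nu_cθ z) hG, map_add]

/-- The gauge transformation as an isomorphism of algebras of sections. -/
def equiv (V : Opens C) (hV : V ≤ g.N) :
    kernelSections P.isComplexStructure V ≃ₐ[ℂ] D.extSections V where
  toFun s := ⟨extendFrom g.α V (g.act (S.ext s.1 g.α)),
    D.mem_extSections.mpr (g.isSection_act hV s.2)⟩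
  invFun t := ⟨extendFrom g.α V (g.actInv (S.ext t.1 g.α)),
    g.isSection_actInv hV (D.mem_extSections.mp t.2)⟩
  left_inv s := by
    refine Subtype.ext (IsSection.eq_of_ext_eq (g.subset_of_le hV)
      (g.isSection_actInv hV (g.isSection_act hV s.2)) s.2 fun z hz => ?_)
    rw [ext_extendFrom_self _ hz, g.actInv_congr (eventuallyEq_of_dom
      (fun w hw => ext_extendFrom_self _ hw) hz)]
    exact g.actInv_act hV (s.2.smooth g.α) hz
  right_inv t := by
    have ht := D.mem_extSections.mp t.2
    refine Subtype.ext (IsSection.eq_of_ext_eq (g.subset_of_le hV)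
      (g.isSection_act hV (g.isSection_actInv hV ht)) ht fun z hz => ?_)
    rw [ext_extendFrom_self _ hz, g.act_congr (eventuallyEq_of_dom
      (fun w hw => ext_extendFrom_self _ hw) hz)]
    exact g.act_actInv hV (ht.smooth g.α) hz
  map_mul' s t := by
    refine Subtype.ext (IsSection.eq_of_ext_eq (g.subset_of_le hV) (g.isSection_act hV (s * t).2)
      (D.mem_extSections.mp (mul_mem (D.mem_extSections.mpr (g.isSection_act hV s.2))
        (D.mem_extSections.mpr (g.isSection_act hV t.2)))) fun z hz => ?_)
    rw [ext_extendFrom_self _ hz]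
    change g.act (S.ext (s.1 * t.1) g.α) z = S.ext (extendFrom g.α V (g.act (S.ext s.1 g.α)) *
      extendFrom g.α V (g.act (S.ext t.1 g.α))) g.α z
    rw [ext_mul _ _ hz, ext_extendFrom_self _ hz,
      ext_extendFrom_self _ hz, ← g.act_mul (s.2.differentiableAt hz) (t.2.differentiableAt hz)]
    exact g.act_congr (eventuallyEq_of_dom (fun w hw => ext_mul _ _ hw) hz)
  map_add' s t := by
    refine Subtype.ext (IsSection.eq_of_ext_eq (g.subset_of_le hV) (g.isSection_act hV (s + t).2)
      (D.mem_extSections.mp (add_mem (D.mem_extSections.mpr (g.isSection_act hV s.2))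
        (D.mem_extSections.mpr (g.isSection_act hV t.2)))) fun z hz => ?_)
    rw [ext_extendFrom_self _ hz]
    change g.act (S.ext (s.1 + t.1) g.α) z = S.ext (extendFrom g.α V (g.act (S.ext s.1 g.α)) +
      extendFrom g.α V (g.act (S.ext t.1 g.α))) g.α z
    rw [ext_add _ _ hz, ext_extendFrom_self _ hz,
      ext_extendFrom_self _ hz, g.act_congr (eventuallyEq_of_dom (fun w hw => ext_add _ _ hw) hz),
      act, VField.app_add _ (s.2.differentiableAt hz) (t.2.differentiableAt hz), act, act]
    abel
  commutes' r := by
    refine Subtype.ext (IsSection.eq_of_ext_eq (g.subset_of_le hV)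
      (g.isSection_act hV (algebraMap ℂ (kernelSections P.isComplexStructure V) r).2)
      (D.mem_extSections.mp (algebraMap ℂ (D.extSections V) r).2) fun z hz => ?_)
    rw [ext_extendFrom_self _ hz, g.act_congr (H := fun _ => algebraMap ℂ (Grass n) r)
      (eventuallyEq_of_dom (fun w hw => by rw [S.ext_apply _ hw]; rfl) hz), act, VField.app_const,
      add_zero, S.ext_apply _ hz]
    rfl

/-- The coefficients of ν have degrees two and three, so ν contributes nothing in degrees zero and
one. All gauge trivializations therefore induce the same identifications of `O/J` and `J/J²`. -/
theorem degPart_act {k : ℕ} (hk : k < 2) (G : ℂ → Grass n) (z : ℂ) :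
    degPart k (g.act G z) = degPart k (G z) := by
  have h1 : g.nu.cx z ∈ deg n 2 := mul_mem_deg (xi_mem_deg P.i) (g.m_mem z)
  have h2 : g.nu.cθ z ∈ deg n 3 := mul_mem_deg (xi_mem_deg P.i) (g.k_mem z)
  rw [act, map_add, VField.app, map_add, degPart_mul_left_of_lt h1 _ hk,
    degPart_mul_left_of_lt h2 _ (by omega), add_zero, add_zero]

theorem component_equiv {k : ℕ} (hk : k < 2) {V : Opens C} (hV : V ≤ g.N)
    (s : kernelSections P.isComplexStructure V) (β : S.ι) (z : S.dom β V) :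
    degPart k ((g.equiv V hV s).1 β z) = degPart k (s.1 β z) := by
  have ho := dom_subset_overlap (g.subset_of_le hV) z.2
  have h := s.2.compat β g.α z.1 z.2 ho
  rw [S.ext_apply _ z.2] at h
  change degPart k (S.pullback β g.α (g.act (S.ext s.1 g.α)) z) = degPart k (s.1 β z)
  rw [h, pullback, pullback, degPart_rescale, degPart_rescale, g.degPart_act hk]

theorem extendFrom_act_famRes {V V' : Opens C} (h : V' ≤ V) (hV : V ≤ g.N) {s : S.Fam n V}
    (hs : IsSection P.field s) :
    extendFrom g.α V' (g.act (S.ext (S.famRes h s) g.α)) =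
      S.famRes h (extendFrom g.α V (g.act (S.ext s g.α))) := by
  refine IsSection.eq_of_ext_eq (g.subset_of_le (h.trans hV))
    (g.isSection_act (h.trans hV) (hs.famRes h)) ((g.isSection_act hV hs).famRes h)
    fun z hz => ?_
  rw [ext_extendFrom_self _ hz, ext_famRes h _ hz, ext_extendFrom_self _ (S.dom_mono h hz)]
  exact g.act_congr (eventuallyEq_of_dom (fun w hw => ext_famRes h _ hw) hz)

theorem extendFrom_act_famParity {V : Opens C} (hV : V ≤ g.N) {s : S.Fam n V}
    (hs : IsSection P.field s) :
    extendFrom g.α V (g.act (S.ext (S.famParity V s) g.α)) =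
      S.famParity V (extendFrom g.α V (g.act (S.ext s g.α))) := by
  refine IsSection.eq_of_ext_eq (g.subset_of_le hV)
    (g.isSection_act hV (P.isComplexStructure.isSection_famParity hs))
    (D.isComplexStructure_base.isSection_famParity (g.isSection_act hV hs)) fun z hz => ?_
  rw [ext_extendFrom_self _ hz, ext_famParity _ hz, ext_extendFrom_self _ hz,
    ← g.act_parity (hs.differentiableAt hz)]
  exact g.act_congr (eventuallyEq_of_dom (fun w hw => ext_famParity _ hw) hz)

/-- The gauge transformation as a local isomorphism of sheaves. -/
def isoOver : (kernelPresheaf P.isComplexStructure).IsoOver D.splitModel g.N where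
  equiv V hV := g.equiv V hV
  equiv_res V _ h hV s := Subtype.ext (g.extendFrom_act_famRes h hV
    (show kernelSections P.isComplexStructure V from s).2)
  equiv_par V hV s := Subtype.ext (g.extendFrom_act_famParity hV
    (show kernelSections P.isComplexStructure V from s).2)

end Gauge

/-- The supermanifold defined by a perturbation. -/
def supermanifold : D.Supermanifold where
  O := kernelPresheaf P.isComplexStructure
  isSheaf := isSheaf_kernelPresheaf P.isComplexStructure
  nhd p := (P.exists_gauge p).choose.N
  mem_nhd p := (P.exists_gauge p).choose_spec
  triv p := (P.exists_gauge p).choose.isoOver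
  component_zero p q V hp hq s := by
    funext β z
    exact ((P.exists_gauge p).choose.component_equiv (by norm_num) hp s β z).trans
      ((P.exists_gauge q).choose.component_equiv (by norm_num) hq s β z).symm
  component_one p q V hp hq s _ := by
    funext β z
    exact ((P.exists_gauge p).choose.component_equiv (by norm_num) hp s β z).trans
      ((P.exists_gauge q).choose.component_equiv (by norm_num) hq s β z).symm

end Perturbation

end AnalyticDeformation

end Perturbations

/-! ### What a splitting implies for the perturbation -/

section Splittings

variable {C : Type u} [TopologicalSpace C] [ChartedSpace ℂ C]

namespace SpinAtlas

variable {S : SpinAtlas C} {n : ℕ}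

/-- Families of functions without odd coordinates. -/
def scalarFam (U : Opens C) : Subalgebra ℂ (S.Fam n U) where
  carrier := {s | ∀ α z, s α z ∈ (⊥ : Subalgebra ℂ (Grass n))}
  mul_mem' hs ht α z := mul_mem (hs α z) (ht α z)
  add_mem' hs ht α z := add_mem (hs α z) (ht α z)
  algebraMap_mem' r _ _ := Subalgebra.algebraMap_mem _ r

/-- Restriction of sections. -/
def restrict {Λ : S.ι → VField n} {hΛ : IsComplexStructure Λ} {U V : Opens C} (h : U ≤ V)
    (s : kernelSections hΛ V) : kernelSections hΛ U := ⟨S.famRes h s.1, s.2.famRes h⟩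

/-- The value of a section at a point of a coordinate chart. -/
def eval {Λ : S.ι → VField n} {hΛ : IsComplexStructure Λ} {U : Opens C} {α : S.ι} {z : ℂ}
    (hz : z ∈ S.dom α U) : kernelSections hΛ U →ₐ[ℂ] Grass n :=
  ((Pi.evalAlgHom ℂ (fun _ : S.dom α U => Grass n) ⟨z, hz⟩).comp
    (Pi.evalAlgHom ℂ (fun α : S.ι => S.dom α U → Grass n) α)).comp (kernelSections hΛ U).val

theorem eval_eq_ext {Λ : S.ι → VField n} {hΛ : IsComplexStructure Λ} {U : Opens C} {α : S.ι}
    {z : ℂ} (hz : z ∈ S.dom α U) (s : kernelSections hΛ U) : eval hz s = S.ext s.1 α z := by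
  rw [S.ext_apply _ hz]; rfl

theorem eval_restrict {Λ : S.ι → VField n} {hΛ : IsComplexStructure Λ} {U V : Opens C}
    (h : U ≤ V) {α : S.ι} {z : ℂ} (hz : z ∈ S.dom α U) (s : kernelSections hΛ V) :
    eval hz (restrict h s) = eval (S.dom_mono h hz) s := rfl

theorem eval_eq_rescale {Λ : S.ι → VField n} {hΛ : IsComplexStructure Λ} {U : Opens C}
    {α β : S.ι} {z : ℂ} (hz : z ∈ S.dom α U) (hz' : z ∈ S.overlap α β)
    (s : kernelSections hΛ U) :
    eval hz s = rescale (S.root α β z) (eval (S.trans_mem_dom hz hz') s) := by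
  rw [eval_eq_ext, eval_eq_ext, s.2.compat α β z hz hz']
  rfl

end SpinAtlas

namespace AnalyticDeformation

open SpinAtlas

variable {S : SpinAtlas C} {n : ℕ} {D : AnalyticDeformation S n}

namespace Perturbation

variable (P : D.Perturbation)

/-- The algebra of sections over `U` of the perturbed structure. -/
abbrev sections (U : Opens C) : Subalgebra ℂ (S.Fam n U) := kernelSections P.isComplexStructure U

/-- An isomorphism of the perturbed structure sheaf with the split model, up to a map of open
sets. -/
structure Splitting where
  T : Opens C → Opens C
  mono : ∀ {U V : Opens C}, U ≤ V → T U ≤ T V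
  e : ∀ U : Opens C, P.sections U ≃ₐ[ℂ] D.extSections (T U)
  res : ∀ {U V : Opens C} (h : U ≤ V) (s : P.sections V),
    (e U (restrict h s)).1 = S.famRes (mono h) (e V s).1
  par : ∀ (U : Opens C) (s : P.sections U),
    (e U ⟨S.famParity U s.1, P.isComplexStructure.isSection_famParity s.2⟩).1 =
      S.famParity (T U) (e U s).1

/-- The homeomorphism of C is retained only as a monotone map of open sets. The argument never
compares points on the two sides, so an isomorphism covering a nontrivial homeomorphism needs no
separate treatment. -/
theorem exists_splitting (h : P.supermanifold.IsSplit) : Nonempty P.Splitting := by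
  have h' : (kernelPresheaf P.isComplexStructure).Isomorphic D.splitModel := h
  obtain ⟨σ, e, hres, hpar⟩ := h'
  let e' : ∀ U : Opens C, P.sections U ≃ₐ[ℂ] D.extSections (Opens.comap (σ : C(C, C)) U) := e
  have hmono : ∀ {U V : Opens C}, U ≤ V →
      Opens.comap (σ : C(C, C)) U ≤ Opens.comap (σ : C(C, C)) V :=
    fun h => OrderHomClass.mono (Opens.comap (σ : C(C, C))) h
  have hres' : ∀ {U V : Opens C} (h : U ≤ V) (s : P.sections V),
      (e' U (restrict h s)).1 = S.famRes (hmono h) (e' V s).1 := by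
    intro U V h s
    have h1 := hres U V h s
    exact congrArg (fun t : D.extSections (Opens.comap (σ : C(C, C)) U) => t.1) h1
  have hpar' : ∀ (U : Opens C) (s : P.sections U),
      (e' U ⟨S.famParity U s.1, P.isComplexStructure.isSection_famParity s.2⟩).1 =
        S.famParity (Opens.comap (σ : C(C, C)) U) (e' U s).1 := by
    intro U s
    have h1 := hpar U s
    exact congrArg (fun t : D.extSections (Opens.comap (σ : C(C, C)) U) => t.1) h1
  exact ⟨⟨fun U => Opens.comap (σ : C(C, C)) U, hmono, e', hres', hpar'⟩⟩

namespace Splitting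

variable {P} (Φ : P.Splitting)

/-- The sections which correspond to holomorphic functions in the split model. -/
def scalars (U : Opens C) : Subalgebra ℂ (P.sections U) :=
  (scalarFam (Φ.T U)).comap ((D.extSections (Φ.T U)).val.comp (Φ.e U).toAlgHom)

theorem mem_scalars {U : Opens C} {t : P.sections U} :
    t ∈ Φ.scalars U ↔ (Φ.e U t).1 ∈ scalarFam (S := S) (n := n) (Φ.T U) := Iff.rfl

theorem restrict_mem_scalars {U V : Opens C} (h : U ≤ V) {t : P.sections V}
    (ht : t ∈ Φ.scalars V) : restrict h t ∈ Φ.scalars U := by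
  rw [mem_scalars, Φ.res h]
  exact fun α z => ht α _

theorem pow_eq_zero {U : Opens C} {t : P.sections U}
    (h : ∀ α z, ∀ hz : z ∈ S.dom α U, body (eval hz t) = 0) : t ^ (n + 2) = 0 := by
  refine Subtype.ext ?_
  funext α z
  exact pow_eq_zero_of_body (h α z.1 z.2)

/-- A section with zero body is nilpotent, hence so is its image under the splitting. That image
takes values in ℂ, which is reduced. -/
theorem eq_zero_of_body {U : Opens C} {t : P.sections U} (ht : t ∈ Φ.scalars U)
    (h : ∀ α z, ∀ hz : z ∈ S.dom α U, body (eval hz t) = 0) : t = 0 := by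
  have h1 : (Φ.e U t) ^ (n + 2) = 0 := by rw [← map_pow, pow_eq_zero h, map_zero]
  have h2 : Φ.e U t = 0 := by
    refine Subtype.ext ?_
    funext α z
    have h3 : ((Φ.e U t).1 α z) ^ (n + 2) = 0 :=
      congrFun (congrFun (congrArg Subtype.val h1) α) z
    obtain ⟨r, hr⟩ := Algebra.mem_bot.mp (ht α z)
    have hr' : algebraMap ℂ (Grass n) r = (Φ.e U t).1 α z := hr
    have h4 := congrArg body h3
    rw [← hr', ← map_pow, body_algebraMap, map_zero] at h4
    change (Φ.e U t).1 α z = 0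
    rw [← hr', eq_zero_of_pow_eq_zero h4, map_zero]
  exact (map_eq_zero_iff (Φ.e U) (Φ.e U).injective).mp h2

theorem isSection_degPart_zero {U : Opens C} {s : S.Fam n U} (hs : IsSection D.base s) :
    IsSection D.base (fun α z => degPart 0 (s α z) : S.Fam n U) :=
  .of_eq (fun α z => degPart 0 (S.ext s α z))
    (fun α z hz => by rw [S.ext_apply _ hz, S.ext_apply _ hz])
    (fun α => contDiffOn_linear (degPart 0) (hs.smooth α))
    (fun α β z hz hz' => by
      rw [hs.compat α β z hz hz']; simp only [pullback, degPart_rescale])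
    fun α z hz => by
      rw [D.base_dbar_degPart α 0 (hs.differentiableAt hz), hs.dbar_eq α z hz, map_zero]

/-- The image of F differs from its degree-zero component by a nilpotent. Pulled back to the
perturbed sheaf, the difference stays nilpotent and so has zero body. -/
theorem exists_scalar {U : Opens C} (F : P.sections U) :
    ∃ t ∈ Φ.scalars U, ∀ α z, ∀ hz : z ∈ S.dom α U, body (eval hz t) = body (eval hz F) := by
  let E : D.extSections (Φ.T U) := ⟨fun α z => degPart 0 ((Φ.e U F).1 α z),
    D.mem_extSections.mpr (isSection_degPart_zero (D.mem_extSections.mp (Φ.e U F).2))⟩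
  refine ⟨(Φ.e U).symm E, ?_, ?_⟩
  · rw [mem_scalars, AlgEquiv.apply_symm_apply]
    intro α z
    change degPart 0 ((Φ.e U F).1 α z) ∈ _
    rw [degPart_zero_eq]
    exact Subalgebra.algebraMap_mem _ _
  · have h1 : (Φ.e U F - E) ^ (n + 2) = 0 := by
      refine Subtype.ext ?_
      funext α z
      refine pow_eq_zero_of_body ?_
      change body ((Φ.e U F).1 α z - degPart 0 ((Φ.e U F).1 α z)) = 0
      rw [map_sub, degPart_zero_eq, body_algebraMap, sub_self]
    have h2 : (F - (Φ.e U).symm E) ^ (n + 2) = 0 := by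
      apply (Φ.e U).injective
      rw [map_pow, map_sub, AlgEquiv.apply_symm_apply, h1, map_zero]
    intro α z hz
    have h3 := congrArg body (congrArg (eval hz) h2)
    rw [map_pow, map_pow, map_sub, map_sub, map_zero, map_zero] at h3
    exact (sub_eq_zero.mp (eq_zero_of_pow_eq_zero h3)).symm

theorem parity_eval {U : Opens C} {t : P.sections U} (ht : t ∈ Φ.scalars U) {α : S.ι} {z : ℂ}
    (hz : z ∈ S.dom α U) : parity (eval hz t) = eval hz t := by
  have h1 : Φ.e U ⟨S.famParity U t.1, P.isComplexStructure.isSection_famParity t.2⟩ =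
      Φ.e U t := by
    refine Subtype.ext ?_
    rw [Φ.par U]
    funext α z
    change parity ((Φ.e U t).1 α z) = (Φ.e U t).1 α z
    obtain ⟨r, hr⟩ := Algebra.mem_bot.mp (ht α z)
    have hr' : algebraMap ℂ (Grass n) r = (Φ.e U t).1 α z := hr
    rw [← hr', AlgHom.commutes]
  have h2 := congrArg (eval hz) ((Φ.e U).injective h1)
  exact h2

/-- A scalar section over `N` which lifts the holomorphic function `h` of the coordinate `x_α`. -/
structure IsLift (α : S.ι) (N : Opens C) (h : ℂ → ℂ) (t : P.sections N) : Prop where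
  subset : (N : Set C) ⊆ (S.chart α).source
  mem : t ∈ Φ.scalars N
  body_eq : ∀ z, ∀ hz : z ∈ S.dom α N, body (eval hz t) = h z

theorem IsLift.restrict {α : S.ι} {N N' : Opens C} {h : ℂ → ℂ} {t : P.sections N}
    (ht : Φ.IsLift α N h t) (hN : N' ≤ N) : Φ.IsLift α N' h (restrict hN t) :=
  ⟨fun _ hx => ht.subset (hN hx), Φ.restrict_mem_scalars hN ht.mem,
    fun z hz => ht.body_eq z (S.dom_mono hN hz)⟩

theorem eq_zero_of_isLift {α : S.ι} {N : Opens C} {t : P.sections N}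
    (ht : Φ.IsLift α N (fun _ => 0) t) : t = 0 := by
  refine Φ.eq_zero_of_body ht.mem fun β z hz => ?_
  rw [eval_eq_rescale hz (dom_subset_overlap ht.subset hz), body_rescale]
  exact ht.body_eq _ _

/-- On the intersection the difference of the two lifts is a scalar section with zero body, hence
zero. Local choices of lifts therefore define one function on the whole chart. -/
theorem IsLift.eval_eq {α : S.ι} {N N' : Opens C} {h : ℂ → ℂ} {t : P.sections N}
    {t' : P.sections N'} (ht : Φ.IsLift α N h t) (ht' : Φ.IsLift α N' h t') {z : ℂ}
    (hz : z ∈ S.dom α N) (hz' : z ∈ S.dom α N') : eval hz t = eval hz' t' := by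
  have hl : N ⊓ N' ≤ N := inf_le_left
  have hr : N ⊓ N' ≤ N' := inf_le_right
  have h1 := ht.restrict Φ hl
  have h2 := ht'.restrict Φ hr
  have h0 : SpinAtlas.restrict hl t - SpinAtlas.restrict hr t' = 0 :=
    Φ.eq_zero_of_isLift ⟨h1.subset, sub_mem h1.mem h2.mem, fun z hz => by
      rw [map_sub, map_sub, h1.body_eq, h2.body_eq, sub_self]⟩
  have hz0 : z ∈ S.dom α (N ⊓ N') := ⟨hz.1, hz.2, hz'.2⟩
  have h3 := congrArg (eval hz0) h0
  rw [map_sub, map_zero, sub_eq_zero] at h3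
  exact h3

/-- The function h is a degree-zero section of the split model. A local gauge transformation carries
it to the perturbed sheaf without changing its body, and `exists_scalar` replaces the result by a
scalar section with the same body. -/
theorem exists_lift {α : S.ι} {V : Set ℂ} (hV : IsOpen V) {h : ℂ → ℂ}
    (hh : DifferentiableOn ℂ h V) {z : ℂ} (hz : z ∈ (S.chart α).target) (hzV : z ∈ V) :
    ∃ (N : Opens C) (t : P.sections N), Φ.IsLift α N h t ∧ z ∈ S.dom α N := by
  obtain ⟨g, hg⟩ := P.exists_gauge ((S.chart α).symm z)
  let N₀ : Opens C := ⟨(S.chart α).source ∩ S.chart α ⁻¹' V, (S.chart α).isOpen_inter_preimage hV⟩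
  let N : Opens C := g.N ⊓ N₀
  have hN : N ≤ g.N := inf_le_left
  have hNs : (N : Set C) ⊆ (S.chart α).source := fun x hx => hx.2.1
  have hdom : ∀ w ∈ S.dom α N, w ∈ V := by
    intro w hw
    have h : S.chart α ((S.chart α).symm w) ∈ V := hw.2.2.2
    rwa [(S.chart α).right_inv hw.1] at h
  have hhat : ∀ w ∈ V, DifferentiableAt ℂ h w := fun w hw =>
    hh.differentiableAt (hV.mem_nhds hw)
  have hH : ContDiffOn ℝ ∞ (fun w => algebraMap ℂ (Grass n) (h w)) (S.dom α N) :=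
    ((Algebra.linearMap ℂ (Grass n)).toContinuousLinearMap.restrictScalars
      ℝ).contDiff.comp_contDiffOn
      (((hh.contDiffOn hV).restrict_scalars ℝ).mono hdom)
  have hsec : IsSection D.base (extendFrom α N fun w => algebraMap ℂ (Grass n) (h w)) := by
    refine isSection_extendFrom D.isComplexStructure_base hNs hH fun w hw => ?_
    rw [base_dbar, dxbar_algebraMap (hhat w (hdom w hw)), dOdd_algebraMap, mul_zero, sub_zero]
  let E : D.extSections N := ⟨_, D.mem_extSections.mpr hsec⟩
  obtain ⟨t, ht, hb⟩ := Φ.exists_scalar ((g.equiv N hN).symm E)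
  refine ⟨N, t, ⟨hNs, ht, fun w hw => ?_⟩, hz, hg, (S.chart α).map_target hz, ?_⟩
  · have h1 := g.component_equiv (k := 0) (by norm_num) hN ((g.equiv N hN).symm E) α ⟨w, hw⟩
    rw [AlgEquiv.apply_symm_apply] at h1
    have h2 : E.1 α ⟨w, hw⟩ = algebraMap ℂ (Grass n) (h w) :=
      (S.ext_apply E.1 hw).symm.trans 
        (ext_extendFrom_self (fun w => algebraMap ℂ (Grass n) (h w)) hw)
    rw [h2, degPart_zero_eq, degPart_zero_eq, body_algebraMap] at h1
    have h3 := congrArg body h1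
    rw [body_algebraMap, body_algebraMap] at h3
    rw [hb α w hw, h3]
    rfl
  · rw [Set.mem_preimage, (S.chart α).right_inv hz]
    exact hzV

theorem exists_coordinate_lift {α : S.ι} {z : ℂ} (hz : z ∈ (S.chart α).target) :
    ∃ (N : Opens C) (t : P.sections N), Φ.IsLift α N (fun w => w) t ∧ z ∈ S.dom α N :=
  Φ.exists_lift isOpen_univ differentiableOn_id hz (Set.mem_univ z)

open Classical in
/-- The component of degree two of the lift of the coordinate `x_α`. -/
def primitive (α : S.ι) (z : ℂ) : Grass n :=
  if hz : z ∈ (S.chart α).target then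
    degPart 2 (S.ext (Φ.exists_coordinate_lift hz).choose_spec.choose.1 α z)
  else 0

theorem primitive_eq {α : S.ι} {N : Opens C} {t : P.sections N}
    (ht : Φ.IsLift α N (fun w => w) t) {z : ℂ} (hz : z ∈ S.dom α N) :
    Φ.primitive α z = degPart 2 (S.ext t.1 α z) := by
  have h := (Φ.exists_coordinate_lift hz.1).choose_spec.choose_spec
  rw [primitive, dif_pos hz.1, ← eval_eq_ext h.2, ← eval_eq_ext hz, h.1.eval_eq Φ ht h.2 hz]

theorem primitive_mem (α : S.ι) (z : ℂ) : Φ.primitive α z ∈ deg n 2 := by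
  rw [primitive]
  split
  · exact degPart_mem 2 _
  · exact zero_mem _

theorem contDiffOn_primitive (α : S.ι) : ContDiffOn ℝ ∞ (Φ.primitive α) (S.chart α).target := by
  intro z hz
  obtain ⟨N, t, ht, hzN⟩ := Φ.exists_coordinate_lift hz
  have h1 := contDiffOn_linear (degPart 2) (t.2.smooth α)
  exact ((h1.contDiffAt ((S.isOpen_dom α N).mem_nhds hzN)).congr_of_eventuallyEq
    (eventuallyEq_of_dom (fun w hw => Φ.primitive_eq ht hw) hzN)).contDiffWithinAt

/-- Take the degree-two part of ∂̄_E t = δt for a lift t of x. The term ξ_i κ ∂t/∂θ starts in degree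
three, and ξ_i ρ ∂t/∂x contributes ξ_i ρ times the body of ∂t/∂x, which is 1. -/
theorem dbar_primitive {α : S.ι} {z : ℂ} (hz : z ∈ (S.chart α).target) :
    (D.base α).dbar (Φ.primitive α) z = xi P.i * P.ρ α z := by
  obtain ⟨N, t, ht, hzN⟩ := Φ.exists_coordinate_lift hz
  have hd := t.2.differentiableAt hzN
  have h1 := t.2.dbar_eq α z hzN
  rw [field_dbar, sub_eq_zero] at h1
  rw [(D.base α).dbar_congr (eventuallyEq_of_dom (fun w hw => Φ.primitive_eq ht hw) hzN),
    D.base_dbar_degPart α 2 hd, h1, VField.app, map_add]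
  have h2 : xi P.i * P.ρ α z ∈ deg n 2 := mul_mem_deg (xi_mem_deg P.i) (P.ρ_mem α z hz)
  have h3 : xi P.i * P.κ α z ∈ deg n 3 := mul_mem_deg (xi_mem_deg P.i) (P.κ_mem α z hz)
  have h4 : body (dx (S.ext t.1 α) z) = 1 := by
    have e1 := dx_clm (body (n := n)).toLinearMap.toContinuousLinearMap hd
    have e2 : dx (fun w => body (S.ext t.1 α w)) z = dx (fun w : ℂ => w) z :=
      dx_congr (by
        filter_upwards [(S.isOpen_dom α N).mem_nhds hzN] with w hw
        rw [← eval_eq_ext hw, ht.body_eq])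
    have e3 : dx (fun w => body (S.ext t.1 α w)) z = body (dx (S.ext t.1 α) z) := e1
    rw [← e3, e2, dx_of_differentiableAt differentiableAt_fun_id]
    simp
  have h5 := degPart_mul_left (l := 0) h2 (dx (S.ext t.1 α) z)
  rw [degPart_zero_eq, h4, map_one, mul_one] at h5
  exact (congrArg₂ (· + ·) h5 (degPart_mul_left_of_lt h3 _ (by norm_num))).trans (add_zero _)

/-- Scalar sections form an algebra and are determined by their bodies, so the Taylor formula f(x) =
f(z) + f'(z)(x - z) + (x - z)² g(x) also holds between the lifts of x_β, x_α and g. At z the lift of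
x_α - z is even with zero body, so it starts in degree two and its square in degree four. In degree
two only the linear term remains: the transformation law of a tangent vector. -/
theorem primitive_glues {α β : S.ι} {z : ℂ} (hz : z ∈ S.overlap α β) :
    deriv (S.trans α β) z • Φ.primitive α z = S.pullback α β (Φ.primitive β) z := by
  have hzα := (S.mem_overlap.mp hz).1
  have hO := S.isOpen_overlap α β
  let f := S.trans α β
  -- The remainder g is the iterated divided difference of f at z; it is holomorphic also at z by
  -- removal of singularities.
  have hf1 : DifferentiableOn ℂ (dslope f z) (S.overlap α β) :=
    (Complex.differentiableOn_dslope (hO.mem_nhds hz)).mpr (S.differentiableOn_trans α β)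
  have hf2 : DifferentiableOn ℂ (dslope (dslope f z) z) (S.overlap α β) :=
    (Complex.differentiableOn_dslope (hO.mem_nhds hz)).mpr hf1
  obtain ⟨N₁, t₁, ht₁, hz₁⟩ := Φ.exists_coordinate_lift hzα
  obtain ⟨N₂, t₂, ht₂, hz₂⟩ := Φ.exists_coordinate_lift (S.trans_mem_target hz)
  obtain ⟨N₃, t₃, ht₃, hz₃⟩ := Φ.exists_lift hO hf2 hzα hz
  let M : Opens C := N₁ ⊓ N₂ ⊓ N₃
  have hM₁ : M ≤ N₁ := inf_le_left.trans inf_le_left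
  have hM₂ : M ≤ N₂ := inf_le_left.trans inf_le_right
  have hM₃ : M ≤ N₃ := inf_le_right
  have hsz : (S.chart α).symm z ∈ N₂ := by
    have := hz₂.2
    rwa [Set.mem_preimage, S.symm_trans_apply hz] at this
  have hzM : z ∈ S.dom α M := ⟨hzα, ⟨hz₁.2, hsz⟩, hz₃.2⟩
  have r₁ := ht₁.restrict Φ hM₁
  have r₂ := ht₂.restrict Φ hM₂
  have r₃ := ht₃.restrict Φ hM₃
  let c : P.sections M := algebraMap ℂ _ z
  let y : P.sections M := restrict hM₁ t₁ - c
  have hy : y ∈ Φ.scalars M := sub_mem r₁.mem (Subalgebra.algebraMap_mem _ z)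
  let q : P.sections M := restrict hM₂ t₂ - algebraMap ℂ _ (f z) - deriv f z • y -
    y * y * restrict hM₃ t₃
  have hy_eval : ∀ w, ∀ hw : w ∈ S.dom α M,
      eval hw y = eval (S.dom_mono hM₁ hw) t₁ - algebraMap ℂ _ z := by
    intro w hw
    rw [map_sub, AlgHom.commutes, eval_restrict]
  have hq_eval : ∀ w, ∀ hw : w ∈ S.dom α M, eval hw q =
      eval (S.dom_mono hM₂ hw) t₂ - algebraMap ℂ _ (f z) - deriv f z • eval hw y -
        eval hw y * eval hw y * eval (S.dom_mono hM₃ hw) t₃ := by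
    intro w hw
    rw [map_sub, map_sub, map_sub, map_smul, map_mul, map_mul, AlgHom.commutes, eval_restrict,
      eval_restrict]
  have hover : ∀ w ∈ S.dom α M, w ∈ S.overlap α β := fun w hw =>
    dom_subset_overlap r₂.subset hw
  have hq : q = 0 := by
    refine Φ.eq_zero_of_isLift (α := α) ⟨r₁.subset, ?_, fun w hw => ?_⟩
    · exact sub_mem (sub_mem (sub_mem r₂.mem (Subalgebra.algebraMap_mem _ _))
        (Subalgebra.smul_mem _ hy _)) (mul_mem (mul_mem hy hy) r₃.mem)
    · have e1 : body (eval (S.dom_mono hM₂ hw) t₂) = f w := by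
        rw [eval_eq_rescale _ (hover w hw), body_rescale, ht₂.body_eq]
      have e2 : body (eval hw y) = w - z := by
        rw [hy_eval, map_sub, ht₁.body_eq, body_algebraMap]
      rw [hq_eval, map_sub, map_sub, map_sub, map_smul, map_mul, map_mul, e1, e2, ht₃.body_eq,
        body_algebraMap]
      have s1 := sub_smul_dslope f z w
      have s2 := sub_smul_dslope (dslope f z) z w
      rw [dslope_same] at s2
      simp only [smul_eq_mul] at s1 s2 ⊢
      linear_combination (-1) * s1 - (w - z) * s2
  have h0 := hq_eval z hzM
  rw [hq, map_zero] at h0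
  have h1 := congrArg (degPart 2) h0
  -- Degree one is excluded by parity: splittings commute with parity, so scalar sections are even.
  have hy0 : ∀ m < 2, degPart m (eval hzM y) = 0 := by
    intro m hm
    interval_cases m
    · rw [degPart_zero_eq, hy_eval, map_sub, ht₁.body_eq, body_algebraMap, sub_self, map_zero]
    · exact degPart_eq_zero_of_even odd_one (Φ.parity_eval hy hzM)
  have hyy : degPart 2 (eval hzM y * eval hzM y * eval (S.dom_mono hM₃ hzM) t₃) = 0 :=
    degPart_mul_of_lt (k := 4) (l := 0) (degPart_mul_of_lt hy0 hy0) (fun m hm => by omega) 2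
      (by norm_num)
  have hc : ∀ r : ℂ, degPart 2 (algebraMap ℂ (Grass n) r) = 0 := fun r =>
    degPart_of_mem_ne (algebraMap_mem_deg r) (by norm_num)
  have hy2 : degPart 2 (eval hzM y) = Φ.primitive α z := by
    rw [hy_eval, map_sub, hc, sub_zero, Φ.primitive_eq ht₁ (S.dom_mono hM₁ hzM), eval_eq_ext]
  have ht2 : degPart 2 (eval (S.dom_mono hM₂ hzM) t₂) = S.pullback α β (Φ.primitive β) z := by
    rw [eval_eq_rescale _ hz, degPart_rescale, eval_eq_ext, pullback, Φ.primitive_eq ht₂ hz₂]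
  rw [map_zero, map_sub, map_sub, map_sub, map_smul, hyy, hc, hy2, ht2, sub_zero, sub_zero,
    eq_comm, sub_eq_zero] at h1
  exact h1.symm

end Splitting

/-- If the supermanifold of a perturbation splits, then the perturbation is exact. -/
theorem exists_primitive (h : P.supermanifold.IsSplit) : ∃ w : S.ι → ℂ → Grass n,
    (∀ α, ContDiffOn ℝ ∞ (w α) (S.chart α).target) ∧ (∀ α z, w α z ∈ deg n 2) ∧
    (∀ α, ∀ z ∈ (S.chart α).target, (D.base α).dbar (w α) z = xi P.i * P.ρ α z) ∧
    ∀ α β, ∀ z ∈ S.overlap α β, deriv (S.trans α β) z • w α z = S.pullback α β (w β) z := by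
  obtain ⟨Φ⟩ := P.exists_splitting h
  exact ⟨Φ.primitive, Φ.contDiffOn_primitive, Φ.primitive_mem, fun _ _ hz => Φ.dbar_primitive hz,
    fun _ _ _ hz => Φ.primitive_glues hz⟩

end Perturbation

end AnalyticDeformation

end Splittings

/-! ### The filtration by powers of (ξ) and Euler's identity -/

section Filtration
variable {n : ℕ}

/-- The `k`-th power of the ideal `(ξ₁, …, ξₙ)`. -/
def xiPow (n : ℕ) : ℕ → Submodule ℂ (Grass n)
  | 0 => ⊤
  | k + 1 => Submodule.span ℂ {x | ∃ i, ∃ y ∈ xiPow n k, x = xi i * y}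

theorem xi_mul_mem_xiPow {k : ℕ} (i : Fin n) {y : Grass n} (hy : y ∈ xiPow n k) :
    xi i * y ∈ xiPow n (k + 1) :=
  Submodule.subset_span ⟨i, y, hy, rfl⟩

theorem xiPow_succ_induction {k : ℕ} {P : Submodule ℂ (Grass n)}
    (h : ∀ i, ∀ y ∈ xiPow n k, xi i * y ∈ P) {x : Grass n} (hx : x ∈ xiPow n (k + 1)) : x ∈ P := by
  have h' : xiPow n (k + 1) ≤ P := by
    refine Submodule.span_le.mpr ?_
    rintro _ ⟨i, y, hy, rfl⟩
    exact h i y hy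
  exact h' hx

theorem mul_mem_xiPow_right {k : ℕ} (x : Grass n) {y : Grass n} (hy : y ∈ xiPow n k) :
    x * y ∈ xiPow n k := by
  induction k generalizing x y with
  | zero => trivial
  | succ k ih =>
    refine xiPow_succ_induction (P := (xiPow n (k + 1)).comap (LinearMap.mulLeft ℂ x)) ?_ hy
    intro i y hy
    change x * (xi i * y) ∈ xiPow n (k + 1)
    rw [← mul_assoc, mul_xi, mul_assoc]
    exact xi_mul_mem_xiPow i (ih _ hy)

theorem mul_mem_xiPow {k l : ℕ} {x y : Grass n} (hx : x ∈ xiPow n k) (hy : y ∈ xiPow n l) :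
    x * y ∈ xiPow n (k + l) := by
  induction k generalizing x with
  | zero =>
    rw [Nat.zero_add]
    exact mul_mem_xiPow_right x hy
  | succ k ih =>
    refine xiPow_succ_induction (P := (xiPow n (k + 1 + l)).comap (LinearMap.mulRight ℂ y)) ?_ hx
    intro i x hx
    change xi i * x * y ∈ xiPow n (k + 1 + l)
    rw [mul_assoc, Nat.add_right_comm]
    exact xi_mul_mem_xiPow i (ih hx)

theorem xiPow_succ_le (k : ℕ) : xiPow n (k + 1) ≤ xiPow n k := fun _ hx =>
  xiPow_succ_induction (fun i _ hy => mul_mem_xiPow_right (xi i) hy) hx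

theorem xiPow_antitone : Antitone (xiPow n) := antitone_nat_of_succ_le xiPow_succ_le

theorem dOdd_zero_mem_xiPow {k : ℕ} {x : Grass n} (hx : x ∈ xiPow n k) :
    dOdd 0 x ∈ xiPow n k := by
  induction k generalizing x with
  | zero => trivial
  | succ k ih =>
    refine xiPow_succ_induction (P := (xiPow n (k + 1)).comap (dOdd 0)) ?_ hx
    intro i y hy
    change dOdd 0 (xi i * y) ∈ xiPow n (k + 1)
    rw [dOdd_zero_xi_mul]
    exact neg_mem (xi_mul_mem_xiPow i (ih hy))

/-- `xiPow` has the ξ_i as left factors, while the left ideal `xiIdeal` has its generators on the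
right; supercommutativity moves them across. -/
theorem xiPow_one_subset {x : Grass n} (hx : x ∈ xiPow n 1) : x ∈ xiIdeal n := by
  refine xiPow_succ_induction (k := 0) (P := (xiIdeal n).restrictScalars ℂ) ?_ hx
  intro i y _
  change xi i * y ∈ xiIdeal n
  have h := mul_xi i (parity y)
  rw [parity_parity] at h
  rw [← h]
  exact Ideal.mul_mem_left _ _ (Ideal.subset_span ⟨i, rfl⟩)

theorem xiPow_three_subset {x : Grass n} (hx : x ∈ xiPow n 3) : x ∈ xiIdealCubed n := by
  let P : Submodule ℂ (Grass n) := (xiIdealCubed n).restrictScalars ℂ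
  have h : ∀ i j k : Fin n, ∀ y : Grass n, xi i * (xi j * (xi k * y)) ∈ P := by
    intro i j k y
    have h1 : parity (xi i * xi j * xi k) = -(xi i * xi j * xi k) := by
      simp only [map_mul, parity_xi]
      noncomm_ring
    have h2 := mul_eq_of_odd h1 (parity y)
    rw [parity_parity] at h2
    rw [← mul_assoc, ← mul_assoc, ← h2]
    exact Ideal.mul_mem_left _ _ (Ideal.subset_span ⟨i, j, k, rfl⟩)
  refine xiPow_succ_induction (P := P) (fun i y hy => ?_) hx
  refine xiPow_succ_induction (P := P.comap (LinearMap.mulLeft ℂ (xi i))) (fun j y hy => ?_) hy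
  refine xiPow_succ_induction (P := P.comap
    ((LinearMap.mulLeft ℂ (xi i)).comp (LinearMap.mulLeft ℂ (xi j)))) (fun k y hy => ?_) hy
  exact h i j k y

/-- At θ = 0 every degree-one element is a combination of the ξ_i, so degree k becomes order k in ξ.
-/
theorem rescale_zero_mem_xiPow {k : ℕ} {x : Grass n} (hx : x ∈ deg n k) :
    rescale 0 x ∈ xiPow n k := by
  induction k generalizing x with
  | zero => trivial
  | succ k ih =>
    refine deg_succ_induction (p := fun x => rescale 0 x ∈ xiPow n (k + 1)) ?_ ?_ hx
    · intro x y hx hy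
      rw [map_add]
      exact add_mem hx hy
    · intro v x hx
      rw [map_mul, ι_eq_sum, map_add, map_smul, rescale_theta, zero_smul, smul_zero, zero_add,
        map_sum, Finset.sum_mul]
      refine sum_mem fun i _ => ?_
      rw [map_smul, rescale_xi, smul_mul_assoc]
      exact Submodule.smul_mem _ _ (xi_mul_mem_xiPow i (ih hx))

theorem mem_xiPow_of_mem_deg {k : ℕ} {x : Grass n} (hx : x ∈ deg n k) (h : dOdd 0 x = 0) :
    x ∈ xiPow n k := by
  rw [← rescale_eq_self h 0]
  exact rescale_zero_mem_xiPow hx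

theorem rescale_zero_mem_xiPow_of_degPart {k : ℕ} {x : Grass n} (h : ∀ m < k, degPart m x = 0) :
    rescale 0 x ∈ xiPow n k := by
  rw [eq_sum_degPart x, map_sum]
  refine sum_mem fun m _ => ?_
  by_cases hm : m < k
  · rw [h m hm, map_zero]
    exact zero_mem _
  · exact xiPow_antitone (not_lt.mp hm) (rescale_zero_mem_xiPow (degPart_mem m x))

/-- Euler's identity. It recovers a form without θ from the terms ξ_i ∂/∂ξ_i of that form, which is
why perturbations divisible by a single ξ_i suffice. -/
theorem theta_mul_dOdd_add_sum {k : ℕ} {x : Grass n} (hx : x ∈ deg n k) :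
    theta * dOdd 0 x + ∑ i : Fin n, xi i * dOdd i.succ x = (k : ℂ) • x := by
  induction k generalizing x with
  | zero =>
    obtain ⟨r, rfl⟩ := exists_of_mem_deg_zero hx
    simp [dOdd_algebraMap]
  | succ k ih =>
    refine deg_succ_induction (p := fun x => theta * dOdd 0 x +
      ∑ i : Fin n, xi i * dOdd i.succ x = ((k + 1 : ℕ) : ℂ) • x) ?_ ?_ hx
    · intro x y hx hy
      rw [smul_add, ← hx, ← hy]
      simp only [map_add, mul_add, Finset.sum_add_distrib]
      abel
    · intro v x hx
      have hv : ∀ y : Grass n, parity y = -y → ∀ j : Fin (n + 1),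
          y * dOdd j ((ExteriorAlgebra.ι ℂ v : Grass n) * x) =
            (v j • y) * x + (ExteriorAlgebra.ι ℂ v : Grass n) * (y * dOdd j x) := by
        intro y hy j
        have h2 := mul_eq_of_odd hy (ExteriorAlgebra.ι ℂ v : Grass n)
        rw [parity_ι] at h2
        rw [dOdd_mul, dOdd_ι, parity_ι, mul_add, ← mul_assoc (ExteriorAlgebra.ι ℂ v : Grass n), h2,
          ← Algebra.smul_def]
        simp only [mul_smul_comm, smul_mul_assoc, mul_neg, neg_mul, mul_assoc]
      rw [hv theta parity_theta]
      simp only [hv _ (parity_xi _)]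
      rw [Finset.sum_add_distrib, ← Finset.mul_sum, ← Finset.sum_mul, add_add_add_comm, ← add_mul,
        ← mul_add, ih hx, ← ι_eq_sum, mul_smul_comm, Nat.cast_succ, add_smul, one_smul, add_comm]

end Filtration

/-! ### Superconformal vector fields -/

section Superconformal
variable {n : ℕ}

/-- The superconformal vector field `(u + θη) ∂/∂x + (η + θu'/2) ∂/∂θ`. -/
def superconformalField (u η : ℂ → Grass n) : VField n :=
  ⟨fun z => u z + theta * η z, fun z => η z + (1 / 2 : ℂ) • (theta * dx u z)⟩

variable {V : Set ℂ}

theorem dOdd_zero_dx (hV : IsOpen V) {G : ℂ → Grass n} (hG : ContDiffOn ℝ ∞ G V) {z : ℂ}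
    (hz : z ∈ V) :
    dx (fun w => dOdd 0 (G w)) z = dOdd 0 (dx G z) :=
  dx_linear (dOdd 0) (differentiableAt_of_isOpen hV hG hz)

theorem dOdd_zero_dx_eq_zero (hV : IsOpen V) {G : ℂ → Grass n} (hG : ContDiffOn ℝ ∞ G V)
    (h : ∀ z ∈ V, dOdd 0 (G z) = 0) {z : ℂ} (hz : z ∈ V) : dOdd 0 (dx G z) = 0 :=
  LinearMap.mem_ker.mp (dx_mem (P := LinearMap.ker (dOdd 0))
    (differentiableAt_of_isOpen hV hG hz) (by
      filter_upwards [hV.mem_nhds hz] with w hw using h w hw))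

theorem parity_dx (hV : IsOpen V) {G : ℂ → Grass n} (hG : ContDiffOn ℝ ∞ G V)
    (h : ∀ z ∈ V, parity (G z) = G z) {z : ℂ} (hz : z ∈ V) : parity (dx G z) = dx G z := by
  have hd := differentiableAt_of_isOpen hV hG hz
  have h1 : dx (fun w => parity (G w)) z = parity (dx G z) :=
    dx_linear (parity (n := n)).toLinearMap hd
  rw [← h1]
  refine dx_congr ?_
  filter_upwards [hV.mem_nhds hz] with w hw using h w hw

/-- Testing [W, D] = fD on θ and on x gives f = -D(cθ) and D(cx) = cθ + D(cθ)θ. Comparing the parts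
with and without θ in the second identity expresses the θ-coefficients of `cx` and `cθ` through
their values at θ = 0. -/
theorem VField.IsEvenSuperconformalOn.eq_superconformalField (hV : IsOpen V) {W : VField n}
    (hW : W.IsEvenSuperconformalOn V) {z : ℂ} (hz : z ∈ V) :
    W.cx z = (superconformalField (fun w => rescale 0 (W.cx w))
        (fun w => rescale 0 (W.cθ w))).cx z ∧
      W.cθ z = (superconformalField (fun w => rescale 0 (W.cx w))
        (fun w => rescale 0 (W.cθ w))).cθ z := by
  obtain ⟨f, -, hf⟩ := hW.superconformal
  have hdx := differentiableAt_of_isOpen hV hW.smooth_cx hz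
  have hdθ := differentiableAt_of_isOpen hV hW.smooth_cθ hz
  have hG : ContDiff ℝ ∞ fun w : ℂ => algebraMap ℂ (Grass n) w :=
    ((Algebra.linearMap ℂ (Grass n)).toContinuousLinearMap.restrictScalars ℝ).contDiff
  have e1 : ∀ w, dx (fun w : ℂ => algebraMap ℂ (Grass n) w) w = 1 := fun w => by
    rw [dx_algebraMap (h := fun w => w) differentiableAt_fun_id]; simp
  have h1 : -superD W.cθ z = f z := by
    have h := hf (fun _ => theta) contDiffOn_const z hz
    have a1 : superD (fun _ => theta) = fun _ : ℂ => (1 : Grass n) := by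
      funext w; simp only [superD, dOdd_zero_theta, dx_const, mul_zero, add_zero]
    have a2 : W.app (fun _ => theta) = W.cθ := by
      funext w; simp only [VField.app, dOdd_zero_theta, dx_const, mul_zero, zero_add, mul_one]
    rw [a1, a2] at h
    simpa only [VField.app, dx_const, dOdd_one, mul_zero, add_zero, zero_sub, mul_one] using h
  have h2 : W.cθ z - superD W.cx z = f z * theta := by
    have h := hf _ hG.contDiffOn z hz
    have a1 : superD (fun w : ℂ => algebraMap ℂ (Grass n) w) = fun _ => theta := by
      funext w; simp only [superD, dOdd_algebraMap, e1, mul_one, zero_add]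
    have a2 : W.app (fun w : ℂ => algebraMap ℂ (Grass n) w) = W.cx := by
      funext w; simp only [VField.app, dOdd_algebraMap, e1, mul_one, mul_zero, add_zero]
    rw [a1, a2] at h
    simpa only [VField.app, dx_const, dOdd_zero_theta, mul_zero, zero_add, mul_one] using h
  have hq : parity (dOdd 0 (W.cθ z)) = dOdd 0 (W.cθ z) := by
    have h := dOdd_parity 0 (W.cθ z)
    rw [hW.parity_cθ z hz, map_neg, neg_inj] at h
    exact h.symm
  have hqθ : dOdd 0 (W.cθ z) * theta = theta * dOdd 0 (W.cθ z) := by rw [mul_theta, hq]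
  have h3 : W.cθ z - dOdd 0 (W.cx z) - theta * dx W.cx z = -(theta * dOdd 0 (W.cθ z)) := by
    rw [← h1, superD, superD, neg_mul, add_mul, hqθ, mul_theta (theta * _), map_mul,
      parity_theta, neg_mul, mul_neg, ← mul_assoc, theta_mul_theta, zero_mul, neg_zero,
      add_zero] at h2
    rw [← h2]; abel
  have h4 : dOdd 0 (W.cx z) = rescale 0 (W.cθ z) := by
    have h := congrArg (rescale 0) h3
    rw [map_sub, map_sub, map_neg, map_mul, map_mul, rescale_theta, zero_smul, zero_mul, zero_mul,
      neg_zero, sub_zero, rescale_dOdd_zero, sub_eq_zero] at h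
    exact h.symm
  have h5 : dx (fun w => rescale 0 (W.cx w)) z = rescale 0 (dx W.cx z) :=
    dx_linear (rescale (n := n) 0).toLinearMap hdx
  have h6 : theta * dOdd 0 (W.cθ z) = (1 / 2 : ℂ) • (theta * dx W.cx z) := by
    have h' := congrArg (dOdd 0) h3
    rw [map_sub, map_sub, dOdd_dOdd, sub_zero, map_neg, dOdd_zero_theta_mul, dOdd_zero_theta_mul,
      dOdd_dOdd, mul_zero, sub_zero] at h'
    have h'' := congrArg (fun x => theta * x) h'
    simp only [mul_sub, mul_neg, ← mul_assoc, theta_mul_theta, zero_mul, sub_zero] at h''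
    have h7 : theta * dx W.cx z = (2 : ℂ) • (theta * dOdd 0 (W.cθ z)) := by
      rw [sub_eq_iff_eq_add, eq_neg_add_iff_add_eq] at h''
      rw [two_smul, h'']
    rw [h7, smul_smul]; norm_num
  have h8 : theta * rescale 0 (dx W.cx z) = theta * dx W.cx z := by
    rw [rescale_zero, mul_sub, ← mul_assoc, theta_mul_theta, zero_mul, sub_zero]
  refine ⟨?_, ?_⟩
  · change W.cx z = rescale 0 (W.cx z) + theta * rescale 0 (W.cθ z)
    rw [← h4]
    exact rescale_zero_add _
  · change W.cθ z = rescale 0 (W.cθ z) + (1 / 2 : ℂ) • (theta * dx (fun w => rescale 0 (W.cx w)) z)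
    rw [h5, h8, ← h6]
    exact rescale_zero_add _

theorem contDiffOn_superD (hV : IsOpen V) {G : ℂ → Grass n} (hG : ContDiffOn ℝ ∞ G V) :
    ContDiffOn ℝ ∞ (superD G) V :=
  (contDiffOn_linear (dOdd 0) hG).add (contDiffOn_const.mul (contDiffOn_dx hV hG))

theorem superD_mul {G H : ℂ → Grass n} {z : ℂ} (hG : DifferentiableAt ℝ G z)
    (hH : DifferentiableAt ℝ H z) :
    superD (fun w => G w * H w) z = superD G z * H z + parity (G z) * superD H z := by
  have h : theta * (G z * dx H z) = parity (G z) * (theta * dx H z) := by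
    rw [← mul_assoc, ← mul_assoc, mul_theta, parity_parity]
  simp only [superD, dOdd_mul, dx_mul hG hH, mul_add, add_mul, h]
  noncomm_ring

theorem superD_add {G H : ℂ → Grass n} {z : ℂ} (hG : DifferentiableAt ℝ G z)
    (hH : DifferentiableAt ℝ H z) :
    superD (fun w => G w + H w) z = superD G z + superD H z := by
  simp only [superD, map_add, dx_add hG hH, mul_add]
  abel

/-- The second-order terms of [W, D] cancel, so it need only agree with fD on x and θ. The function
θ forces f = -D(cθ), and x gives the assumed identity. -/
theorem VField.isEvenSuperconformalOn_of_superD (hV : IsOpen V) {W : VField n}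
    (hx : ContDiffOn ℝ ∞ W.cx V)
    (hθ : ContDiffOn ℝ ∞ W.cθ V) (px : ∀ z ∈ V, parity (W.cx z) = W.cx z)
    (pθ : ∀ z ∈ V, parity (W.cθ z) = -W.cθ z)
    (h : ∀ z ∈ V, superD W.cx z = W.cθ z + superD W.cθ z * theta) :
    W.IsEvenSuperconformalOn V := by
  refine ⟨hx, hθ, px, pθ, fun z => -superD W.cθ z, (contDiffOn_superD hV hθ).neg,
    fun G hG z hz => ?_⟩
  have d {F : ℂ → Grass n} (hF : ContDiffOn ℝ ∞ F V) : DifferentiableAt ℝ F z :=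
    differentiableAt_of_isOpen hV hF hz
  have sx := contDiffOn_dx hV hG
  have so := contDiffOn_linear (dOdd 0) hG
  have e1 : superD (W.app G) z = superD W.cx z * dx G z + W.cx z * superD (dx G) z +
      (superD W.cθ z * dOdd 0 (G z) - W.cθ z * superD (fun w => dOdd 0 (G w)) z) := by
    have a := superD_add (d (hx.mul sx)) (d (hθ.mul so))
    have b := superD_mul (d hx) (d sx)
    have c := superD_mul (d hθ) (d so)
    rw [px z hz] at b
    rw [pθ z hz, neg_mul, ← sub_eq_add_neg] at c
    rw [← b, ← c]
    exact a
  have e2 : superD (fun w => dOdd 0 (G w)) z = theta * dOdd 0 (dx G z) := by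
    rw [superD, dOdd_dOdd, zero_add, dOdd_zero_dx hV hG hz]
  have e3 : dx (superD G) z = superD (dx G) z := by
    have a := dx_add (d so) (d (contDiffOn_const.mul sx) : DifferentiableAt ℝ
      (fun w => theta * dx G w) z)
    rw [dOdd_zero_dx hV hG hz, dx_const_mul _ (d sx)] at a
    exact a
  have e4 : dOdd 0 (superD G z) = dx G z - theta * dOdd 0 (dx G z) := by
    rw [superD, map_add, dOdd_dOdd, zero_add, dOdd_zero_theta_mul]
  rw [e1, VField.app, e2, e3, e4, h z hz, superD.eq_1 G]
  noncomm_ring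

theorem isEvenSuperconformalOn_superconformalField (hV : IsOpen V) {u η : ℂ → Grass n}
    (su : ContDiffOn ℝ ∞ u V)
    (sη : ContDiffOn ℝ ∞ η V) (pu : ∀ z ∈ V, parity (u z) = u z)
    (pη : ∀ z ∈ V, parity (η z) = -η z) (u0 : ∀ z ∈ V, dOdd 0 (u z) = 0)
    (η0 : ∀ z ∈ V, dOdd 0 (η z) = 0) :
    (superconformalField u η).IsEvenSuperconformalOn V := by
  have su' := contDiffOn_dx hV su
  have sθη : ContDiffOn ℝ ∞ (fun z => theta * η z) V := contDiffOn_const.mul sη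
  have sθu : ContDiffOn ℝ ∞ (fun z => (1 / 2 : ℂ) • (theta * dx u z)) V :=
    contDiffOn_linear ((1 / 2 : ℂ) • LinearMap.mulLeft ℂ theta) su'
  refine VField.isEvenSuperconformalOn_of_superD hV (su.add sθη) (sη.add sθu) ?_ ?_ ?_
  · intro z hz
    simp only [superconformalField, map_add, map_mul, pu z hz, pη z hz, parity_theta, neg_mul_neg]
  · intro z hz
    simp only [superconformalField, map_add, map_mul, map_smul, parity_dx hV su pu hz, pη z hz,
      parity_theta, neg_mul, smul_neg, neg_add]
  · intro z hz
    have d {F : ℂ → Grass n} (hF : ContDiffOn ℝ ∞ F V) : DifferentiableAt ℝ F z :=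
      differentiableAt_of_isOpen hV hF hz
    have e1 : superD (superconformalField u η).cx z = η z + theta * dx u z := by
      change dOdd 0 (u z + theta * η z) + theta * dx (fun w => u w + theta * η w) z = _
      rw [dx_add (d su) (d sθη), dx_const_mul _ (d sη), map_add, u0 z hz, dOdd_zero_theta_mul,
        η0 z hz, mul_add, ← mul_assoc theta theta, theta_mul_theta, zero_mul, mul_zero, sub_zero,
        add_zero, zero_add]
    have h0 : dOdd 0 (dx u z) = 0 := dOdd_zero_dx_eq_zero hV su u0 hz
    have e2 : superD (superconformalField u η).cθ z = (1 / 2 : ℂ) • dx u z +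
        theta * dx (superconformalField u η).cθ z := by
      have : dOdd 0 ((superconformalField u η).cθ z) = (1 / 2 : ℂ) • dx u z := by
        change dOdd 0 (η z + (1 / 2 : ℂ) • (theta * dx u z)) = _
        rw [map_add, map_smul, η0 z hz, dOdd_zero_theta_mul, h0, mul_zero, sub_zero, zero_add]
      rw [superD, this]
    rw [e1, e2, add_mul, mul_theta (theta * _), map_mul, parity_theta, neg_mul, mul_neg,
      ← mul_assoc theta theta, theta_mul_theta, zero_mul, neg_zero, add_zero, smul_mul_assoc,
      mul_theta, parity_dx hV su pu hz]
    change _ = η z + (1 / 2 : ℂ) • (theta * dx u z) + (1 / 2 : ℂ) • (theta * dx u z)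
    rw [add_assoc, ← add_smul]
    norm_num

end Superconformal

/-! ### The gauge equation modulo (ξ)³ -/

section SecondOrder
variable {n : ℕ} {V : Set ℂ}

/-- The vector field whose coefficients are the derivatives with respect to `x̃`. -/
def VField.dxbarCoeff (W : VField n) : VField n := ⟨dxbar W.cx, dxbar W.cθ⟩

/-- The commutator of two even vector fields. -/
def VField.bracket (W W' : VField n) : VField n :=
  ⟨fun z => W.app W'.cx z - W'.app W.cx z, fun z => W.app W'.cθ z - W'.app W.cθ z⟩

/-- `W` is a smooth even vector field which vanishes modulo `(ξ)`. -/
structure VField.IsNilpotentOn (W : VField n) (V : Set ℂ) : Prop where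
  smooth_cx : ContDiffOn ℝ ∞ W.cx V
  smooth_cθ : ContDiffOn ℝ ∞ W.cθ V
  parity_cx : ∀ z ∈ V, parity (W.cx z) = W.cx z
  parity_cθ : ∀ z ∈ V, parity (W.cθ z) = -W.cθ z
  cx_mem : ∀ z ∈ V, W.cx z ∈ xiPow n 1
  cθ_mem : ∀ z ∈ V, W.cθ z ∈ xiPow n 1

theorem VField.dxbar_app (hV : IsOpen V) {W : VField n} (hx : ContDiffOn ℝ ∞ W.cx V)
    (hθ : ContDiffOn ℝ ∞ W.cθ V) {G : ℂ → Grass n} (hG : ContDiffOn ℝ ∞ G V) {z : ℂ}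
    (hz : z ∈ V) :
    dxbar (W.app G) z = W.dxbarCoeff.app G z + W.app (dxbar G) z := by
  have d {F : ℂ → Grass n} (hF : ContDiffOn ℝ ∞ F V) : DifferentiableAt ℝ F z :=
    differentiableAt_of_isOpen hV hF hz
  have sx := contDiffOn_dx hV hG
  have so := contDiffOn_linear (dOdd 0) hG
  have a := dxbar_add (d (hx.mul sx)) (d (hθ.mul so))
  have b := dxbar_mul (d hx) (d sx)
  have c := dxbar_mul (d hθ) (d so)
  rw [dxbar_dx_comm hV hG hz] at b
  rw [dxbar_linear (dOdd 0) (d hG)] at c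
  refine a.trans ((congrArg₂ (· + ·) b c).trans ?_)
  simp only [VField.app, VField.dxbarCoeff]
  abel

theorem VField.app_mem_xiPow (hV : IsOpen V) {W : VField n} {k l : ℕ} {G : ℂ → Grass n} {z : ℂ}
    (hz : z ∈ V) (hx : W.cx z ∈ xiPow n k) (hθ : W.cθ z ∈ xiPow n k)
    (hG : ContDiffOn ℝ ∞ G V) (h : ∀ w ∈ V, G w ∈ xiPow n l) : W.app G z ∈ xiPow n (k + l) :=
  add_mem (mul_mem_xiPow hx (dx_mem (differentiableAt_of_isOpen hV hG hz) (by
      filter_upwards [hV.mem_nhds hz] with w hw using h w hw)))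
    (mul_mem_xiPow hθ (dOdd_zero_mem_xiPow (h z hz)))

theorem VField.app_app (hV : IsOpen V) {W W' : VField n} (hW : W.IsNilpotentOn V)
    (hW' : W'.IsNilpotentOn V) {G : ℂ → Grass n} (hG : ContDiffOn ℝ ∞ G V) {z : ℂ} (hz : z ∈ V) :
    W.app (W'.app G) z = W.app W'.cx z * dx G z + W.app W'.cθ z * dOdd 0 (G z) +
      W'.cx z * (W.cx z * dx (dx G) z) + W'.cx z * (W.cθ z * dOdd 0 (dx G z)) +
        W'.cθ z * (W.cx z * dOdd 0 (dx G z)) := by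
  have d {F : ℂ → Grass n} (hF : ContDiffOn ℝ ∞ F V) : DifferentiableAt ℝ F z :=
    differentiableAt_of_isOpen hV hF hz
  have sx := contDiffOn_dx hV hG
  have so := contDiffOn_linear (dOdd 0) hG
  have a := W.app_add (d (hW'.smooth_cx.mul sx)) (d (hW'.smooth_cθ.mul so))
  have b := W.app_mul (hW.parity_cx z hz) (hW.parity_cθ z hz) (d hW'.smooth_cx) (d sx)
  have c := W.app_mul (hW.parity_cx z hz) (hW.parity_cθ z hz) (d hW'.smooth_cθ) (d so)
  have e1 : W.app (dx G) z = W.cx z * dx (dx G) z + W.cθ z * dOdd 0 (dx G z) := rfl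
  have e2 : W.app (fun w => dOdd 0 (G w)) z = W.cx z * dOdd 0 (dx G z) := by
    rw [VField.app, dOdd_dOdd, mul_zero, add_zero, dOdd_zero_dx hV hG hz]
  rw [e1] at b
  rw [e2] at c
  refine a.trans ((congrArg₂ (· + ·) b c).trans ?_)
  noncomm_ring

/-- Both compositions contain the same second-order terms: in each product of coefficients at least
one factor is even, so the order does not matter. -/
theorem VField.bracket_app (hV : IsOpen V) {W W' : VField n} (hW : W.IsNilpotentOn V)
    (hW' : W'.IsNilpotentOn V) {G : ℂ → Grass n} (hG : ContDiffOn ℝ ∞ G V) {z : ℂ} (hz : z ∈ V) :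
    (W.bracket W').app G z = W.app (W'.app G) z - W'.app (W.app G) z := by
  rw [app_app hV hW hW' hG hz, app_app hV hW' hW hG hz]
  have h1 : W'.cx z * (W.cx z * dx (dx G) z) = W.cx z * (W'.cx z * dx (dx G) z) := by
    rw [← mul_assoc, ← mul_assoc, mul_eq_of_even (hW.parity_cx z hz)]
  have h2 : W'.cx z * (W.cθ z * dOdd 0 (dx G z)) = W.cθ z * (W'.cx z * dOdd 0 (dx G z)) := by
    rw [← mul_assoc, ← mul_assoc, mul_eq_of_even (hW'.parity_cx z hz)]
  have h3 : W'.cθ z * (W.cx z * dOdd 0 (dx G z)) = W.cx z * (W'.cθ z * dOdd 0 (dx G z)) := by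
    rw [← mul_assoc, ← mul_assoc, mul_eq_of_even (hW.parity_cx z hz)]
  rw [h1, h2, h3, VField.app]
  simp only [bracket]
  noncomm_ring

theorem dx_const_smul (c : ℂ) {G : ℂ → Grass n} {z : ℂ} (hG : DifferentiableAt ℝ G z) :
    dx (fun w => c • G w) z = c • dx G z := by
  simp only [Algebra.smul_def]
  exact dx_const_mul _ hG

theorem dxbar_const_smul (c : ℂ) {G : ℂ → Grass n} {z : ℂ} (hG : DifferentiableAt ℝ G z) :
    dxbar (fun w => c • G w) z = c • dxbar G z := by
  simp only [Algebra.smul_def]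
  exact dxbar_const_mul _ hG

theorem differentiableAt_const_smul (c : ℂ) {G : ℂ → Grass n} {z : ℂ}
    (hG : DifferentiableAt ℝ G z) : DifferentiableAt ℝ (fun w => c • G w) z :=
  differentiableAt_linear (c • LinearMap.id) hG

theorem VField.dxbar_expTwo {W : VField n} {G : ℂ → Grass n} {z : ℂ}
    (hG : DifferentiableAt ℝ G z) (hWG : DifferentiableAt ℝ (W.app G) z)
    (hWWG : DifferentiableAt ℝ (W.app (W.app G)) z) :
    dxbar (W.expTwo G) z = dxbar G z + dxbar (W.app G) z +
      (1 / 2 : ℂ) • dxbar (W.app (W.app G)) z := by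
  rw [← dxbar_const_smul _ hWWG, ← dxbar_add hG hWG]
  exact dxbar_add (hG.fun_add hWG) (differentiableAt_const_smul _ hWWG)

theorem VField.app_expTwo {W W' : VField n} {G : ℂ → Grass n} {z : ℂ}
    (hG : DifferentiableAt ℝ G z) (hWG : DifferentiableAt ℝ (W.app G) z)
    (hWWG : DifferentiableAt ℝ (W.app (W.app G)) z) :
    W'.app (W.expTwo G) z = W'.app G z + W'.app (W.app G) z +
      (1 / 2 : ℂ) • W'.app (W.app (W.app G)) z := by
  have h : W'.app (fun w => (1 / 2 : ℂ) • W.app (W.app G) w) z =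
      (1 / 2 : ℂ) • W'.app (W.app (W.app G)) z := by
    simp only [VField.app.eq_1 W', dx_const_smul _ hWWG, map_smul, mul_smul_comm, smul_add]
  rw [← h, ← W'.app_add hG hWG]
  exact W'.app_add (hG.fun_add hWG) (differentiableAt_const_smul _ hWWG)

/-- A truncated Baker–Campbell–Hausdorff formula. With N the coefficientwise ∂̄ of ν, the operator
∂̄e^ν - φe^ν - e^ν∂̄ is N - φ + ½(Nν + νN) - φν up to third order. As N ≡ φ modulo (ξ)², the
quadratic terms become ½[ν, φ], and the hypotheses say that N - φ + ½[ν, φ] is of third order. -/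
theorem VField.dxbar_expTwo_mem (hV : IsOpen V) {ν φ : VField n} (hν : ν.IsNilpotentOn V)
    (hφ : φ.IsNilpotentOn V)
    (hx : ∀ z ∈ V, dxbar ν.cx z - φ.cx z + (1 / 2 : ℂ) • (ν.bracket φ).cx z ∈ xiPow n 3)
    (hθ : ∀ z ∈ V, dxbar ν.cθ z - φ.cθ z + (1 / 2 : ℂ) • (ν.bracket φ).cθ z ∈ xiPow n 3)
    {G : ℂ → Grass n} (hG : ContDiffOn ℝ ∞ G V) {z : ℂ} (hz : z ∈ V) :
    dxbar (ν.expTwo G) z - φ.app (ν.expTwo G) z - ν.expTwo (dxbar G) z ∈ xiPow n 3 := by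
  have d {F : ℂ → Grass n} (hF : ContDiffOn ℝ ∞ F V) : DifferentiableAt ℝ F z :=
    differentiableAt_of_isOpen hV hF hz
  have triv : ∀ F : ℂ → Grass n, ∀ w ∈ V, F w ∈ xiPow n 0 := fun _ _ _ => trivial
  have sν {F : ℂ → Grass n} (hF : ContDiffOn ℝ ∞ F V) : ContDiffOn ℝ ∞ (ν.app F) V :=
    contDiffOn_app hV hν.smooth_cx hν.smooth_cθ hF
  have sφ {F : ℂ → Grass n} (hF : ContDiffOn ℝ ∞ F V) : ContDiffOn ℝ ∞ (φ.app F) V :=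
    contDiffOn_app hV hφ.smooth_cx hφ.smooth_cθ hF
  let N := ν.dxbarCoeff
  have sN {F : ℂ → Grass n} (hF : ContDiffOn ℝ ∞ F V) : ContDiffOn ℝ ∞ (N.app F) V :=
    contDiffOn_app (W := N) hV (contDiffOn_dxbar hV hν.smooth_cx)
      (contDiffOn_dxbar hV hν.smooth_cθ) hF
  let B := ν.bracket φ
  let K : VField n := ⟨fun z => dxbar ν.cx z - φ.cx z + (1 / 2 : ℂ) • B.cx z,
    fun z => dxbar ν.cθ z - φ.cθ z + (1 / 2 : ℂ) • B.cθ z⟩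
  have hN : ∀ (F : ℂ → Grass n) (w : ℂ),
      N.app F w = φ.app F w - (1 / 2 : ℂ) • B.app F w + K.app F w := by
    intro F w
    simp only [VField.app, N, K, dxbarCoeff, add_mul, sub_mul, smul_mul_assoc, smul_add]
    abel
  have hBx : ∀ w ∈ V, B.cx w ∈ xiPow n 2 := fun w hw => sub_mem
    (app_mem_xiPow (k := 1) (l := 1) hV hw (hν.cx_mem w hw) (hν.cθ_mem w hw) hφ.smooth_cx hφ.cx_mem)
    (app_mem_xiPow (k := 1) (l := 1) hV hw (hφ.cx_mem w hw) (hφ.cθ_mem w hw) hν.smooth_cx hν.cx_mem)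
  have hBθ : ∀ w ∈ V, B.cθ w ∈ xiPow n 2 := fun w hw => sub_mem
    (app_mem_xiPow (k := 1) (l := 1) hV hw (hν.cx_mem w hw) (hν.cθ_mem w hw) hφ.smooth_cθ hφ.cθ_mem)
    (app_mem_xiPow (k := 1) (l := 1) hV hw (hφ.cx_mem w hw) (hφ.cθ_mem w hw) hν.smooth_cθ hν.cθ_mem)
  have hνG : ∀ w ∈ V, ν.app G w ∈ xiPow n 1 := fun w hw =>
    app_mem_xiPow (k := 1) (l := 0) hV hw (hν.cx_mem w hw) (hν.cθ_mem w hw) hG (triv G)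
  have hννG : ∀ w ∈ V, ν.app (ν.app G) w ∈ xiPow n 2 := fun w hw =>
    app_mem_xiPow (k := 1) (l := 1) hV hw (hν.cx_mem w hw) (hν.cθ_mem w hw) (sν hG) hνG
  have m1 : K.app G z ∈ xiPow n 3 :=
    app_mem_xiPow (k := 3) (l := 0) hV hz (hx z hz) (hθ z hz) hG (triv G)
  have m2 : K.app (ν.app G) z ∈ xiPow n 3 :=
    app_mem_xiPow (k := 3) (l := 0) hV hz (hx z hz) (hθ z hz) (sν hG) (triv _)
  have m3 : B.app (ν.app G) z ∈ xiPow n 3 :=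
    app_mem_xiPow (k := 2) (l := 1) hV hz (hBx z hz) (hBθ z hz) (sν hG) hνG
  have m4 : φ.app (ν.app (ν.app G)) z ∈ xiPow n 3 :=
    app_mem_xiPow (k := 1) (l := 2) hV hz (hφ.cx_mem z hz) (hφ.cθ_mem z hz) (sν (sν hG)) hννG
  have hM : ∀ w ∈ V, N.app G w - φ.app G w ∈ xiPow n 2 := by
    intro w hw
    have h1 : B.app G w ∈ xiPow n 2 :=
      app_mem_xiPow (k := 2) (l := 0) hV hw (hBx w hw) (hBθ w hw) hG (triv G)
    have h2 : K.app G w ∈ xiPow n 3 :=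
      app_mem_xiPow (k := 3) (l := 0) hV hw (hx w hw) (hθ w hw) hG (triv G)
    have e : N.app G w - φ.app G w = K.app G w - (1 / 2 : ℂ) • B.app G w := by
      rw [hN]; abel
    rw [e]
    exact sub_mem (xiPow_succ_le 2 h2) (Submodule.smul_mem _ _ h1)
  have m5 : ν.app (fun w => N.app G w - φ.app G w) z ∈ xiPow n 3 :=
    app_mem_xiPow (k := 1) (l := 2) hV hz (hν.cx_mem z hz) (hν.cθ_mem z hz) ((sN hG).sub (sφ hG)) hM
  rw [ν.app_sub (d (sN hG)) (d (sφ hG))] at m5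
  have e1 : ∀ w ∈ V, dxbar (ν.app G) w = N.app G w + ν.app (dxbar G) w := fun w hw =>
    dxbar_app hV hν.smooth_cx hν.smooth_cθ hG hw
  have e2 : dxbar (ν.app (ν.app G)) z = N.app (ν.app G) z + ν.app (N.app G) z +
      ν.app (ν.app (dxbar G)) z := by
    rw [dxbar_app hV hν.smooth_cx hν.smooth_cθ (sν hG) hz, add_assoc,
      ← ν.app_add (d (sN hG)) (d (sν (contDiffOn_dxbar hV hG)))]
    congr 1
    refine ν.app_congr ?_
    filter_upwards [hV.mem_nhds hz] with w hw using e1 w hw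
  have e3 := dxbar_expTwo (d hG) (d (sν hG)) (d (sν (sν hG)))
  have e4 := app_expTwo (W' := φ) (d hG) (d (sν hG)) (d (sν (sν hG)))
  have e5 : ν.expTwo (dxbar G) z = dxbar G z + ν.app (dxbar G) z +
      (1 / 2 : ℂ) • ν.app (ν.app (dxbar G)) z := rfl
  have e6 := bracket_app hV hν hφ hG hz
  -- K is the error N - φ + ½[ν, φ] and B the bracket. The expansion is regrouped so that each
  -- summand is visibly of third order.
  have key : dxbar (ν.expTwo G) z - φ.app (ν.expTwo G) z - ν.expTwo (dxbar G) z =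
      K.app G z + (1 / 2 : ℂ) • K.app (ν.app G) z - (1 / 4 : ℂ) • B.app (ν.app G) z +
        (1 / 2 : ℂ) • (ν.app (N.app G) z - ν.app (φ.app G) z) -
          (1 / 2 : ℂ) • φ.app (ν.app (ν.app G)) z := by
    rw [e3, e4, e5, e1 z hz, e2, hN G z, hN (ν.app G) z]
    change B.app G z = _ at e6
    rw [e6]
    module
  rw [key]
  exact sub_mem (add_mem (sub_mem (add_mem m1 (Submodule.smul_mem _ _ m2))
    (Submodule.smul_mem _ _ m3)) (Submodule.smul_mem _ _ m5)) (Submodule.smul_mem _ _ m4)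

/-- The coefficients of a superconformal vector field which vanishes modulo `(ξ)`. -/
structure IsPotentialOn (u η : ℂ → Grass n) (V : Set ℂ) : Prop where
  smooth_u : ContDiffOn ℝ ∞ u V
  smooth_η : ContDiffOn ℝ ∞ η V
  parity_u : ∀ z ∈ V, parity (u z) = u z
  parity_η : ∀ z ∈ V, parity (η z) = -η z
  dOdd_u : ∀ z ∈ V, dOdd 0 (u z) = 0
  dOdd_η : ∀ z ∈ V, dOdd 0 (η z) = 0
  u_mem : ∀ z ∈ V, u z ∈ xiPow n 2
  η_mem : ∀ z ∈ V, η z ∈ xiPow n 1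

namespace IsPotentialOn

variable {u η r p : ℂ → Grass n}

theorem dx_u_mem (h : IsPotentialOn u η V) (hV : IsOpen V) {z : ℂ} (hz : z ∈ V) :
    dx u z ∈ xiPow n 2 :=
  dx_mem (differentiableAt_of_isOpen hV h.smooth_u hz) (by
    filter_upwards [hV.mem_nhds hz] with w hw using h.u_mem w hw)

theorem dx_η_mem (h : IsPotentialOn u η V) (hV : IsOpen V) {z : ℂ} (hz : z ∈ V) :
    dx η z ∈ xiPow n 1 :=
  dx_mem (differentiableAt_of_isOpen hV h.smooth_η hz) (by
    filter_upwards [hV.mem_nhds hz] with w hw using h.η_mem w hw)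

theorem isEvenSuperconformalOn (h : IsPotentialOn u η V) (hV : IsOpen V) :
    (superconformalField u η).IsEvenSuperconformalOn V :=
  isEvenSuperconformalOn_superconformalField hV h.smooth_u h.smooth_η h.parity_u h.parity_η
    h.dOdd_u h.dOdd_η

theorem isNilpotentOn (h : IsPotentialOn u η V) (hV : IsOpen V) :
    (superconformalField u η).IsNilpotentOn V where
  smooth_cx := (h.isEvenSuperconformalOn hV).smooth_cx
  smooth_cθ := (h.isEvenSuperconformalOn hV).smooth_cθ
  parity_cx := (h.isEvenSuperconformalOn hV).parity_cx
  parity_cθ := (h.isEvenSuperconformalOn hV).parity_cθ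
  cx_mem z hz := add_mem (xiPow_succ_le 1 (h.u_mem z hz)) (mul_mem_xiPow_right _ (h.η_mem z hz))
  cθ_mem z hz := add_mem (h.η_mem z hz) (Submodule.smul_mem _ _ (mul_mem_xiPow_right _
    (xiPow_succ_le 1 (h.dx_u_mem hV hz))))

/-- Since u and r have order two and η and p order one in ξ, only η ∂/∂θ applied to θp stays below
order three. -/
theorem app_cx_mem (h : IsPotentialOn u η V) (h' : IsPotentialOn r p V) (hV : IsOpen V) {z : ℂ}
    (hz : z ∈ V) :
    (superconformalField u η).app (superconformalField r p).cx z - η z * p z ∈ xiPow n 3 := by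
  have d {F : ℂ → Grass n} (hF : ContDiffOn ℝ ∞ F V) : DifferentiableAt ℝ F z :=
    differentiableAt_of_isOpen hV hF hz
  have sθp : ContDiffOn ℝ ∞ (fun z => theta * p z) V := contDiffOn_const.mul h'.smooth_η
  have e1 : dx (superconformalField r p).cx z = dx r z + theta * dx p z := by
    have a := dx_add (d h'.smooth_u) (d sθp)
    rw [dx_const_mul _ (d h'.smooth_η)] at a
    exact a
  have e2 : dOdd 0 ((superconformalField r p).cx z) = p z := by
    change dOdd 0 (r z + theta * p z) = p z
    rw [map_add, h'.dOdd_u z hz, dOdd_zero_theta_mul, h'.dOdd_η z hz, mul_zero, sub_zero, zero_add]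
  have e3 : (superconformalField u η).app (superconformalField r p).cx z - η z * p z =
      u z * dx r z + u z * (theta * dx p z) + theta * η z * dx r z +
        (1 / 2 : ℂ) • (theta * dx u z * p z) := by
    rw [VField.app, e1, e2]
    simp only [superconformalField, add_mul, mul_add, theta_mul_mul_theta_mul, smul_mul_assoc]
    abel
  rw [e3]
  have hr := h'.dx_u_mem hV hz
  have hp := h'.dx_η_mem hV hz
  exact add_mem (add_mem (add_mem
    (xiPow_succ_le 3 (mul_mem_xiPow (k := 2) (l := 2) (h.u_mem z hz) hr))
    (mul_mem_xiPow (k := 2) (l := 1) (h.u_mem z hz) (mul_mem_xiPow_right _ hp)))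
    (mul_mem_xiPow (k := 1) (l := 2) (mul_mem_xiPow_right _ (h.η_mem z hz)) hr))
    (Submodule.smul_mem _ _ (mul_mem_xiPow (k := 2) (l := 1)
      (mul_mem_xiPow_right _ (h.dx_u_mem hV hz)) (h'.η_mem z hz)))

theorem dx_cθ (h : IsPotentialOn u η V) (hV : IsOpen V) {z : ℂ} (hz : z ∈ V) :
    dx (superconformalField u η).cθ z = dx η z + (1 / 2 : ℂ) • (theta * dx (dx u) z) := by
  have d {F : ℂ → Grass n} (hF : ContDiffOn ℝ ∞ F V) : DifferentiableAt ℝ F z :=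
    differentiableAt_of_isOpen hV hF hz
  have su := contDiffOn_dx hV h.smooth_u
  have a := dx_add (d h.smooth_η)
    (d (contDiffOn_linear ((1 / 2 : ℂ) • LinearMap.mulLeft ℂ theta) su))
  rw [dx_linear _ (d su)] at a
  exact a

/-- By the same count only θη ∂/∂x applied to p survives. -/
theorem app_cθ_mem (h : IsPotentialOn u η V) (h' : IsPotentialOn r p V) (hV : IsOpen V) {z : ℂ}
    (hz : z ∈ V) :
    (superconformalField u η).app (superconformalField r p).cθ z - theta * η z * dx p z ∈
      xiPow n 3 := by
  have e2 : dOdd 0 ((superconformalField r p).cθ z) = (1 / 2 : ℂ) • dx r z := by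
    change dOdd 0 (p z + (1 / 2 : ℂ) • (theta * dx r z)) = _
    rw [map_add, map_smul, h'.dOdd_η z hz, dOdd_zero_theta_mul,
      dOdd_zero_dx_eq_zero hV h'.smooth_u h'.dOdd_u hz, mul_zero, sub_zero, zero_add]
  have e3 : (superconformalField u η).app (superconformalField r p).cθ z - theta * η z * dx p z =
      u z * dx p z + (1 / 2 : ℂ) • (u z * (theta * dx (dx r) z)) + (1 / 2 : ℂ) • (η z * dx r z) +
        (1 / 2 : ℂ) • ((1 / 2 : ℂ) • (theta * dx u z * dx r z)) := by
    rw [VField.app, h'.dx_cθ hV hz, e2]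
    simp only [superconformalField, add_mul, mul_add, mul_smul_comm, theta_mul_mul_theta_mul,
      smul_mul_assoc, smul_add, smul_zero]
    abel
  rw [e3]
  have hr := h'.dx_u_mem hV hz
  have hrr : dx (dx r) z ∈ xiPow n 2 :=
    dx_mem (differentiableAt_of_isOpen hV (contDiffOn_dx hV h'.smooth_u) hz) (by
      filter_upwards [hV.mem_nhds hz] with w hw using h'.dx_u_mem hV hw)
  have hp := h'.dx_η_mem hV hz
  exact add_mem (add_mem (add_mem (mul_mem_xiPow (k := 2) (l := 1) (h.u_mem z hz) hp)
    (Submodule.smul_mem _ _ (xiPow_succ_le 3 (mul_mem_xiPow (k := 2) (l := 2) (h.u_mem z hz)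
      (mul_mem_xiPow_right _ hrr)))))
    (Submodule.smul_mem _ _ (mul_mem_xiPow (k := 1) (l := 2) (h.η_mem z hz) hr)))
    (Submodule.smul_mem _ _ (Submodule.smul_mem _ _ (xiPow_succ_le 3
      (mul_mem_xiPow (k := 2) (l := 2) (mul_mem_xiPow_right _ (h.dx_u_mem hV hz)) hr))))

theorem parity_dx_η (h : IsPotentialOn u η V) (hV : IsOpen V) {z : ℂ} (hz : z ∈ V) :
    parity (dx η z) = -dx η z := by
  have hd := differentiableAt_of_isOpen hV h.smooth_η hz
  have hm := dx_mem (P := LinearMap.ker ((parity (n := n)).toLinearMap + LinearMap.id)) hd (by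
    filter_upwards [hV.mem_nhds hz] with w hw
    exact add_eq_zero_iff_eq_neg.mpr (h.parity_η w hw))
  exact add_eq_zero_iff_eq_neg.mp hm

/-- The two products give ½[ν, φ] ≡ ηp ∂/∂x + ½θ(ηp)' ∂/∂θ, again of superconformal shape. So the
gauge equation reduces to ∂̄η ≡ p and ∂̄u ≡ r - ηp; its remaining θ-component is half the
x-derivative of the second equation. -/
theorem dxbar_expTwo_mem (h : IsPotentialOn u η V) (h' : IsPotentialOn r p V) (hV : IsOpen V)
    (hη : ∀ z ∈ V, dxbar η z - p z ∈ xiPow n 3)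
    (hu : ∀ z ∈ V, dxbar u z - (r z - η z * p z) ∈ xiPow n 3)
    {G : ℂ → Grass n} (hG : ContDiffOn ℝ ∞ G V) {z : ℂ} (hz : z ∈ V) :
    dxbar ((superconformalField u η).expTwo G) z -
        (superconformalField r p).app ((superconformalField u η).expTwo G) z -
      (superconformalField u η).expTwo (dxbar G) z ∈ xiPow n 3 := by
  refine VField.dxbar_expTwo_mem hV (h.isNilpotentOn hV) (h'.isNilpotentOn hV) ?_ ?_ hG hz
  · intro z hz
    have d {F : ℂ → Grass n} (hF : ContDiffOn ℝ ∞ F V) : DifferentiableAt ℝ F z :=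
      differentiableAt_of_isOpen hV hF hz
    have sθη : ContDiffOn ℝ ∞ (fun z => theta * η z) V := contDiffOn_const.mul h.smooth_η
    have e1 : dxbar (superconformalField u η).cx z = dxbar u z + theta * dxbar η z := by
      have a := dxbar_add (d h.smooth_u) (d sθη)
      rw [dxbar_const_mul _ (d h.smooth_η)] at a
      exact a
    have e2 : p z * η z = -(η z * p z) := by
      rw [mul_eq_of_odd (h.parity_η z hz), h'.parity_η z hz, mul_neg]
    have m1 := h.app_cx_mem h' hV hz
    have m2 := h'.app_cx_mem h hV hz
    rw [e2] at m2
    have key := add_mem (add_mem (hu z hz) (mul_mem_xiPow_right theta (hη z hz)))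
      (Submodule.smul_mem _ (1 / 2 : ℂ) (sub_mem m1 m2))
    refine (congrArg (· ∈ xiPow n 3) ?_).mp key
    rw [e1]
    simp only [VField.bracket]
    change _ = dxbar u z + theta * dxbar η z - (r z + theta * p z) + _
    rw [mul_sub]
    module
  · intro z hz
    have d {F : ℂ → Grass n} (hF : ContDiffOn ℝ ∞ F V) : DifferentiableAt ℝ F z :=
      differentiableAt_of_isOpen hV hF hz
    have su := contDiffOn_dx hV h.smooth_u
    have e1 : dxbar (superconformalField u η).cθ z =
        dxbar η z + (1 / 2 : ℂ) • (theta * dx (dxbar u) z) := by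
      have a := dxbar_add (d h.smooth_η)
        (d (contDiffOn_linear ((1 / 2 : ℂ) • LinearMap.mulLeft ℂ theta) su))
      rw [dxbar_linear _ (d su), dxbar_dx_comm hV h.smooth_u hz] at a
      exact a
    have sub := contDiffOn_dxbar hV h.smooth_u
    have sηp := h.smooth_η.mul h'.smooth_η
    have e2 : dx (fun w => dxbar u w - (r w - η w * p w)) z =
        dx (dxbar u) z - (dx r z - (dx η z * p z + η z * dx p z)) := by
      rw [← dx_mul (d h.smooth_η) (d h'.smooth_η)]
      have a := dx_sub (d h'.smooth_u) (d sηp)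
      have b := dx_sub (d sub) (d (h'.smooth_u.sub sηp))
      exact b.trans (congrArg _ a)
    have m0 : dx (fun w => dxbar u w - (r w - η w * p w)) z ∈ xiPow n 3 :=
      dx_mem (d (sub.sub (h'.smooth_u.sub sηp))) (by
        filter_upwards [hV.mem_nhds hz] with w hw using hu w hw)
    rw [e2] at m0
    have e3 : p z * dx η z = -(dx η z * p z) := by
      rw [mul_eq_of_odd (h.parity_dx_η hV hz), h'.parity_η z hz, mul_neg]
    have m1 := h.app_cθ_mem h' hV hz
    have m2 := h'.app_cθ_mem h hV hz
    rw [mul_assoc, e3] at m2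
    have key := add_mem (add_mem (hη z hz) (Submodule.smul_mem _ (1 / 2 : ℂ)
      (mul_mem_xiPow_right theta m0))) (Submodule.smul_mem _ (1 / 2 : ℂ) (sub_mem m1 m2))
    refine (congrArg (· ∈ xiPow n 3) ?_).mp key
    rw [e1]
    simp only [VField.bracket]
    change _ = dxbar η z + (1 / 2 : ℂ) • (theta * dx (dxbar u) z) -
      (p z + (1 / 2 : ℂ) • (theta * dx r z)) + _
    simp only [mul_sub, mul_add, mul_neg, mul_assoc]
    module

end IsPotentialOn

end SecondOrder

/-! ### Sums and complex conjugates under Wirtinger derivatives -/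

section Calculus
variable {n : ℕ}

theorem dxbar_sum {I : Type*} (s : Finset I) {F : I → ℂ → Grass n} {z : ℂ}
    (h : ∀ i ∈ s, DifferentiableAt ℝ (F i) z) :
    dxbar (fun w => ∑ i ∈ s, F i w) z = ∑ i ∈ s, dxbar (F i) z := by
  simp only [dxbar, fderiv_fun_sum h, sum_apply, Finset.smul_sum,
    Finset.sum_add_distrib, smul_add]

theorem dx_conj {h : ℂ → ℂ} {z : ℂ} (hh : DifferentiableAt ℂ h z) :
    dx (fun w => starRingEnd ℂ (h w)) z = 0 := by
  have h1 : ∀ v, fderiv ℝ (fun w => starRingEnd ℂ (h w)) z v =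
      starRingEnd ℂ (deriv h z * v) := by
    intro v
    have e : fderiv ℝ (fun w => starRingEnd ℂ (h w)) z =
        (Complex.conjCLE : ℂ →L[ℝ] ℂ).comp (fderiv ℝ h z) :=
      ((Complex.conjCLE : ℂ →L[ℝ] ℂ).hasFDerivAt.comp z
        (hh.restrictScalars ℝ).hasFDerivAt).fderiv
    rw [e, ← fderiv_real_apply hh]
    rfl
  simp only [dx, h1, map_mul, map_one, Complex.conj_I, smul_eq_mul]
  linear_combination (1 / 2 * starRingEnd ℂ (deriv h z)) * Complex.I_mul_I

theorem differentiableAt_conj {h : ℂ → ℂ} {z : ℂ} (hh : DifferentiableAt ℂ h z) :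
    DifferentiableAt ℝ (fun w => starRingEnd ℂ (h w)) z :=
  (Complex.conjCLE : ℂ →L[ℝ] ℂ).differentiableAt.comp z (hh.restrictScalars ℝ)

end Calculus

/-! ### Assembling the second-order trivialization -/

section Primitives

variable {C : Type u} [TopologicalSpace C] [ChartedSpace ℂ C]

namespace SpinAtlas

variable (S : SpinAtlas C) {n : ℕ}

theorem differentiableAt_deriv_trans {α β : S.ι} {z : ℂ} (hz : z ∈ S.overlap α β) :
    DifferentiableAt ℂ (deriv (S.trans α β)) z :=
  ((S.differentiableOn_trans α β).deriv (S.isOpen_overlap α β)).differentiableAt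
    ((S.isOpen_overlap α β).mem_nhds hz)

theorem deriv_deriv_trans {α β : S.ι} {z : ℂ} (hz : z ∈ S.overlap α β) :
    deriv (deriv (S.trans α β)) z = 2 * S.root α β z * deriv (S.root α β) z := by
  have h : deriv (S.trans α β) =ᶠ[nhds z] fun w => S.root α β w ^ 2 := by
    filter_upwards [(S.isOpen_overlap α β).mem_nhds hz] with w hw using (S.root_sq_eq hw).symm
  rw [h.deriv_eq, deriv_fun_pow (S.differentiableAt_root hz)]
  simp

theorem Glues.congr {c : S.ι → S.ι → ℂ → ℂ} {W W' : S.ι → VField n} (h : S.Glues c W)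
    (hx : ∀ α, ∀ z ∈ (S.chart α).target, (W α).cx z = (W' α).cx z)
    (hθ : ∀ α, ∀ z ∈ (S.chart α).target, (W α).cθ z = (W' α).cθ z) : S.Glues c W' := by
  intro α β G hG z hz
  have h1 := h α β G hG z hz
  have hα := (S.mem_overlap.mp hz).1
  have hβ := S.trans_mem_target hz
  simp only [VField.app, pullback] at h1 ⊢
  rwa [hx α z hα, hθ α z hα, hx β _ hβ, hθ β _ hβ] at h1

/-- The laws for u (weight f') and η (weight ζ) suffice. The term θη of `cx` is covered by f' = ζ².
The term θu'/2 of `cθ` follows by differentiating the law for u: c passes through since ∂c/∂x = 0,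
and f'' = 2ζζ' yields the inhomogeneous term ζ'uθ. The cases needed are c = 1 and c = conj(f'). -/
theorem glues_superconformalField {c : S.ι → S.ι → ℂ → ℂ} {u η : S.ι → ℂ → Grass n}
    (hc : ∀ α β, ∀ z ∈ S.overlap α β, DifferentiableAt ℝ (c α β) z)
    (hc0 : ∀ α β, ∀ z ∈ S.overlap α β, dx (c α β) z = 0)
    (su : ∀ α, ContDiffOn ℝ ∞ (u α) (S.chart α).target)
    (pu : ∀ α, ∀ z ∈ (S.chart α).target, parity (u α z) = u α z)
    (u0 : ∀ α, ∀ z ∈ (S.chart α).target, dOdd 0 (u α z) = 0)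
    (η0 : ∀ α, ∀ z ∈ (S.chart α).target, dOdd 0 (η α z) = 0)
    (hu : ∀ α β, ∀ z ∈ S.overlap α β,
      deriv (S.trans α β) z • u α z = c α β z • u β (S.trans α β z))
    (hη : ∀ α β, ∀ z ∈ S.overlap α β, S.root α β z • η α z = c α β z • η β (S.trans α β z)) :
    S.Glues c fun α => superconformalField (u α) (η α) := by
  refine S.glues_of_eq (fun α β z hz => ?_) fun α β z hz => ?_
  · have hβ := S.trans_mem_target hz
    simp only [superconformalField, pullback, map_add, map_mul, rescale_theta,
      rescale_eq_self (u0 β _ hβ), rescale_eq_self (η0 β _ hβ), smul_add, smul_mul_assoc]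
    rw [hu α β z hz, ← S.root_sq_eq hz, smul_comm (c α β z), ← mul_smul_comm (c α β z),
      ← hη α β z hz, mul_smul_comm, smul_smul, pow_two]
  · have hα := (S.mem_overlap.mp hz).1
    have hβ := S.trans_mem_target hz
    have dα := differentiableAt_of_isOpen (S.chart α).open_target (su α) hα
    have dβ := differentiableAt_of_isOpen (S.chart β).open_target (su β) hβ
    have ht := S.differentiableAt_trans hz
    have key : deriv (deriv (S.trans α β)) z • u α z + deriv (S.trans α β) z • dx (u α) z =
        c α β z • deriv (S.trans α β) z • dx (u β) (S.trans α β z) := by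
      have h1 : dx (fun w => deriv (S.trans α β) w • u α w) z =
          dx (fun w => c α β w • u β (S.trans α β w)) z := by
        refine dx_congr ?_
        filter_upwards [(S.isOpen_overlap α β).mem_nhds hz] with w hw using hu α β w hw
      have dc : DifferentiableAt ℝ (fun w => u β (S.trans α β w)) z :=
        DifferentiableAt.comp z dβ (ht.restrictScalars ℝ)
      rw [dx_smul ((S.differentiableAt_deriv_trans hz).restrictScalars ℝ) dα,
        dx_smul (hc α β z hz) dc, hc0 α β z hz, zero_smul, zero_add,
        dx_of_differentiableAt (S.differentiableAt_deriv_trans hz),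
        dx_comp_holomorphic ht dβ] at h1
      exact h1
    have hζ := S.root_ne_zero hz
    rw [S.deriv_deriv_trans hz, ← S.root_sq_eq hz] at key
    have key2 : c α β z • dx (u β) (S.trans α β z) =
        (2 * (S.root α β z)⁻¹ * deriv (S.root α β) z) • u α z + dx (u α) z := by
      refine smul_right_injective _ (pow_ne_zero 2 hζ) ?_
      change S.root α β z ^ 2 • c α β z • _ = S.root α β z ^ 2 • (_ + _)
      rw [smul_comm, ← key, smul_add, smul_smul]
      congr 2
      field_simp
    have hβ0 := dOdd_zero_dx_eq_zero (S.chart β).open_target (su β) (u0 β) hβ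
    simp only [superconformalField, pullback, map_add, map_smul, map_mul, rescale_theta,
      rescale_eq_self hβ0, rescale_eq_self (η0 β _ hβ)]
    have e1 : (u α z + theta * η α z) * theta = theta * u α z := by
      have e := theta_mul_mul_theta_mul (η α z) 1
      rw [mul_one] at e
      rw [add_mul, e, add_zero, mul_theta, pu α z hα]
    have e2 : c α β z • (1 / 2 : ℂ) • (S.root α β z • theta * dx (u β) (S.trans α β z)) =
        (1 / 2 : ℂ) • S.root α β z • (theta * (c α β z • dx (u β) (S.trans α β z))) := by
      simp only [smul_mul_assoc, mul_smul_comm, smul_smul]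
      congr 1
      ring
    rw [e1, smul_add (c α β z), e2, key2, ← hη α β z hz, smul_add, mul_add, mul_smul_comm]
    simp only [smul_add, smul_smul]
    have e3 : 1 / 2 * (S.root α β z * (2 * (S.root α β z)⁻¹ * deriv (S.root α β) z)) =
        deriv (S.root α β) z := by field_simp
    rw [e3, mul_comm (S.root α β z) (1 / 2)]
    abel

/-- The section w has weight f' = ζ² and θ absorbs one factor ζ, so the coefficient of θ keeps
weight ζ. -/
theorem root_smul_dOdd_eq {w : S.ι → ℂ → Grass n} {α β : S.ι} {z : ℂ} (hz : z ∈ S.overlap α β)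
    (h : deriv (S.trans α β) z • w α z = S.pullback α β (w β) z) :
    S.root α β z • dOdd 0 (w α z) = dOdd 0 (w β (S.trans α β z)) := by
  have h1 := congrArg (dOdd 0) h
  rw [map_smul, pullback, dOdd_zero_rescale, ← S.root_sq_eq hz, pow_two, ← smul_smul] at h1
  exact smul_right_injective _ (S.root_ne_zero hz) h1

end SpinAtlas

namespace AnalyticDeformation

open SpinAtlas

variable {S : SpinAtlas C} {n : ℕ} (D : AnalyticDeformation S n)

/-- ∂/∂θ annihilates β ∂w/∂θ, as β is free of θ and the odd derivative squares to zero. On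
θ-coefficients ∂̄_E is the plain ∂̄. -/
theorem dxbar_dOdd_eq {α : S.ι} {z : ℂ} (hz : z ∈ (S.chart α).target) {w : ℂ → Grass n}
    (hw : DifferentiableAt ℝ w z) :
    dxbar (fun x => dOdd 0 (w x)) z = dOdd 0 ((D.base α).dbar w z) := by
  rw [base_dbar, map_sub, dOdd_mul, D.dOdd_zero_lin hz, dOdd_dOdd, mul_zero, zero_mul, add_zero,
    sub_zero]
  exact dxbar_linear (dOdd 0) hw

/-- The extra term is the coupling by β of the θ-coefficient to the part without θ. -/
theorem dxbar_rescale_zero_eq {α : S.ι} {z : ℂ} (hz : z ∈ (S.chart α).target) {w : ℂ → Grass n}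
    (hw : DifferentiableAt ℝ w z) :
    dxbar (fun x => rescale 0 (w x)) z =
      rescale 0 ((D.base α).dbar w z) + D.lin α z * dOdd 0 (w z) := by
  have h : dxbar (fun x => rescale 0 (w x)) z = rescale 0 (dxbar w z) :=
    dxbar_linear (rescale (n := n) 0).toLinearMap hw
  rw [h, base_dbar, map_sub, map_mul, rescale_eq_self (D.dOdd_zero_lin hz), rescale_dOdd_zero,
    sub_add_cancel]

theorem dOdd_zero_dOdd_succ_eq_zero {x : Grass n} (hx : dOdd 0 x = 0) (i : Fin n) :
    dOdd 0 (dOdd i.succ x) = 0 := by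
  rw [dOdd_dOdd_comm, hx, map_zero, neg_zero]

theorem lin_trans {α β : S.ι} {z : ℂ} (hz : z ∈ S.overlap α β) :
    S.root α β z • D.lin α z =
      starRingEnd ℂ (deriv (S.trans α β) z) • D.lin β (S.trans α β z) := by
  rw [D.lin_glues hz, pullback, rescale_eq_self (D.dOdd_zero_lin (S.trans_mem_target hz))]

/-- The perturbation `θ ξ_i χ^i ∂/∂x`. -/
def oddPerturbation (i : Fin n) : D.Perturbation where
  i := i
  -- The sign is chosen so that ∂(ξ_i ρ)/∂θ = ξ_i ∂β/∂ξ_i.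
  ρ α z := -(theta * dOdd i.succ (D.lin α z))
  κ _ _ := 0
  smooth_ρ α := (contDiffOn_const.mul (contDiffOn_linear (dOdd i.succ) (D.contDiffOn_lin α))).neg
  smooth_κ _ := contDiffOn_const
  ρ_mem α z _ := neg_mem (mul_mem_deg theta_mem_deg (dOdd_mem_deg i.succ (D.lin_mem_deg α z)))
  κ_mem _ _ _ := zero_mem _
  glues := by
    refine S.glues_of_eq (fun α β z hz => ?_) fun α β z hz => ?_
    · have hβ := S.trans_mem_target hz
      have h := congrArg (dOdd i.succ) (D.lin_trans hz)
      rw [map_smul, map_smul] at h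
      simp only [pullback, map_mul, map_neg, rescale_xi, rescale_theta,
        rescale_eq_self (dOdd_zero_dOdd_succ_eq_zero (D.dOdd_zero_lin hβ) i)]
      generalize starRingEnd ℂ (deriv (S.trans α β) z) = c at h ⊢
      rw [← S.root_sq_eq hz, pow_two, ← smul_smul]
      simp only [smul_mul_assoc, mul_neg, smul_neg, mul_smul_comm]
      rw [smul_comm c, ← mul_smul_comm c, ← mul_smul_comm c, ← h]
      simp only [mul_smul_comm]
    -- The coefficient contains θ, so the inhomogeneous term in the law for κ vanishes by θ² = 0,
    -- and κ = 0 is consistent.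
    · have e := theta_mul_mul_theta_mul (dOdd i.succ (D.lin α z)) 1
      rw [mul_one] at e
      simp only [pullback, mul_zero, map_zero, smul_zero, add_zero, mul_neg, neg_mul,
        mul_assoc] at e ⊢
      rw [e, mul_zero, neg_zero, smul_zero]

/-- The sections `Σ η^i ξ_i` with `∂̄ η^i = χ^i`. -/
theorem exists_odd_primitive (h : ∀ X : D.Supermanifold, X.IsSplit) :
    ∃ η : S.ι → ℂ → Grass n, (∀ α, ContDiffOn ℝ ∞ (η α) (S.chart α).target) ∧
      (∀ α z, η α z ∈ deg n 1) ∧ (∀ α z, dOdd 0 (η α z) = 0) ∧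
      (∀ α, ∀ z ∈ (S.chart α).target, dxbar (η α) z = D.lin α z) ∧
      ∀ α β, ∀ z ∈ S.overlap α β, S.root α β z • η α z = η β (S.trans α β z) := by
  choose w sw dw ew gw using fun i => (D.oddPerturbation i).exists_primitive (h _)
  -- The i-th summand has ∂̄ equal to ξ_i ∂β/∂ξ_i; by Euler's identity in degree one these add up to
  -- β.
  refine ⟨fun α z => ∑ i, dOdd 0 (w i α z), fun α => ?_, fun α z => ?_, fun α z => ?_,
    fun α z hz => ?_, fun α β z hz => ?_⟩
  · exact ContDiffOn.sum fun i _ => contDiffOn_linear (dOdd 0) (sw i α)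
  · exact sum_mem fun i _ => dOdd_mem_deg 0 (dw i α z)
  · rw [map_sum]
    exact Finset.sum_eq_zero fun i _ => dOdd_dOdd 0 _
  · have hd : ∀ i, DifferentiableAt ℝ (w i α) z := fun i =>
      differentiableAt_of_isOpen (S.chart α).open_target (sw i α) hz
    have h1 : ∀ i, dxbar (fun x => dOdd 0 (w i α x)) z = xi i * dOdd i.succ (D.lin α z) := by
      intro i
      rw [D.dxbar_dOdd_eq hz (hd i), ew i α z hz]
      change dOdd 0 (xi i * -(theta * dOdd i.succ (D.lin α z))) = _
      rw [dOdd_zero_xi_mul, map_neg, dOdd_zero_theta_mul,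
        dOdd_zero_dOdd_succ_eq_zero (D.dOdd_zero_lin hz), mul_zero, sub_zero, mul_neg, neg_neg]
    have h2 := theta_mul_dOdd_add_sum (D.lin_mem_deg α z)
    rw [D.dOdd_zero_lin hz, mul_zero, zero_add, Nat.cast_one, one_smul] at h2
    rw [dxbar_sum _ fun i _ => differentiableAt_linear (dOdd 0) (hd i), ← h2]
    exact Finset.sum_congr rfl fun i _ => h1 i
  · rw [Finset.smul_sum]
    exact Finset.sum_congr rfl fun i _ => S.root_smul_dOdd_eq hz (gw i α β z hz)

/-- A smooth section of degree two without `θ` of the `(0,1)`-forms with values in the tangent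
bundle of `C`. -/
structure IsEvenForm (R : S.ι → ℂ → Grass n) : Prop where
  smooth : ∀ α, ContDiffOn ℝ ∞ (R α) (S.chart α).target
  mem : ∀ α, ∀ z ∈ (S.chart α).target, R α z ∈ deg n 2
  dOdd_eq : ∀ α, ∀ z ∈ (S.chart α).target, dOdd 0 (R α z) = 0
  glue : ∀ α β, ∀ z ∈ S.overlap α β, deriv (S.trans α β) z • R α z =
    starRingEnd ℂ (deriv (S.trans α β) z) • R β (S.trans α β z)

variable {D} in
/-- The superconformal perturbation `ξ_i ρ ∂/∂x + (ξ_i ρ)' θ/2 ∂/∂θ`, where `2ρ = ∂R/∂ξ_i`. -/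
def IsEvenForm.perturbation {R : S.ι → ℂ → Grass n} (hR : IsEvenForm R) (i : Fin n) :
    D.Perturbation where
  i := i
  ρ α z := (1 / 2 : ℂ) • dOdd i.succ (R α z)
  -- The sign comes from moving ξ_i past θ: ξ_i κ equals ½θ(ξ_i ρ)'. Without this superconformal
  -- completion the form ξ_i ρ ∂/∂x would not glue.
  κ α z := -((1 / 2 : ℂ) • (theta * dx (fun w => (1 / 2 : ℂ) • dOdd i.succ (R α w)) z))
  smooth_ρ α := contDiffOn_linear ((1 / 2 : ℂ) • dOdd i.succ) (hR.smooth α)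
  smooth_κ α := (contDiffOn_linear ((1 / 2 : ℂ) • LinearMap.mulLeft ℂ theta)
    (contDiffOn_dx (S.chart α).open_target
      (contDiffOn_linear ((1 / 2 : ℂ) • dOdd i.succ) (hR.smooth α)))).neg
  ρ_mem α z hz := Submodule.smul_mem _ _ (dOdd_mem_deg i.succ (hR.mem α z hz))
  κ_mem α z hz := by
    have sρ : ContDiffOn ℝ ∞ (fun w => (1 / 2 : ℂ) • dOdd i.succ (R α w)) (S.chart α).target :=
      contDiffOn_linear ((1 / 2 : ℂ) • dOdd i.succ) (hR.smooth α)
    refine neg_mem (Submodule.smul_mem _ _ (mul_mem_deg (k := 1) (l := 1) theta_mem_deg (dx_mem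
      (differentiableAt_of_isOpen (S.chart α).open_target sρ hz) ?_)))
    filter_upwards [(S.chart α).open_target.mem_nhds hz] with w hw using
      Submodule.smul_mem _ _ (dOdd_mem_deg i.succ (hR.mem α w hw))
  glues := by
    let ρ : S.ι → ℂ → Grass n := fun α z => (1 / 2 : ℂ) • dOdd i.succ (R α z)
    have sρ : ∀ α, ContDiffOn ℝ ∞ (ρ α) (S.chart α).target := fun α =>
      contDiffOn_linear ((1 / 2 : ℂ) • dOdd i.succ) (hR.smooth α)
    have hmem : ∀ α, ∀ z ∈ (S.chart α).target, xi i * ρ α z ∈ deg n 2 := fun α z hz =>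
      mul_mem_deg (xi_mem_deg i) (Submodule.smul_mem _ _ (dOdd_mem_deg i.succ (hR.mem α z hz)))
    have hg := S.glues_superconformalField (u := fun α z => xi i * ρ α z) (η := fun _ _ => 0)
      (c := fun α β z => starRingEnd ℂ (deriv (S.trans α β) z))
      (fun α β z hz => differentiableAt_conj (S.differentiableAt_deriv_trans hz))
      (fun α β z hz => dx_conj (S.differentiableAt_deriv_trans hz))
      (fun α => contDiffOn_const.mul (sρ α))
      (fun α z hz => parity_of_mem_deg_two (hmem α z hz))
      (fun α z hz => by
        rw [dOdd_zero_xi_mul, map_smul, dOdd_zero_dOdd_succ_eq_zero (hR.dOdd_eq α z hz), smul_zero,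
          mul_zero, neg_zero])
      (fun α z hz => map_zero _)
      (fun α β z hz => by
        have h := congrArg (dOdd i.succ) (hR.glue α β z hz)
        rw [map_smul, map_smul] at h
        simp only [ρ, mul_smul_comm]
        rw [smul_comm, ← mul_smul_comm, h, mul_smul_comm, smul_comm])
      (fun α β z hz => by rw [smul_zero, smul_zero])
    refine Glues.congr S hg (fun α z hz => ?_) fun α z hz => ?_
    · simp only [superconformalField, mul_zero, add_zero, ρ]
    · simp only [superconformalField, zero_add]
      rw [dx_const_mul _ (differentiableAt_of_isOpen (S.chart α).open_target (sρ α) hz), mul_neg,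
        mul_smul_comm, ← mul_assoc, ← mul_assoc, mul_theta, parity_xi, mul_neg, neg_mul, smul_neg,
        neg_neg]

variable {D} in
-- The primitives for the individual ξ_i are summed. Euler's identity in degree two produces 2R,
-- which the factor ½ in ρ compensates.
theorem IsEvenForm.exists_primitive {R : S.ι → ℂ → Grass n} (hR : IsEvenForm R)
    (h : ∀ X : D.Supermanifold, X.IsSplit) :
    ∃ w : S.ι → ℂ → Grass n, (∀ α, ContDiffOn ℝ ∞ (w α) (S.chart α).target) ∧
      (∀ α z, w α z ∈ deg n 2) ∧
      (∀ α, ∀ z ∈ (S.chart α).target, (D.base α).dbar (w α) z = R α z) ∧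
      ∀ α β, ∀ z ∈ S.overlap α β, deriv (S.trans α β) z • w α z = S.pullback α β (w β) z := by
  choose w sw dw ew gw using fun i =>
    (hR.perturbation (D := D) i).exists_primitive (h _)
  refine ⟨fun α z => ∑ i, w i α z, fun α => ContDiffOn.sum fun i _ => sw i α,
    fun α z => sum_mem fun i _ => dw i α z, fun α z hz => ?_, fun α β z hz => ?_⟩
  · have hd : ∀ i, DifferentiableAt ℝ (w i α) z := fun i =>
      differentiableAt_of_isOpen (S.chart α).open_target (sw i α) hz
    have h1 : (D.base α).dbar (fun z => ∑ i, w i α z) z = ∑ i, (D.base α).dbar (w i α) z := by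
      simp only [base_dbar]
      rw [dxbar_sum _ fun i _ => hd i, map_sum, Finset.mul_sum, Finset.sum_sub_distrib]
    have h2 := theta_mul_dOdd_add_sum (hR.mem α z hz)
    rw [hR.dOdd_eq α z hz, mul_zero, zero_add] at h2
    have h3 : ∀ i, (D.base α).dbar (w i α) z = (1 / 2 : ℂ) • (xi i * dOdd i.succ (R α z)) :=
      fun i => (ew i α z hz).trans (mul_smul_comm _ _ _)
    rw [h1, Finset.sum_congr rfl fun i _ => h3 i, ← Finset.smul_sum, h2, smul_smul]
    norm_num
  · rw [Finset.smul_sum, pullback, map_sum]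
    exact Finset.sum_congr rfl fun i _ => gw i α β z hz

theorem degPart_sub_degPart {k m : ℕ} {x : Grass n} (h : m ≠ k → degPart m x = 0) :
    degPart m (x - degPart k x) = 0 := by
  rw [map_sub]
  by_cases hm : m = k
  · rw [hm, degPart_of_mem (degPart_mem k x), sub_self]
  · rw [h hm, degPart_of_mem_ne (degPart_mem k x) (Ne.symm hm), sub_zero]

theorem degPart_cx {α : S.ι} {z : ℂ} (hz : z ∈ (S.chart α).target) {m : ℕ} (hm : m < 4)
    (h : m ≠ 2) : degPart m ((D.φ α).cx z) = 0 := by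
  have he := (D.superconformal α).parity_cx z hz
  interval_cases m
  · rw [degPart_zero_eq, body_of_mem_xiIdeal (D.vanishes α z hz).1, map_zero]
  · exact degPart_eq_zero_of_even odd_one he
  · exact absurd rfl h
  · exact degPart_eq_zero_of_even (by decide) he

theorem degPart_cθ {α : S.ι} {z : ℂ} (hz : z ∈ (S.chart α).target) {m : ℕ} (hm : m < 3)
    (h : m ≠ 1) : degPart m ((D.φ α).cθ z) = 0 := by
  have he := (D.superconformal α).parity_cθ z hz
  interval_cases m
  · exact degPart_eq_zero_of_odd (by decide) he
  · exact absurd rfl h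
  · exact degPart_eq_zero_of_odd (by decide) he

/-- The component of degree two of `φ`, at `θ = 0`. -/
def quad (α : S.ι) (z : ℂ) : Grass n := rescale 0 (degPart 2 ((D.φ α).cx z))

/-- The coefficient is odd, so below degree three only its degree-one part β occurs; at θ = 0 what
remains has order at least three in ξ. -/
theorem rescale_cθ_sub_lin_mem {α : S.ι} {z : ℂ} (hz : z ∈ (S.chart α).target) :
    rescale 0 ((D.φ α).cθ z) - D.lin α z ∈ xiPow n 3 := by
  rw [← rescale_eq_self (D.dOdd_zero_lin hz) 0, ← map_sub]
  exact rescale_zero_mem_xiPow_of_degPart fun m hm =>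
    degPart_sub_degPart fun h => D.degPart_cθ hz hm h

theorem rescale_cx_sub_quad_mem {α : S.ι} {z : ℂ} (hz : z ∈ (S.chart α).target) :
    rescale 0 ((D.φ α).cx z) - D.quad α z ∈ xiPow n 3 := by
  rw [quad, ← map_sub]
  exact rescale_zero_mem_xiPow_of_degPart fun m hm =>
    degPart_sub_degPart fun h => D.degPart_cx hz (by omega) h

theorem isPotentialOn (α : S.ι) :
    IsPotentialOn (fun z => rescale 0 ((D.φ α).cx z)) (fun z => rescale 0 ((D.φ α).cθ z))
      (S.chart α).target where
  smooth_u := contDiffOn_linear (rescale (n := n) 0).toLinearMap (D.superconformal α).smooth_cx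
  smooth_η := contDiffOn_linear (rescale (n := n) 0).toLinearMap (D.superconformal α).smooth_cθ
  parity_u z hz := by rw [← rescale_parity, (D.superconformal α).parity_cx z hz]
  parity_η z hz := by rw [← rescale_parity, (D.superconformal α).parity_cθ z hz, map_neg]
  dOdd_u _ _ := dOdd_zero_rescale_zero _
  dOdd_η _ _ := dOdd_zero_rescale_zero _
  u_mem _ hz := rescale_zero_mem_xiPow_of_degPart fun _ hm =>
    D.degPart_cx hz (by omega) (by omega)
  η_mem _ hz := rescale_zero_mem_xiPow_of_degPart fun _ hm =>
    D.degPart_cθ hz (by omega) (by omega)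

theorem quad_trans {α β : S.ι} {z : ℂ} (hz : z ∈ S.overlap α β) :
    deriv (S.trans α β) z • D.quad α z =
      starRingEnd ℂ (deriv (S.trans α β) z) • D.quad β (S.trans α β z) := by
  have h := congrArg (fun x => rescale 0 (degPart 2 x)) (D.glues.cx_eq S hz)
  simp only [map_smul, pullback, degPart_rescale, rescale_rescale, mul_zero] at h
  exact h

/-- This is the right-hand side of the equation for u. The product ηβ has the weight of a (0,1)-form
with values in T_C because η and β each carry one factor ζ. -/
theorem isEvenForm_quad_sub {η : S.ι → ℂ → Grass n}
    (sη : ∀ α, ContDiffOn ℝ ∞ (η α) (S.chart α).target) (dη : ∀ α z, η α z ∈ deg n 1)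
    (η0 : ∀ α z, dOdd 0 (η α z) = 0)
    (gη : ∀ α β, ∀ z ∈ S.overlap α β, S.root α β z • η α z = η β (S.trans α β z)) :
    IsEvenForm fun α z => D.quad α z - η α z * D.lin α z where
  smooth α := (contDiffOn_linear ((rescale (n := n) 0).toLinearMap.comp (degPart 2))
    (D.superconformal α).smooth_cx).sub ((sη α).mul (D.contDiffOn_lin α))
  mem α z _ := sub_mem (rescale_mem_deg 0 (degPart_mem 2 _))
    (mul_mem_deg (dη α z) (D.lin_mem_deg α z))
  dOdd_eq α z hz := by
    rw [map_sub, quad, dOdd_zero_rescale_zero, dOdd_mul, η0, D.dOdd_zero_lin hz, zero_mul, mul_zero,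
      add_zero, sub_zero]
  glue α β z hz := by
    have h1 := D.quad_trans hz
    have h2 := D.lin_trans hz
    generalize starRingEnd ℂ (deriv (S.trans α β) z) = c at h1 h2 ⊢
    rw [smul_sub, smul_sub, h1, ← gη α β z hz, ← S.root_sq_eq hz, pow_two, ← smul_smul,
      ← mul_smul_comm, h2]
    simp only [mul_smul_comm, smul_mul_assoc]
    rw [smul_comm]

/-- If all supermanifolds modelled on `(C, T^*_{𝒳^an,-})` split, then the deformation is trivial to
second order. -/
theorem isTrivialToSecondOrder_of_isSplit (h : ∀ X : D.Supermanifold, X.IsSplit) :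
    D.IsTrivialToSecondOrder := by
  obtain ⟨η, sη, dη, η0, eη, gη⟩ := D.exists_odd_primitive h
  obtain ⟨w, sw, dw, ew, gw⟩ := (D.isEvenForm_quad_sub sη dη η0 gη).exists_primitive h
  have hR := D.isEvenForm_quad_sub sη dη η0 gη
  -- The ∂̄ of w|_{θ=0} is R + β ∂w/∂θ. Subtracting η ∂w/∂θ removes the second term, since ∂̄η = β
  -- and ∂̄(∂w/∂θ) = ∂R/∂θ = 0.
  let u : S.ι → ℂ → Grass n := fun α z => rescale 0 (w α z) - η α z * dOdd 0 (w α z)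
  have s1 : ∀ α, ContDiffOn ℝ ∞ (fun z => rescale 0 (w α z)) (S.chart α).target := fun α =>
    contDiffOn_linear (rescale (n := n) 0).toLinearMap (sw α)
  have s2 : ∀ α, ContDiffOn ℝ ∞ (fun z => dOdd 0 (w α z)) (S.chart α).target := fun α =>
    contDiffOn_linear (dOdd 0) (sw α)
  have du : ∀ α z, u α z ∈ deg n 2 := fun α z =>
    sub_mem (rescale_mem_deg 0 (dw α z)) (mul_mem_deg (dη α z) (dOdd_mem_deg 0 (dw α z)))
  have u0 : ∀ α z, dOdd 0 (u α z) = 0 := fun α z => by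
    rw [map_sub, dOdd_zero_rescale_zero, dOdd_mul, η0, dOdd_dOdd, zero_mul, mul_zero, add_zero,
      sub_zero]
  have gu : ∀ α β, ∀ z ∈ S.overlap α β,
      deriv (S.trans α β) z • u α z = u β (S.trans α β z) := by
    intro α β z hz
    have h1 := congrArg (rescale 0) (gw α β z hz)
    rw [map_smul, pullback, rescale_rescale, mul_zero] at h1
    simp only [u]
    rw [smul_sub, h1, ← gη α β z hz, ← S.root_smul_dOdd_eq hz (gw α β z hz), ← S.root_sq_eq hz,
      smul_mul_smul_comm, pow_two]
  have pot : ∀ α, IsPotentialOn (u α) (η α) (S.chart α).target := fun α =>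
    { smooth_u := (s1 α).sub ((sη α).mul (s2 α))
      smooth_η := sη α
      parity_u := fun z _ => parity_of_mem_deg_two (du α z)
      parity_η := fun z _ => parity_of_mem_deg_one (dη α z)
      dOdd_u := fun z _ => u0 α z
      dOdd_η := fun z _ => η0 α z
      u_mem := fun z _ => mem_xiPow_of_mem_deg (du α z) (u0 α z)
      η_mem := fun z _ => mem_xiPow_of_mem_deg (dη α z) (η0 α z) }
  have eu : ∀ α, ∀ z ∈ (S.chart α).target, dxbar (u α) z = D.quad α z - η α z * D.lin α z := by
    intro α z hz
    have d {F : ℂ → Grass n} (hF : ContDiffOn ℝ ∞ F (S.chart α).target) : DifferentiableAt ℝ F z :=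
      differentiableAt_of_isOpen (S.chart α).open_target hF hz
    have a := dxbar_sub (d (s1 α)) (d ((sη α).mul (s2 α)))
    have b := dxbar_mul (d (sη α)) (d (s2 α))
    rw [D.dxbar_dOdd_eq hz (d (sw α)), ew α z hz, hR.dOdd_eq α z hz, mul_zero, add_zero,
      eη α z hz] at b
    have c := D.dxbar_rescale_zero_eq hz (d (sw α))
    rw [ew α z hz, rescale_eq_self (hR.dOdd_eq α z hz)] at c
    refine a.trans ((congrArg₂ (· - ·) c b).trans ?_)
    exact add_sub_cancel_right _ _
  refine ⟨fun α => superconformalField (u α) (η α),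
    fun α => (pot α).isEvenSuperconformalOn (S.chart α).open_target, fun α z hz => ?_, ?_,
    fun α G hG z hz => ?_⟩
  · have hn := (pot α).isNilpotentOn (S.chart α).open_target
    exact ⟨xiPow_one_subset (hn.cx_mem z hz), xiPow_one_subset (hn.cθ_mem z hz)⟩
  · refine S.glues_superconformalField (fun α β z _ => differentiableAt_const _)
      (fun α β z _ => dx_const _ _) (fun α => (pot α).smooth_u) (fun α => (pot α).parity_u)
      (fun α => (pot α).dOdd_u) (fun α => (pot α).dOdd_η) (fun α β z hz => ?_) fun α β z hz => ?_
    · rw [one_smul, gu α β z hz]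
    · rw [one_smul, gη α β z hz]
  · refine xiPow_three_subset ?_
    have hp : ∀ z ∈ (S.chart α).target,
        dxbar (η α) z - rescale 0 ((D.φ α).cθ z) ∈ xiPow n 3 := fun z hz => by
      rw [eη α z hz, ← neg_sub]
      exact neg_mem (D.rescale_cθ_sub_lin_mem hz)
    have key := (pot α).dxbar_expTwo_mem (D.isPotentialOn α) (S.chart α).open_target hp
      (fun z hz => by
        have e : dxbar (u α) z - (rescale 0 ((D.φ α).cx z) - η α z * rescale 0 ((D.φ α).cθ z)) =
            η α z * (rescale 0 ((D.φ α).cθ z) - D.lin α z) -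
              (rescale 0 ((D.φ α).cx z) - D.quad α z) := by
          rw [eu α z hz, mul_sub]
          abel
        rw [e]
        exact sub_mem (mul_mem_xiPow_right _ (D.rescale_cθ_sub_lin_mem hz))
          (D.rescale_cx_sub_quad_mem hz)) hG hz
    -- φ is the superconformal field of its own values at θ = 0, so the estimate obtained for that
    -- field is the one required for ∂̄_ξ.
    obtain ⟨e1, e2⟩ := (D.superconformal α).eq_superconformalField (S.chart α).open_target hz
    rw [dbarXi, VField.app, e1, e2]
    exact key

end AnalyticDeformation

end Primitives

end SuperRiemann
end

theorem mainTheorem3 {C : Type*} [TopologicalSpace C] [T2Space C] [ConnectedSpace C]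
    [ChartedSpace ℂ C] [IsManifold 𝓘(ℂ) ω C]
    (S : SuperRiemann.SpinAtlas C) (n : ℕ) (D : SuperRiemann.AnalyticDeformation S n)
    (hD : ¬ D.IsTrivialToSecondOrder) :
    ∃ X : D.Supermanifold, ¬ X.IsSplit := by
  by_contra h
  push Not at h
  exact hD (D.isTrivialToSecondOrder_of_isSplit h)
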